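/- Let $k$ be an algebraically closed field of characteristic zero. A fusion category over $k$ is a $k$-linear semisimple rigid monoidal category with finitely many isomorphism classes of simple objects, finite-dimensional spaces of morphisms and simple unit object; it is pointed if all its simple objects are invertible. For a finite abelian group $G$, let $\mathrm{Vec}_G$ be the pointed fusion category of finite-dimensional $G$-graded vector spaces with trivial associator, and let $\boxtimes$ be the Deligne tensor product. Let $\mathfrak I$ be an Ising fusion category over $k$, that is, a fusion category whose simple objects up to isomorphism are three pairwise non-isomorphic objects $\mathbf 1,\delta,Z$ with $\delta\otimes\delta\cong\mathbf 1$ and $Z\otimes Z\cong\mathbf 1\oplus\delta$ (for example the semisimplification of the representation category of $U_{-q}(\mathfrak{sl}_2)$, $q=\exp(i\pi/4)$). For $M\ge 2$ even, let $\mathcal C_M$ be the fusion subcategory of $\mathfrak I\boxtimes\mathrm{Vec}_{\mathbb Z/M}$ generated by the simple object $Z\boxtimes 1$, where $1$ denotes the one-dimensional space in degree $1\in\mathbb Z/M$. For $N\ge 1$ put $\mathfrak I_N=\mathcal C_{2^N}$. Let $M=2^N m$ with $N\ge 1$ and $m\geq 1$ odd. Then $\mathcal B=\mathrm{Vec}_{\mathbb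 Z/m}$ is a pointed fusion category, and there is an equivalence of fusion categories (a $k$-linear monoidal equivalence) $$F:\mathcal C_M\to\mathfrak I_N\boxtimes\mathcal B .$$ Moreover, for every braiding on $\mathcal C_M$ there are braidings on $\mathfrak I_N$ and on $\mathcal B$ such that $F$ is a braided equivalence, where $\mathfrak I_N\boxtimes\mathcal B$ carries the product braiding. -/

import Mathlib

open CategoryTheory MonoidalCategory Limits

universe w v v₁ v₂ u u₁ u₂

noncomputable section

namespace IsingCM

/-! ### Monoidal structure on the additive completion `Mat_ C`

The objects of `Mat_ C` are the finite formal direct sums of objects of `C` and its morphisms are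
matrices of morphisms of `C`. -/

section Additive

variable {C : Type u} [Category.{v} C] [Preadditive C]

open scoped Classical in
/-- The morphism of formal direct sums that sends the `i`-th summand to the `f i`-th summand
through `φ i`. -/
def single {M N : Mat_ C} (f : M.ι → N.ι) (φ : ∀ i, M.X i ⟶ N.X (f i)) : M ⟶ N :=
  fun i j => if h : f i = j then φ i ≫ eqToHom (congrArg N.X h) else 0

theorem single_self {M N : Mat_ C} (f : M.ι → N.ι) (φ : ∀ i, M.X i ⟶ N.X (f i)) (i : M.ι) :
    single f φ i (f i) = φ i := by
  simp [single]

theorem single_ne {M N : Mat_ C} (f : M.ι → N.ι) (φ : ∀ i, M.X i ⟶ N.X (f i)) {i : M.ι}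
    {j : N.ι} (h : f i ≠ j) : single f φ i j = 0 := by
  simp [single, h]

theorem id_eq_single (M : Mat_ C) : 𝟙 M = single (fun i => i) (fun i => 𝟙 (M.X i)) := by
  ext i j
  by_cases h : i = j
  · subst h
    rw [single_self (N := M) (fun i => i) (fun i => 𝟙 (M.X i)) i]; simp
  · rw [single_ne _ _ h]; simp [h]

theorem single_comp {M N K : Mat_ C} (f : M.ι → N.ι) (φ : ∀ i, M.X i ⟶ N.X (f i)) (g : N ⟶ K)
    (i : M.ι) (k : K.ι) : (single f φ ≫ g) i k = φ i ≫ g (f i) k := by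
  rw [Mat_.comp_apply, Finset.sum_eq_single (f i)]
  · rw [single_self]
  · intro j _ hj
    rw [single_ne _ _ (Ne.symm hj), zero_comp]
  · intro h; exact absurd (Finset.mem_univ _) h

theorem comp_single {M N K : Mat_ C} (g : M ⟶ N) (f : N.ι → K.ι) (hf : Function.Injective f)
    (φ : ∀ i, N.X i ⟶ K.X (f i)) (i : M.ι) (j : N.ι) :
    (g ≫ single f φ) i (f j) = g i j ≫ φ j := by
  rw [Mat_.comp_apply, Finset.sum_eq_single j]
  · rw [single_self]
  · intro b _ hb
    rw [single_ne _ _ (fun h => hb (hf h)), comp_zero]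
  · intro h; exact absurd (Finset.mem_univ _) h

theorem single_comp_single {M N K : Mat_ C} (f : M.ι → N.ι) (φ : ∀ i, M.X i ⟶ N.X (f i))
    (g : N.ι → K.ι) (ψ : ∀ i, N.X i ⟶ K.X (g i)) :
    single f φ ≫ single g ψ = single (M := M) (N := K) (fun i => g (f i))
      (fun i => φ i ≫ ψ (f i)) := by
  ext i k
  rw [single_comp]
  by_cases h : g (f i) = k
  · subst h
    rw [single_self, single_self (M := M) (N := K) (fun i => g (f i))]
  · rw [single_ne _ _ h, single_ne (M := M) (N := K) (fun i => g (f i)) _ h, comp_zero]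

/-- An isomorphism of formal direct sums given by a reindexing and isomorphisms of summands. -/
def singleIso {M N : Mat_ C} (e : M.ι ≃ N.ι) (φ : ∀ i, M.X i ≅ N.X (e i)) : M ≅ N where
  hom := single e fun i => (φ i).hom
  inv := single e.symm fun j => eqToHom (congrArg N.X (e.apply_symm_apply j).symm) ≫
    (φ (e.symm j)).inv
  hom_inv_id := by
    ext i k
    rw [single_comp]
    obtain ⟨j, rfl⟩ : ∃ j, e.symm j = k := e.symm.surjective k
    by_cases h : e i = j
    · subst h
      rw [single_self]
      have : ∀ (a b : M.ι) (h : a = b) (h' : N.X (e b) = N.X (e a)),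
          (φ b).hom ≫ eqToHom h' ≫ (φ a).inv = (𝟙 M : M ⟶ M) b a := by
        rintro a b rfl h'; simp
      exact this _ _ (by simp) _
    · rw [single_ne _ _ (fun h' => h (e.symm.injective h')), comp_zero,
        Mat_.id_apply_of_ne]
      intro h'; exact h (by rw [h']; simp)
  inv_hom_id := by
    ext j k
    rw [single_comp]
    by_cases h : j = k
    · subst h
      simp [single]
    · rw [single_ne _ _ (by simpa using h), comp_zero, Mat_.id_apply_of_ne _ _ _ h]

@[simp]
theorem singleIso_hom {M N : Mat_ C} (e : M.ι ≃ N.ι) (φ : ∀ i, M.X i ≅ N.X (e i)) :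
    (singleIso e φ).hom = single e fun i => (φ i).hom := rfl

section Linear

variable (k : Type w) [Semiring k] [Linear k C]

instance matHomModule (M N : Mat_ C) : Module k (M ⟶ N) :=
  inferInstanceAs (Module k (∀ i j, M.X i ⟶ N.X j))

theorem smul_apply {M N : Mat_ C} (r : k) (f : M ⟶ N) (i : M.ι) (j : N.ι) :
    (r • f) i j = r • f i j := rfl

instance matLinear : Linear k (Mat_ C) where
  smul_comp X Y Z r f g := by
    ext i j
    simp [smul_apply, Finset.smul_sum]
  comp_smul X Y Z f r g := by
    ext i j
    simp [smul_apply, Finset.smul_sum]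

end Linear

variable [MonoidalCategory C] [MonoidalPreadditive C]

/-- The tensor product of formal direct sums, distributing over the summands. -/
abbrev tensorMat (M N : Mat_ C) : Mat_ C := ⟨M.ι × N.ι, fun p => M.X p.1 ⊗ N.X p.2⟩

/-- The unit object: a single summand, which is the unit object of `C`. -/
abbrev unitMat (C : Type u) [Category.{v} C] [Preadditive C] [MonoidalCategory C] : Mat_ C :=
  ⟨Unit, fun _ => 𝟙_ C⟩

/-- The Kronecker product of two matrices of morphisms. -/
def tensorMatHom {M M' N N' : Mat_ C} (f : M ⟶ M') (g : N ⟶ N') :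
    tensorMat M N ⟶ tensorMat M' N' :=
  fun p q => f p.1 q.1 ⊗ₘ g p.2 q.2

theorem tensorMatHom_single {M M' N N' : Mat_ C} (f : M.ι → M'.ι)
    (φ : ∀ i, M.X i ⟶ M'.X (f i)) (g : N.ι → N'.ι) (ψ : ∀ i, N.X i ⟶ N'.X (g i)) :
    tensorMatHom (single f φ) (single g ψ) =
      single (M := tensorMat M N) (N := tensorMat M' N') (fun p => (f p.1, g p.2))
        (fun p => φ p.1 ⊗ₘ ψ p.2) := by
  ext ⟨i, j⟩ ⟨i', j'⟩
  change single f φ i i' ⊗ₘ single g ψ j j' = _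
  by_cases h : f i = i'
  · subst h
    by_cases h' : g j = j'
    · subst h'
      rw [single_self, single_self]
      exact (single_self (M := tensorMat M N) (N := tensorMat M' N')
        (fun p => (f p.1, g p.2)) (fun p => φ p.1 ⊗ₘ ψ p.2) (i, j)).symm
    · rw [single_ne g ψ h', MonoidalPreadditive.tensor_zero]
      exact (single_ne (M := tensorMat M N) (N := tensorMat M' N')
        (fun p => (f p.1, g p.2)) (fun p => φ p.1 ⊗ₘ ψ p.2) (i := (i, j)) (j := (f i, j'))
        (fun e => h' (Prod.ext_iff.mp e).2)).symm
  · rw [single_ne f φ h, MonoidalPreadditive.zero_tensor]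
    exact (single_ne (M := tensorMat M N) (N := tensorMat M' N')
      (fun p => (f p.1, g p.2)) (fun p => φ p.1 ⊗ₘ ψ p.2) (i := (i, j)) (j := (i', j'))
      (fun e => h (Prod.ext_iff.mp e).1)).symm

theorem tensorMatHom_id (M N : Mat_ C) : tensorMatHom (𝟙 M) (𝟙 N) = 𝟙 (tensorMat M N) := by
  rw [id_eq_single, id_eq_single, tensorMatHom_single, id_eq_single]
  congr 1
  funext p
  exact id_tensorHom_id _ _

theorem tensorMatHom_comp {M M' M'' N N' N'' : Mat_ C} (f : M ⟶ M') (f' : M' ⟶ M'')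
    (g : N ⟶ N') (g' : N' ⟶ N'') :
    tensorMatHom f g ≫ tensorMatHom f' g' = tensorMatHom (f ≫ f') (g ≫ g') := by
  ext ⟨i, j⟩ ⟨i', j'⟩
  change ∑ x : M'.ι × N'.ι, (f i x.1 ⊗ₘ g j x.2) ≫ (f' x.1 i' ⊗ₘ g' x.2 j') =
    (∑ a, f i a ≫ f' a i') ⊗ₘ (∑ b, g j b ≫ g' b j')
  rw [Fintype.sum_prod_type, sum_tensor]
  refine Finset.sum_congr rfl fun a _ => ?_
  rw [tensor_sum]
  exact Finset.sum_congr rfl fun b _ => tensorHom_comp_tensorHom _ _ _ _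

instance matMonoidalStruct : MonoidalCategoryStruct (Mat_ C) where
  tensorObj := tensorMat
  tensorHom := tensorMatHom
  whiskerLeft M _ _ g := tensorMatHom (𝟙 M) g
  whiskerRight f N := tensorMatHom f (𝟙 N)
  tensorUnit := unitMat C
  associator M N K := singleIso (M := tensorMat (tensorMat M N) K)
    (N := tensorMat M (tensorMat N K)) (Equiv.prodAssoc _ _ _) fun _ => α_ _ _ _
  leftUnitor M := singleIso (M := tensorMat (unitMat C) M) (Equiv.punitProd M.ι)
    fun _ => λ_ _
  rightUnitor M := singleIso (M := tensorMat M (unitMat C)) (Equiv.prodPUnit M.ι)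
    fun _ => ρ_ _

instance matMonoidal : MonoidalCategory (Mat_ C) :=
  MonoidalCategory.ofTensorHom
    (id_tensorHom_id := tensorMatHom_id)
    (tensorHom_comp_tensorHom := fun f f' g g' => tensorMatHom_comp f g f' g')
    (associator_naturality := by
      intro M₁ M₂ M₃ N₁ N₂ N₃ f₁ f₂ f₃
      ext ⟨⟨i₁, i₂⟩, i₃⟩ ⟨j₁, j₂, j₃⟩
      refine (comp_single (N := tensorMat (tensorMat N₁ N₂) N₃)
        (K := tensorMat N₁ (tensorMat N₂ N₃)) _ (Equiv.prodAssoc _ _ _)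
        (Equiv.injective _) _ _ ((j₁, j₂), j₃)).trans ?_
      refine Eq.trans ?_ (single_comp (M := tensorMat (tensorMat M₁ M₂) M₃)
        (N := tensorMat M₁ (tensorMat M₂ M₃)) _ _ _ _ _).symm
      exact associator_naturality _ _ _)
    (leftUnitor_naturality := by
      intro M N f
      ext ⟨⟨⟩, i⟩ j
      refine (comp_single (N := tensorMat (unitMat C) N) (K := N) _
        (Equiv.punitProd N.ι) (Equiv.injective _) _ _ ((), j)).trans ?_
      refine Eq.trans ?_ (single_comp (M := tensorMat (unitMat C) M) (N := M)
        _ _ _ _ _).symm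
      change ((𝟙 (unitMat C) : _ ⟶ _) () () ⊗ₘ f i j) ≫ (λ_ (N.X j)).hom = _
      rw [Mat_.id_apply_self, id_tensorHom, leftUnitor_naturality]; rfl)
    (rightUnitor_naturality := by
      intro M N f
      ext ⟨i, ⟨⟩⟩ j
      refine (comp_single (N := tensorMat N (unitMat C)) (K := N) _
        (Equiv.prodPUnit N.ι) (Equiv.injective _) _ _ (j, ())).trans ?_
      refine Eq.trans ?_ (single_comp (M := tensorMat M (unitMat C)) (N := M)
        _ _ _ _ _).symm
      change (f i j ⊗ₘ (𝟙 (unitMat C) : _ ⟶ _) () ()) ≫ (ρ_ (N.X j)).hom = _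
      rw [Mat_.id_apply_self, tensorHom_id, rightUnitor_naturality]; rfl)
    (pentagon := by
      intro M N K L
      change tensorMatHom (single (M := tensorMat (tensorMat M N) K)
          (N := tensorMat M (tensorMat N K)) _ _) (𝟙 L) ≫
        single (M := tensorMat (tensorMat M (tensorMat N K)) L)
          (N := tensorMat M (tensorMat (tensorMat N K) L)) _ _ ≫
        tensorMatHom (𝟙 M) (single (M := tensorMat (tensorMat N K) L)
          (N := tensorMat N (tensorMat K L)) _ _) =
        single (M := tensorMat (tensorMat (tensorMat M N) K) L)
          (N := tensorMat (tensorMat M N) (tensorMat K L)) _ _ ≫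
        single (N := tensorMat M (tensorMat N (tensorMat K L))) _ _
      rw [id_eq_single, id_eq_single, tensorMatHom_single, tensorMatHom_single]
      erw [single_comp_single, single_comp_single, single_comp_single]
      refine congrArg (single _) ?_
      funext p
      change ((α_ _ _ _).hom ⊗ₘ 𝟙 _) ≫ (α_ _ _ _).hom ≫ (𝟙 _ ⊗ₘ (α_ _ _ _).hom) =
        (α_ _ _ _).hom ≫ (α_ _ _ _).hom
      rw [tensorHom_id, id_tensorHom]
      exact MonoidalCategory.pentagon _ _ _ _)
    (triangle := by
      intro M N
      change single (M := tensorMat (tensorMat M (unitMat C)) N)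
          (N := tensorMat M (tensorMat (unitMat C) N)) _ _ ≫
        tensorMatHom (𝟙 M) (single (M := tensorMat (unitMat C) N) (N := N) _ _) =
        tensorMatHom (single (M := tensorMat M (unitMat C)) (N := M) _ _) (𝟙 N)
      rw [id_eq_single, id_eq_single, tensorMatHom_single, tensorMatHom_single]
      erw [single_comp_single]
      refine congrArg (single _) ?_
      funext p
      change (α_ _ _ _).hom ≫ (𝟙 _ ⊗ₘ (λ_ _).hom) = ((ρ_ _).hom ⊗ₘ 𝟙 _)
      rw [tensorHom_id, id_tensorHom]
      exact MonoidalCategory.triangle _ _)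

instance matMonoidalPreadditive : MonoidalPreadditive (Mat_ C) where
  whiskerLeft_zero := by
    intro M N K; ext p q; exact MonoidalPreadditive.tensor_zero _
  zero_whiskerRight := by
    intro M N K; ext p q; exact MonoidalPreadditive.zero_tensor _
  whiskerLeft_add := by
    intro M N K f g; ext p q; exact MonoidalPreadditive.tensor_add _ _ _
  add_whiskerRight := by
    intro M N K f g; ext p q; exact MonoidalPreadditive.add_tensor _ _ _

instance matMonoidalLinear (k : Type w) [CommRing k] [Linear k C] [MonoidalLinear k C] :
    MonoidalLinear k (Mat_ C) where
  whiskerLeft_smul := by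
    intro M N K r f; ext p q
    change (𝟙 M : M ⟶ M) p.1 q.1 ⊗ₘ (r • f p.2 q.2) = r • ((𝟙 M : M ⟶ M) p.1 q.1 ⊗ₘ f p.2 q.2)
    simp [MonoidalCategory.tensorHom_def]
  smul_whiskerRight := by
    intro r N K f M; ext p q
    change (r • f p.1 q.1) ⊗ₘ (𝟙 M : M ⟶ M) p.2 q.2 = r • (f p.1 q.1 ⊗ₘ (𝟙 M : M ⟶ M) p.2 q.2)
    simp [MonoidalCategory.tensorHom_def]

set_option linter.unusedSectionVars false in
theorem associator_inv_eq_single (M N K : Mat_ C) :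
    (α_ M N K).inv = single (M := tensorMat M (tensorMat N K)) (N := tensorMat (tensorMat M N) K)
      (Equiv.prodAssoc _ _ _).symm (fun _ => (α_ _ _ _).inv) := by
  refine Iso.inv_ext ?_
  change single (M := tensorMat (tensorMat M N) K) (N := tensorMat M (tensorMat N K)) _ _ ≫ _ = _
  erw [single_comp_single]
  rw [id_eq_single]
  refine congrArg (single _) ?_
  funext p
  exact Iso.hom_inv_id _

/-- A braiding of `C` extends to formal direct sums, summand by summand. -/
instance matBraided [BraidedCategory C] : BraidedCategory (Mat_ C) where
  braiding M N := singleIso (M := tensorMat M N) (N := tensorMat N M) (Equiv.prodComm _ _)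
    fun _ => β_ _ _
  braiding_naturality_right M N K f := by
    ext ⟨i, j⟩ ⟨j', i'⟩
    refine (comp_single (N := tensorMat M K) (K := tensorMat K M) _ (Equiv.prodComm _ _)
      (Equiv.injective _) _ _ (i', j')).trans ?_
    refine Eq.trans ?_ (single_comp (M := tensorMat M N) (N := tensorMat N M) _ _ _ _ _).symm
    exact BraidedCategory.braiding_naturality _ _
  braiding_naturality_left {N K} f M := by
    ext ⟨i, j⟩ ⟨j', i'⟩
    refine (comp_single (N := tensorMat K M) (K := tensorMat M K) _ (Equiv.prodComm _ _)
      (Equiv.injective _) _ _ (i', j')).trans ?_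
    refine Eq.trans ?_ (single_comp (M := tensorMat N M) (N := tensorMat M N) _ _ _ _ _).symm
    exact BraidedCategory.braiding_naturality _ _
  hexagon_forward M N K := by
    change single (M := tensorMat (tensorMat M N) K) (N := tensorMat M (tensorMat N K)) _ _ ≫
        single (N := tensorMat (tensorMat N K) M) _ _ ≫
        single (N := tensorMat N (tensorMat K M)) _ _ =
      tensorMatHom (single (M := tensorMat M N) (N := tensorMat N M) _ _) (𝟙 K) ≫
        single (M := tensorMat (tensorMat N M) K) (N := tensorMat N (tensorMat M K)) _ _ ≫
        tensorMatHom (𝟙 N) (single (M := tensorMat M K) (N := tensorMat K M) _ _)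
    rw [id_eq_single, id_eq_single, tensorMatHom_single, tensorMatHom_single]
    erw [single_comp_single, single_comp_single, single_comp_single, single_comp_single]
    refine congrArg (single _) ?_
    funext p
    change (α_ _ _ _).hom ≫ (β_ _ _).hom ≫ (α_ _ _ _).hom =
      ((β_ _ _).hom ⊗ₘ 𝟙 _) ≫ (α_ _ _ _).hom ≫ (𝟙 _ ⊗ₘ (β_ _ _).hom)
    rw [tensorHom_id, id_tensorHom]
    exact BraidedCategory.hexagon_forward _ _ _
  hexagon_reverse M N K := by
    change (α_ M N K).inv ≫ single (M := tensorMat (tensorMat M N) K)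
        (N := tensorMat K (tensorMat M N)) _ _ ≫ (α_ K M N).inv =
      tensorMatHom (𝟙 M) (single (M := tensorMat N K) (N := tensorMat K N) _ _) ≫
        (α_ M K N).inv ≫ tensorMatHom (single (M := tensorMat M K) (N := tensorMat K M) _ _) (𝟙 N)
    rw [id_eq_single, id_eq_single, tensorMatHom_single, tensorMatHom_single,
      associator_inv_eq_single, associator_inv_eq_single, associator_inv_eq_single]
    erw [single_comp_single, single_comp_single, single_comp_single, single_comp_single]
    refine congrArg (single _) ?_
    funext p
    change (α_ _ _ _).inv ≫ (β_ _ _).hom ≫ (α_ _ _ _).inv =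
      (𝟙 _ ⊗ₘ (β_ _ _).hom) ≫ (α_ _ _ _).inv ≫ ((β_ _ _).hom ⊗ₘ 𝟙 _)
    rw [tensorHom_id, id_tensorHom]
    exact BraidedCategory.hexagon_reverse _ _ _

end Additive

/-! ### The tensor product of two linear categories -/

section LinTensor

/-- The tensor product over `k` of two `k`-linear categories: an object is a pair of objects, and
the space of morphisms is the tensor product over `k` of the two spaces of morphisms. -/
structure LinTensor (k : Type w) (A : Type u₁) (B : Type u₂) where
  /-- the first component -/
  left : A
  /-- the second component -/
  right : B

open TensorProduct

variable (k : Type w) [CommRing k]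
  (A : Type u₁) [Category.{v₁} A] [Preadditive A] [Linear k A]
  (B : Type u₂) [Category.{v₂} B] [Preadditive B] [Linear k B]

variable {k A B} in
/-- Composition in the tensor product category: `(f ⊗ g) ≫ (f' ⊗ g') = (f ≫ f') ⊗ (g ≫ g')`. -/
def LinTensor.compMap (X Y Z : LinTensor k A B) :
    ((X.left ⟶ Y.left) ⊗[k] (X.right ⟶ Y.right)) →ₗ[k]
      ((Y.left ⟶ Z.left) ⊗[k] (Y.right ⟶ Z.right)) →ₗ[k]
      ((X.left ⟶ Z.left) ⊗[k] (X.right ⟶ Z.right)) :=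
  TensorProduct.map₂ (Linear.comp X.left Y.left Z.left) (Linear.comp X.right Y.right Z.right)

instance LinTensor.category : Category (LinTensor k A B) where
  Hom X Y := (X.left ⟶ Y.left) ⊗[k] (X.right ⟶ Y.right)
  id X := 𝟙 X.left ⊗ₜ 𝟙 X.right
  comp {X Y Z} f g := LinTensor.compMap X Y Z f g
  id_comp {X Y} f := by
    induction f using TensorProduct.induction_on with
    | zero => simp
    | tmul a b => simp [LinTensor.compMap]
    | add a b ha hb => rw [map_add, ha, hb]
  comp_id {X Y} f := by
    induction f using TensorProduct.induction_on with
    | zero => simp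
    | tmul a b => simp [LinTensor.compMap]
    | add a b ha hb => rw [map_add, LinearMap.add_apply, ha, hb]
  assoc {W X Y Z} f g h := by
    induction f using TensorProduct.induction_on with
    | zero => simp
    | add a b ha hb => simp only [map_add, LinearMap.add_apply, ha, hb]
    | tmul a b =>
      induction g using TensorProduct.induction_on with
      | zero => simp
      | add a b ha hb => simp only [map_add, LinearMap.add_apply, ha, hb]
      | tmul c d =>
        induction h using TensorProduct.induction_on with
        | zero => simp
        | add a b ha hb => simp only [map_add, ha, hb]
        | tmul p q => simp [LinTensor.compMap]

variable {k A B}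

/-- The pure tensor of two morphisms. -/
def LinTensor.tmul {X Y : LinTensor k A B} (f : X.left ⟶ Y.left) (g : X.right ⟶ Y.right) :
    X ⟶ Y :=
  (f ⊗ₜ[k] g : (X.left ⟶ Y.left) ⊗[k] (X.right ⟶ Y.right))

instance LinTensor.homGroup (X Y : LinTensor k A B) : AddCommGroup (X ⟶ Y) :=
  inferInstanceAs (AddCommGroup ((X.left ⟶ Y.left) ⊗[k] (X.right ⟶ Y.right)))

instance LinTensor.homModule (X Y : LinTensor k A B) : Module k (X ⟶ Y) :=
  inferInstanceAs (Module k ((X.left ⟶ Y.left) ⊗[k] (X.right ⟶ Y.right)))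

theorem LinTensor.comp_eq {X Y Z : LinTensor k A B} (f : X ⟶ Y) (g : Y ⟶ Z) :
    f ≫ g = LinTensor.compMap X Y Z f g := rfl

instance LinTensor.preadditive : Preadditive (LinTensor k A B) where
  homGroup := LinTensor.homGroup
  add_comp X Y Z f g h := by
    exact LinearMap.congr_fun ((LinTensor.compMap X Y Z).map_add f g) h
  comp_add X Y Z f g h := by
    exact (LinTensor.compMap X Y Z f).map_add g h

instance LinTensor.linear : Linear k (LinTensor k A B) where
  homModule := LinTensor.homModule
  smul_comp X Y Z r f g := by
    exact LinearMap.congr_fun ((LinTensor.compMap X Y Z).map_smul r f) g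
  comp_smul X Y Z f r g := by
    exact (LinTensor.compMap X Y Z f).map_smul r g

theorem LinTensor.hom_induction {X Y : LinTensor k A B} {P : (X ⟶ Y) → Prop} (f : X ⟶ Y)
    (zero : P 0) (tmul : ∀ a b, P (LinTensor.tmul a b)) (add : ∀ a b, P a → P b → P (a + b)) :
    P f :=
  TensorProduct.induction_on (motive := P) f zero tmul add

theorem LinTensor.id_eq (X : LinTensor k A B) : 𝟙 X = LinTensor.tmul (𝟙 X.left) (𝟙 X.right) := rfl

theorem LinTensor.tmul_comp {X Y Z : LinTensor k A B} (f : X.left ⟶ Y.left)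
    (g : X.right ⟶ Y.right) (f' : Y.left ⟶ Z.left) (g' : Y.right ⟶ Z.right) :
    LinTensor.tmul f g ≫ LinTensor.tmul f' g' = LinTensor.tmul (f ≫ f') (g ≫ g') := rfl

/-- A pair of isomorphisms is an isomorphism in the tensor product category. -/
def LinTensor.isoMk {X Y : LinTensor k A B} (f : X.left ≅ Y.left) (g : X.right ≅ Y.right) :
    X ≅ Y where
  hom := LinTensor.tmul f.hom g.hom
  inv := LinTensor.tmul f.inv g.inv
  hom_inv_id := by rw [LinTensor.tmul_comp, f.hom_inv_id, g.hom_inv_id]; rfl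
  inv_hom_id := by rw [LinTensor.tmul_comp, f.inv_hom_id, g.inv_hom_id]; rfl

variable (k) in
/-- The tensor product of morphisms in a `k`-linear monoidal category as a bilinear map. -/
def tensorHomLinear {A : Type u₁} [Category.{v₁} A] [Preadditive A] [Linear k A]
    [MonoidalCategory A] [MonoidalPreadditive A] [MonoidalLinear k A] (X Y X' Y' : A) :
    (X ⟶ Y) →ₗ[k] (X' ⟶ Y') →ₗ[k] (X ⊗ X' ⟶ Y ⊗ Y') :=
  LinearMap.mk₂ k (fun f g => f ⊗ₘ g)
    (fun _ _ _ => MonoidalPreadditive.add_tensor _ _ _)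
    (fun _ _ _ => by simp [MonoidalCategory.tensorHom_def])
    (fun _ _ _ => MonoidalPreadditive.tensor_add _ _ _)
    (fun _ _ _ => by simp [MonoidalCategory.tensorHom_def])

variable [MonoidalCategory A] [MonoidalPreadditive A] [MonoidalLinear k A]
  [MonoidalCategory B] [MonoidalPreadditive B] [MonoidalLinear k B]

/-- The componentwise tensor product of objects. -/
abbrev LinTensor.tensorObj' (X Y : LinTensor k A B) : LinTensor k A B :=
  ⟨X.left ⊗ Y.left, X.right ⊗ Y.right⟩

/-- The componentwise tensor product of morphisms:
`(f ⊗ g) ⊗ (f' ⊗ g') = (f ⊗ f') ⊗ (g ⊗ g')`. -/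
def LinTensor.tensorHomMap (X Y X' Y' : LinTensor k A B) :
    (X ⟶ Y) →ₗ[k] (X' ⟶ Y') →ₗ[k] (LinTensor.tensorObj' X X' ⟶ LinTensor.tensorObj' Y Y') :=
  TensorProduct.map₂ (tensorHomLinear k X.left Y.left X'.left Y'.left)
    (tensorHomLinear k X.right Y.right X'.right Y'.right)

theorem LinTensor.tensorHomMap_tmul {X Y X' Y' : LinTensor k A B} (f : X.left ⟶ Y.left)
    (g : X.right ⟶ Y.right) (f' : X'.left ⟶ Y'.left) (g' : X'.right ⟶ Y'.right) :
    LinTensor.tensorHomMap X Y X' Y' (LinTensor.tmul f g) (LinTensor.tmul f' g') =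
      LinTensor.tmul (f ⊗ₘ f') (g ⊗ₘ g') := rfl

instance LinTensor.monoidalStruct : MonoidalCategoryStruct (LinTensor k A B) where
  tensorObj := LinTensor.tensorObj'
  tensorHom f g := LinTensor.tensorHomMap _ _ _ _ f g
  whiskerLeft X _ _ g := LinTensor.tensorHomMap _ _ _ _ (𝟙 X) g
  whiskerRight f Y := LinTensor.tensorHomMap _ _ _ _ f (𝟙 Y)
  tensorUnit := ⟨𝟙_ A, 𝟙_ B⟩
  associator X Y Z := LinTensor.isoMk (α_ X.left Y.left Z.left) (α_ X.right Y.right Z.right)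
  leftUnitor X := LinTensor.isoMk (λ_ X.left) (λ_ X.right)
  rightUnitor X := LinTensor.isoMk (ρ_ X.left) (ρ_ X.right)

theorem LinTensor.tmul_tensorHom {X Y X' Y' : LinTensor k A B} (f : X.left ⟶ Y.left)
    (g : X.right ⟶ Y.right) (f' : X'.left ⟶ Y'.left) (g' : X'.right ⟶ Y'.right) :
    (LinTensor.tmul f g ⊗ₘ LinTensor.tmul f' g' : X ⊗ X' ⟶ Y ⊗ Y') =
      LinTensor.tmul (X := X ⊗ X') (Y := Y ⊗ Y') (f ⊗ₘ f') (g ⊗ₘ g') := rfl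

theorem LinTensor.add_tensorHom {X Y X' Y' : LinTensor k A B} (f f' : X ⟶ Y) (g : X' ⟶ Y') :
    (f + f') ⊗ₘ g = f ⊗ₘ g + f' ⊗ₘ g :=
  LinearMap.map_add₂ (LinTensor.tensorHomMap X Y X' Y') f f' g

theorem LinTensor.tensorHom_add {X Y X' Y' : LinTensor k A B} (f : X ⟶ Y) (g g' : X' ⟶ Y') :
    f ⊗ₘ (g + g') = f ⊗ₘ g + f ⊗ₘ g' :=
  map_add (LinTensor.tensorHomMap X Y X' Y' f) g g'

theorem LinTensor.zero_tensorHom {X Y X' Y' : LinTensor k A B} (g : X' ⟶ Y') :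
    (0 : X ⟶ Y) ⊗ₘ g = 0 :=
  LinearMap.map_zero₂ (LinTensor.tensorHomMap X Y X' Y') g

theorem LinTensor.tensorHom_zero {X Y X' Y' : LinTensor k A B} (f : X ⟶ Y) :
    f ⊗ₘ (0 : X' ⟶ Y') = 0 :=
  map_zero (LinTensor.tensorHomMap X Y X' Y' f)

theorem LinTensor.smul_tensorHom {X Y X' Y' : LinTensor k A B} (r : k) (f : X ⟶ Y)
    (g : X' ⟶ Y') : (r • f) ⊗ₘ g = r • (f ⊗ₘ g) :=
  LinearMap.map_smul₂ (LinTensor.tensorHomMap X Y X' Y') r f g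

theorem LinTensor.tensorHom_smul {X Y X' Y' : LinTensor k A B} (r : k) (f : X ⟶ Y)
    (g : X' ⟶ Y') : f ⊗ₘ (r • g) = r • (f ⊗ₘ g) :=
  map_smul (LinTensor.tensorHomMap X Y X' Y' f) r g

instance LinTensor.monoidal : MonoidalCategory (LinTensor k A B) :=
  MonoidalCategory.ofTensorHom
    (id_tensorHom_id := by
      intro X Y
      rw [LinTensor.id_eq, LinTensor.id_eq, LinTensor.tmul_tensorHom, id_tensorHom_id,
        id_tensorHom_id]
      rfl)
    (tensorHom_comp_tensorHom := by
      intro X₁ Y₁ Z₁ X₂ Y₂ Z₂ f₁ f₂ g₁ g₂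
      induction f₁ using LinTensor.hom_induction with
      | zero => simp only [LinTensor.zero_tensorHom, zero_comp]
      | add a b ha hb => simp only [LinTensor.add_tensorHom, Preadditive.add_comp, ha, hb]
      | tmul a b =>
        induction f₂ using LinTensor.hom_induction with
        | zero => simp only [LinTensor.tensorHom_zero, zero_comp]
        | add a b ha hb => simp only [LinTensor.tensorHom_add, Preadditive.add_comp, ha, hb]
        | tmul c d =>
          induction g₁ using LinTensor.hom_induction with
          | zero => simp only [LinTensor.zero_tensorHom, comp_zero]
          | add a b ha hb => simp only [LinTensor.add_tensorHom, Preadditive.comp_add, ha, hb]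
          | tmul p q =>
            induction g₂ using LinTensor.hom_induction with
            | zero => simp only [LinTensor.tensorHom_zero, comp_zero]
            | add a b ha hb => simp only [LinTensor.tensorHom_add, Preadditive.comp_add, ha, hb]
            | tmul r s =>
              rw [LinTensor.tmul_comp, LinTensor.tmul_comp, LinTensor.tmul_tensorHom,
                LinTensor.tmul_tensorHom, LinTensor.tmul_tensorHom, LinTensor.tmul_comp,
                tensorHom_comp_tensorHom, tensorHom_comp_tensorHom])
    (associator_naturality := by
      intro X₁ X₂ X₃ Y₁ Y₂ Y₃ f₁ f₂ f₃
      induction f₁ using LinTensor.hom_induction with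
      | zero => simp only [LinTensor.zero_tensorHom, zero_comp, comp_zero]
      | add a b ha hb =>
        simp only [LinTensor.add_tensorHom, Preadditive.add_comp, Preadditive.comp_add, ha, hb]
      | tmul a b =>
        induction f₂ using LinTensor.hom_induction with
        | zero => simp only [LinTensor.zero_tensorHom, LinTensor.tensorHom_zero, zero_comp,
            comp_zero]
        | add a b ha hb => simp only [LinTensor.add_tensorHom, LinTensor.tensorHom_add,
            Preadditive.add_comp, Preadditive.comp_add, ha, hb]
        | tmul c d =>
          induction f₃ using LinTensor.hom_induction with
          | zero => simp only [LinTensor.tensorHom_zero, zero_comp, comp_zero]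
          | add a b ha hb => simp only [LinTensor.tensorHom_add,
              Preadditive.add_comp, Preadditive.comp_add, ha, hb]
          | tmul p q =>
            exact congrArg₂ (fun x y => LinTensor.tmul (k := k)
              (X := (X₁ ⊗ X₂) ⊗ X₃) (Y := Y₁ ⊗ (Y₂ ⊗ Y₃)) x y)
              (associator_naturality a c p) (associator_naturality b d q))
    (leftUnitor_naturality := by
      intro X Y f
      induction f using LinTensor.hom_induction with
      | zero => simp only [LinTensor.tensorHom_zero, zero_comp, comp_zero]
      | add a b ha hb => simp only [LinTensor.tensorHom_add,
          Preadditive.add_comp, Preadditive.comp_add, ha, hb]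
      | tmul a b =>
        refine congrArg₂ (fun x y => LinTensor.tmul (k := k) (X := 𝟙_ _ ⊗ X) (Y := Y) x y) ?_ ?_
        · change (𝟙 _ ⊗ₘ a) ≫ (λ_ _).hom = (λ_ _).hom ≫ a
          rw [id_tensorHom]; exact leftUnitor_naturality a
        · change (𝟙 _ ⊗ₘ b) ≫ (λ_ _).hom = (λ_ _).hom ≫ b
          rw [id_tensorHom]; exact leftUnitor_naturality b)
    (rightUnitor_naturality := by
      intro X Y f
      induction f using LinTensor.hom_induction with
      | zero => simp only [LinTensor.zero_tensorHom, zero_comp, comp_zero]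
      | add a b ha hb => simp only [LinTensor.add_tensorHom,
          Preadditive.add_comp, Preadditive.comp_add, ha, hb]
      | tmul a b =>
        refine congrArg₂ (fun x y => LinTensor.tmul (k := k) (X := X ⊗ 𝟙_ _) (Y := Y) x y) ?_ ?_
        · change (a ⊗ₘ 𝟙 _) ≫ (ρ_ _).hom = (ρ_ _).hom ≫ a
          rw [tensorHom_id]; exact rightUnitor_naturality a
        · change (b ⊗ₘ 𝟙 _) ≫ (ρ_ _).hom = (ρ_ _).hom ≫ b
          rw [tensorHom_id]; exact rightUnitor_naturality b)
    (pentagon := by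
      intro X Y Z W
      refine congrArg₂ (fun x y => LinTensor.tmul (k := k)
        (X := ((X ⊗ Y) ⊗ Z) ⊗ W) (Y := X ⊗ (Y ⊗ (Z ⊗ W))) x y) ?_ ?_
      · change ((α_ _ _ _).hom ⊗ₘ 𝟙 _) ≫ (α_ _ _ _).hom ≫ (𝟙 _ ⊗ₘ (α_ _ _ _).hom) =
          (α_ _ _ _).hom ≫ (α_ _ _ _).hom
        rw [id_tensorHom, tensorHom_id]; exact MonoidalCategory.pentagon _ _ _ _
      · change ((α_ _ _ _).hom ⊗ₘ 𝟙 _) ≫ (α_ _ _ _).hom ≫ (𝟙 _ ⊗ₘ (α_ _ _ _).hom) =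
          (α_ _ _ _).hom ≫ (α_ _ _ _).hom
        rw [id_tensorHom, tensorHom_id]; exact MonoidalCategory.pentagon _ _ _ _)
    (triangle := by
      intro X Y
      refine congrArg₂ (fun x y => LinTensor.tmul (k := k)
        (X := (X ⊗ 𝟙_ _) ⊗ Y) (Y := X ⊗ Y) x y) ?_ ?_
      · change (α_ _ _ _).hom ≫ (𝟙 _ ⊗ₘ (λ_ _).hom) = ((ρ_ _).hom ⊗ₘ 𝟙 _)
        rw [id_tensorHom, tensorHom_id]; exact MonoidalCategory.triangle _ _
      · change (α_ _ _ _).hom ≫ (𝟙 _ ⊗ₘ (λ_ _).hom) = ((ρ_ _).hom ⊗ₘ 𝟙 _)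
        rw [id_tensorHom, tensorHom_id]; exact MonoidalCategory.triangle _ _)

instance LinTensor.monoidalPreadditive : MonoidalPreadditive (LinTensor k A B) where
  whiskerLeft_zero := LinTensor.tensorHom_zero _
  zero_whiskerRight := LinTensor.zero_tensorHom _
  whiskerLeft_add := LinTensor.tensorHom_add _
  add_whiskerRight f g := LinTensor.add_tensorHom f g _

instance LinTensor.monoidalLinear : MonoidalLinear k (LinTensor k A B) where
  whiskerLeft_smul _ _ _ r f := LinTensor.tensorHom_smul r _ f
  smul_whiskerRight r _ _ f _ := LinTensor.smul_tensorHom r f _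

/-- The braiding of a tensor product category, componentwise. -/
instance LinTensor.braided [BraidedCategory A] [BraidedCategory B] :
    BraidedCategory (LinTensor k A B) where
  braiding X Y := LinTensor.isoMk (β_ X.left Y.left) (β_ X.right Y.right)
  braiding_naturality_right X Y Z f := by
    induction f using LinTensor.hom_induction with
    | zero => simp only [MonoidalPreadditive.whiskerLeft_zero,
        MonoidalPreadditive.zero_whiskerRight, zero_comp, comp_zero]
    | add a b ha hb => simp only [MonoidalPreadditive.whiskerLeft_add,
        MonoidalPreadditive.add_whiskerRight, Preadditive.add_comp, Preadditive.comp_add, ha, hb]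
    | tmul a b =>
      exact congrArg₂ (fun x y => LinTensor.tmul (k := k) (X := X ⊗ Y) (Y := Z ⊗ X) x y)
        (BraidedCategory.braiding_naturality (𝟙 X.left) a)
        (BraidedCategory.braiding_naturality (𝟙 X.right) b)
  braiding_naturality_left {X Y} f Z := by
    induction f using LinTensor.hom_induction with
    | zero => simp only [MonoidalPreadditive.whiskerLeft_zero,
        MonoidalPreadditive.zero_whiskerRight, zero_comp, comp_zero]
    | add a b ha hb => simp only [MonoidalPreadditive.whiskerLeft_add,
        MonoidalPreadditive.add_whiskerRight, Preadditive.add_comp, Preadditive.comp_add, ha, hb]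
    | tmul a b =>
      exact congrArg₂ (fun x y => LinTensor.tmul (k := k) (X := X ⊗ Z) (Y := Z ⊗ Y) x y)
        (BraidedCategory.braiding_naturality a (𝟙 Z.left))
        (BraidedCategory.braiding_naturality b (𝟙 Z.right))
  hexagon_forward X Y Z := by
    refine congrArg₂ (fun x y => LinTensor.tmul (k := k)
      (X := (X ⊗ Y) ⊗ Z) (Y := Y ⊗ (Z ⊗ X)) x y) ?_ ?_
    · change (α_ _ _ _).hom ≫ (β_ _ _).hom ≫ (α_ _ _ _).hom =
        ((β_ _ _).hom ⊗ₘ 𝟙 _) ≫ (α_ _ _ _).hom ≫ (𝟙 _ ⊗ₘ (β_ _ _).hom)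
      rw [id_tensorHom, tensorHom_id]; exact BraidedCategory.hexagon_forward _ _ _
    · change (α_ _ _ _).hom ≫ (β_ _ _).hom ≫ (α_ _ _ _).hom =
        ((β_ _ _).hom ⊗ₘ 𝟙 _) ≫ (α_ _ _ _).hom ≫ (𝟙 _ ⊗ₘ (β_ _ _).hom)
      rw [id_tensorHom, tensorHom_id]; exact BraidedCategory.hexagon_forward _ _ _
  hexagon_reverse X Y Z := by
    refine congrArg₂ (fun x y => LinTensor.tmul (k := k)
      (X := X ⊗ (Y ⊗ Z)) (Y := (Z ⊗ X) ⊗ Y) x y) ?_ ?_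
    · change (α_ _ _ _).inv ≫ (β_ _ _).hom ≫ (α_ _ _ _).inv =
        (𝟙 _ ⊗ₘ (β_ _ _).hom) ≫ (α_ _ _ _).inv ≫ ((β_ _ _).hom ⊗ₘ 𝟙 _)
      rw [id_tensorHom, tensorHom_id]; exact BraidedCategory.hexagon_reverse _ _ _
    · change (α_ _ _ _).inv ≫ (β_ _ _).hom ≫ (α_ _ _ _).inv =
        (𝟙 _ ⊗ₘ (β_ _ _).hom) ≫ (α_ _ _ _).inv ≫ ((β_ _ _).hom ⊗ₘ 𝟙 _)
      rw [id_tensorHom, tensorHom_id]; exact BraidedCategory.hexagon_reverse _ _ _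

end LinTensor

/-! ### Deligne tensor product -/

section Deligne

variable (k : Type w) [CommRing k]
  (A : Type u₁) [Category.{v₁} A] [Preadditive A] [Linear k A]
  (B : Type u₂) [Category.{v₂} B] [Preadditive B] [Linear k B]

/-- The Deligne tensor product `A ⊠ B` of two semisimple `k`-linear categories (with `k`
algebraically closed and finite-dimensional spaces of morphisms): the completion of the tensor
product of linear categories under finite direct sums. Its simple objects are the `X ⊠ Y` with `X`
and `Y` simple, and `Hom (X ⊠ Y, X' ⊠ Y') = Hom (X, X') ⊗ Hom (Y, Y')`. Idempotents already split
in this completion, because every `X ⊠ Y` is a finite direct sum of objects `S ⊠ T` with `S` and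
`T` simple, whose endomorphism ring is `k`. The tensor product is componentwise, and so is the
braiding if `A` and `B` are braided. -/
abbrev DeligneProduct := Mat_ (LinTensor k A B)

variable {A B} in
/-- The object `X ⊠ Y`. -/
def box (X : A) (Y : B) : DeligneProduct k A B := (Mat_.embedding _).obj ⟨X, Y⟩

end Deligne

/-! ### Graded vector spaces -/

section Vec

/-- The one-dimensional `G`-graded vector spaces, one in each degree. -/
structure Line (k : Type w) (G : Type u) where
  /-- the degree in which the line lives -/
  deg : G

variable (k : Type w) [Field k] (G : Type u)

variable {G} in
/-- The space of morphisms from the line in degree `a` to the line in degree `b`: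
it is `k` if `a = b`, and zero otherwise. -/
def lineHom (a b : G) : Submodule k k where
  carrier := {c | a ≠ b → c = 0}
  add_mem' h h' e := by rw [h e, h' e, add_zero]
  zero_mem' _ := rfl
  smul_mem' r c h e := by rw [h e, smul_zero]

instance Line.category : Category (Line k G) where
  Hom X Y := lineHom k X.deg Y.deg
  id X := ⟨1, fun h => absurd rfl h⟩
  comp {X Y Z} f g := ⟨f.1 * g.1, fun h => by
    by_cases h' : X.deg = Y.deg
    · rw [g.2 (fun e => h (h'.trans e)), mul_zero]
    · rw [f.2 h', zero_mul]⟩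
  id_comp f := Subtype.ext (one_mul _)
  comp_id f := Subtype.ext (mul_one _)
  assoc f g h := Subtype.ext (mul_assoc _ _ _)

variable {k G}

instance Line.homGroup (X Y : Line k G) : AddCommGroup (X ⟶ Y) :=
  inferInstanceAs (AddCommGroup (lineHom k X.deg Y.deg))

instance Line.homModule (X Y : Line k G) : Module k (X ⟶ Y) :=
  inferInstanceAs (Module k (lineHom k X.deg Y.deg))

instance Line.preadditive : Preadditive (Line k G) where
  add_comp _ _ _ f g h := Subtype.ext (add_mul f.1 g.1 h.1)
  comp_add _ _ _ f g h := Subtype.ext (mul_add f.1 g.1 h.1)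

instance Line.linear : Linear k (Line k G) where
  smul_comp _ _ _ r f g := Subtype.ext (mul_assoc r f.1 g.1)
  comp_smul _ _ _ f r g := Subtype.ext (mul_left_comm f.1 r g.1)

/-- The identity of `k` as an isomorphism between two lines in the same degree. -/
def Line.isoOfEq {X Y : Line k G} (h : X.deg = Y.deg) : X ≅ Y where
  hom := ⟨1, fun h' => absurd h h'⟩
  inv := ⟨1, fun h' => absurd h.symm h'⟩
  hom_inv_id := Subtype.ext (one_mul _)
  inv_hom_id := Subtype.ext (one_mul _)

variable [AddMonoid G]

/-- The tensor product of two morphisms of lines is the product of the two scalars. -/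
def Line.tensorHom' {X Y X' Y' : Line k G} (f : X ⟶ Y) (g : X' ⟶ Y') :
    (⟨X.deg + X'.deg⟩ : Line k G) ⟶ ⟨Y.deg + Y'.deg⟩ :=
  ⟨f.1 * g.1, fun h => by
    by_cases h' : X.deg = Y.deg
    · rw [g.2 (fun e => h (congrArg₂ (· + ·) h' e)), mul_zero]
    · rw [f.2 h', zero_mul]⟩

instance Line.monoidalStruct : MonoidalCategoryStruct (Line k G) where
  tensorObj X Y := ⟨X.deg + Y.deg⟩
  tensorHom f g := Line.tensorHom' f g
  whiskerLeft X _ _ g := Line.tensorHom' (𝟙 X) g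
  whiskerRight f Y := Line.tensorHom' f (𝟙 Y)
  tensorUnit := ⟨0⟩
  associator X Y Z := Line.isoOfEq (add_assoc X.deg Y.deg Z.deg)
  leftUnitor X := Line.isoOfEq (zero_add X.deg)
  rightUnitor X := Line.isoOfEq (add_zero X.deg)

instance Line.monoidal : MonoidalCategory (Line k G) :=
  MonoidalCategory.ofTensorHom
    (id_tensorHom_id := fun _ _ => Subtype.ext (mul_one (1 : k)))
    (tensorHom_comp_tensorHom := fun f f' g g' => Subtype.ext (mul_mul_mul_comm f.1 f'.1 g.1 g'.1))
    (associator_naturality := fun f g h => Subtype.ext (by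
      change (f.1 * g.1) * h.1 * 1 = 1 * (f.1 * (g.1 * h.1)); ring))
    (leftUnitor_naturality := fun f => Subtype.ext (by
      change (1 * f.1) * 1 = 1 * f.1; ring))
    (rightUnitor_naturality := fun f => Subtype.ext (by
      change (f.1 * 1) * 1 = 1 * f.1; ring))
    (pentagon := fun _ _ _ _ => Subtype.ext (by
      change ((1 : k) * 1) * (1 * (1 * 1)) = 1 * 1; ring))
    (triangle := fun _ _ => Subtype.ext (by
      change (1 : k) * (1 * 1) = 1 * 1; ring))

instance Line.monoidalPreadditive : MonoidalPreadditive (Line k G) where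
  whiskerLeft_zero := Subtype.ext (mul_zero (1 : k))
  zero_whiskerRight := Subtype.ext (zero_mul (1 : k))
  whiskerLeft_add f g := Subtype.ext (mul_add (1 : k) f.1 g.1)
  add_whiskerRight f g := Subtype.ext (add_mul f.1 g.1 (1 : k))

instance Line.monoidalLinear : MonoidalLinear k (Line k G) where
  whiskerLeft_smul _ _ _ r f := Subtype.ext (mul_left_comm (1 : k) r f.1)
  smul_whiskerRight r _ _ f _ := Subtype.ext (mul_assoc r f.1 (1 : k))

variable (k G) in
/-- The category of finite-dimensional `G`-graded vector spaces over `k`: finite direct sums of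
lines, each in some degree. For an (additively written) group `G`, it is the pointed fusion category
`Vec_G` with trivial associator, degrees being added by the tensor product. -/
abbrev Vec := Mat_ (Line k G)

/-- The line in degree `g`, a simple object of `Vec_G`. -/
def Vec.line (k : Type w) [Field k] {G : Type u} (g : G) : Vec k G := (Mat_.embedding _).obj ⟨g⟩

end Vec

/-! ### Fusion categories -/

section Fusion

/-- `k`-linear monoidal categories that are fusion categories, for `k` algebraically closed:
semisimple (stated as: there are finitely many objects `S 0, …, S (n - 1)` with
`Hom (S i, S i) = k` and `Hom (S i, S j) = 0` for `i ≠ j`, such that every object is a finite direct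
sum of these) with finite direct sums, rigid, and with simple unit object. -/
structure IsFusion (k : Type w) [Field k] (C : Type u) [Category.{v} C] [Preadditive C]
    [Linear k C] [MonoidalCategory C] [MonoidalPreadditive C] [MonoidalLinear k C] : Prop where
  hasFiniteBiproducts : HasFiniteBiproducts C
  semisimple : ∃ (n : ℕ) (S : Fin n → C),
    (∀ i, Module.finrank k (S i ⟶ S i) = 1) ∧
    (∀ i j, i ≠ j → Subsingleton (S i ⟶ S j)) ∧
    ∀ X : C, ∃ (l : ℕ) (s : Fin l → Fin n) (b : Bicone fun j => S (s j)),
      Nonempty b.IsBilimit ∧ Nonempty (X ≅ b.pt)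
  rigid : Nonempty (RigidCategory C)
  simple_unit : Simple (𝟙_ C)

variable {C : Type u} [Category.{v} C] [Preadditive C] [MonoidalCategory C]

/-- A monoidal category is pointed if each of its simple objects is invertible. -/
def IsPointed (C : Type u) [Category.{v} C] [Preadditive C] [MonoidalCategory C] : Prop :=
  ∀ X : C, Simple X → ∃ Y : C, Nonempty (X ⊗ Y ≅ 𝟙_ C) ∧ Nonempty (Y ⊗ X ≅ 𝟙_ C)

/-- The Ising fusion rules: up to isomorphism, the simple objects are `𝟙`, the invertible object
`δ` and the object `Z`, these are distinct, and `Z ⊗ Z ≅ 𝟙 ⊕ δ`. -/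
structure IsIsing (δ Z : C) : Prop where
  simple_delta : Simple δ
  simple_Z : Simple Z
  unit_ne_delta : ¬ Nonempty (𝟙_ C ≅ δ)
  unit_ne_Z : ¬ Nonempty (𝟙_ C ≅ Z)
  delta_ne_Z : ¬ Nonempty (δ ≅ Z)
  simple_cases : ∀ X : C, Simple X → Nonempty (X ≅ 𝟙_ C) ∨ Nonempty (X ≅ δ) ∨ Nonempty (X ≅ Z)
  delta_tensor_delta : Nonempty (δ ⊗ δ ≅ 𝟙_ C)
  Z_tensor_Z : ∃ b : BinaryBicone (𝟙_ C) δ, Nonempty b.IsBilimit ∧ Nonempty (Z ⊗ Z ≅ b.pt)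

/-- A full subcategory is a fusion subcategory if it contains the unit object and is closed under
tensor products, finite direct sums, direct summands (in particular isomorphic objects) and left
and right duals. -/
structure IsFusionSubcategory (P : ObjectProperty C) : Prop where
  unit : P (𝟙_ C)
  tensor : ∀ X Y, P X → P Y → P (X ⊗ Y)
  sum : ∀ (X Y : C) (b : BinaryBicone X Y), b.IsBilimit → P X → P Y → P b.pt
  summand : ∀ X Y : C, Retract X Y → P Y → P X
  rightDual : ∀ X Y : C, ExactPairing X Y → P X → P Y
  leftDual : ∀ X Y : C, ExactPairing X Y → P Y → P X

/-- The smallest fusion subcategory that contains the object `X`. -/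
def generated (X : C) : ObjectProperty C :=
  fun Y => ∀ P : ObjectProperty C, IsFusionSubcategory P → P X → P Y

theorem isFusionSubcategory_generated (X : C) : IsFusionSubcategory (generated X) where
  unit _ hP _ := hP.unit
  tensor _ _ h h' P hP hX := hP.tensor _ _ (h P hP hX) (h' P hP hX)
  sum _ _ b hb h h' P hP hX := hP.sum _ _ b hb (h P hP hX) (h' P hP hX)
  summand _ _ r h P hP hX := hP.summand _ _ r (h P hP hX)
  rightDual _ _ e h P hP hX := hP.rightDual _ _ e (h P hP hX)
  leftDual _ _ e h P hP hX := hP.leftDual _ _ e (h P hP hX)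

instance generated_isMonoidal (X : C) : (generated X).IsMonoidal where
  prop_unit := (isFusionSubcategory_generated X).unit
  prop_tensor X₁ X₂ h₁ h₂ := (isFusionSubcategory_generated X).tensor X₁ X₂ h₁ h₂

end Fusion

/-- The fusion subcategory of `I ⊠ Vec_{ℤ/M}` generated by `Z ⊠ 1`, the line in degree `1 ∈ ℤ/M`
being the second factor. -/
abbrev CM (k : Type w) [Field k] {I : Type u} [Category.{v} I] [Preadditive I] [Linear k I]
    [MonoidalCategory I] [MonoidalPreadditive I] [MonoidalLinear k I] (Z : I) (M : ℕ) :=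
  (generated (box k Z (Vec.line k (1 : ZMod M)))).FullSubcategory

/-- A monoidal functor between braided categories is braided if it carries the braiding to the
braiding. -/
def IsBraidedFunctor {C : Type u₁} [Category.{v₁} C] [MonoidalCategory C] [BraidedCategory C]
    {D : Type u₂} [Category.{v₂} D] [MonoidalCategory D] [BraidedCategory D]
    (F : C ⥤ D) [F.Monoidal] : Prop :=
  ∀ X Y : C, Functor.LaxMonoidal.μ F X Y ≫ F.map (β_ X Y).hom =
    (β_ (F.obj X) (F.obj Y)).hom ≫ Functor.LaxMonoidal.μ F Y X

end IsingCM

end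

-- The equivalence is built in the opposite direction. Write `G₁ = ZMod (2 ^ N)`, `G₂ = ZMod m`, `G₃
-- = ZMod M`, and let `φ`, `ψ` be the inclusions of `G₁`, `G₂` into `G₃` given by the Chinese
-- remainder theorem. Adding degrees gives a `k`-linear functor `combine` that sends `(X ⊠ g) ⊠ h`
-- to `X ⊠ (φ g + ψ h)`. It is monoidal because `Vec` has a symmetric braiding, so that its tensor
-- product is a monoidal functor of two variables.
--
-- The values of `combine` lie in `𝓒_M` by a parity argument. Since `𝟙` is a direct summand of `Z ⊗
-- Z`, the subcategory `𝓒_M` contains `𝟙 ⊠ 2n` and `Z ⊠ (2n + 1)` for all `n` (`boxLine_mem`). As `N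
-- ≥ 1`, the element `φ 1` is an odd multiple of `1` and every `ψ h` is an even multiple. Full
-- faithfulness is checked on the objects `(X ⊠ g) ⊠ h`, of which every object is a finite direct
-- sum: there it amounts to the injectivity of `(g, h) ↦ φ g + ψ h` and to `End = k` for lines. For
-- essential surjectivity, regrading along the projection `π₁ : G₃ → G₁` carries the generator of
-- `𝓒_M` to that of `𝓒_{2^N}`, hence carries `𝓒_M` into `𝓒_{2^N}`; so `X ⊠ g` in `𝓒_M` is the image
-- of `(X ⊠ π₁ g) ⊠ π₂ g` (`combineTo_isEquivalence`).
--
-- For the braidings, a braiding of `𝓒_M` is pulled back to the product and restricted to the two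
-- factors, which embed fully faithfully. It remains to see that a braiding of the product is
-- determined by these restrictions, that is, that any two braidings agree on the mixed pairs. On
-- the pair formed by `Z ⊠ g` and a line of degree `v` they differ by a scalar `r`, the object being
-- absolutely simple. Scalars multiply under tensor products, so `r ^ m = 1` because `m • v = 0`,
-- and `r ^ (2 ^ N) = 1` because `𝟙 ⊠ (2 ^ N) • g`, which is the unit, is a direct summand of a
-- tensor power of `Z ⊠ g`. The exponents are coprime, so `r = 1` (`braidingAgree_boxLineGen`).
-- Agreement is inherited by tensor products, direct sums, direct summands and duals, hence by
-- everything that `Z ⊠ g` generates (`isFusionSubcategory_braidingAgree`, `generated_induction`).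
-- Finally, the inverse of a braided equivalence is braided.

universe v₃ v₄ u₃ u₄

noncomputable section

namespace IsingCM

set_option linter.unusedSectionVars false

/-! ### Functoriality of the additive completion `Mat_`. -/

section MatFunctors

variable {S : Type u₁} [Category.{v₁} S] [Preadditive S]
  {T : Type u₂} [Category.{v₂} T] [Preadditive T]

/-- An additive functor, applied entrywise to matrices. -/
def matMap (F : S ⥤ T) [F.Additive] : Mat_ S ⥤ Mat_ T where
  obj M := ⟨M.ι, fun i => F.obj (M.X i)⟩
  map f := fun i j => F.map (f i j)
  map_id M := by
    refine Mat_.hom_ext _ _ fun (i j : M.ι) => ?_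
    by_cases h : i = j
    · subst h
      exact ((congrArg F.map (Mat_.id_apply_self M i)).trans (F.map_id _)).trans
        (Mat_.id_apply_self (⟨M.ι, fun i => F.obj (M.X i)⟩ : Mat_ T) i).symm
    · exact ((congrArg F.map (Mat_.id_apply_of_ne M i j h)).trans (F.map_zero _ _)).trans
        (Mat_.id_apply_of_ne (⟨M.ι, fun i => F.obj (M.X i)⟩ : Mat_ T) i j h).symm
  map_comp {M N K} f g := by
    refine Mat_.hom_ext _ _ fun (i : M.ι) (j : K.ι) => ?_
    refine (F.map_sum _ _).trans (Finset.sum_congr rfl fun x _ => F.map_comp _ _)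

instance matMap_additive (F : S ⥤ T) [F.Additive] : (matMap F).Additive where
  map_add := by
    intro M N f g
    ext i j
    exact F.map_add

instance matMap_linear (k : Type w) [Semiring k] [Linear k S] [Linear k T] (F : S ⥤ T)
    [F.Additive] [F.Linear k] : (matMap F).Linear k where
  map_smul f r := by
    ext i j
    exact F.map_smul _ _

/-- All structure morphisms of `Mat_` have the form `single`. Since functors, Kronecker products and
compositions preserve this form, each coherence axiom below reduces to the same axiom for one tuple
of summands. -/
theorem matMap_single (F : S ⥤ T) [F.Additive] {M N : Mat_ S} (f : M.ι → N.ι)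
    (φ : ∀ i, M.X i ⟶ N.X (f i)) :
    (matMap F).map (single f φ) =
      single (M := (matMap F).obj M) (N := (matMap F).obj N) f (fun i => F.map (φ i)) := by
  refine Mat_.hom_ext _ _ fun (i : M.ι) (j : N.ι) => ?_
  by_cases h : f i = j
  · subst h
    exact (congrArg F.map (single_self f φ i)).trans
      (single_self (M := (matMap F).obj M) (N := (matMap F).obj N) f
        (fun i => F.map (φ i)) i).symm
  · exact ((congrArg F.map (single_ne f φ h)).trans (F.map_zero _ _)).trans
      (single_ne (M := (matMap F).obj M) (N := (matMap F).obj N) f (fun i => F.map (φ i)) h).symm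

variable [MonoidalCategory S] [MonoidalPreadditive S] [MonoidalCategory T] [MonoidalPreadditive T]

open Functor.LaxMonoidal in
theorem matMap_tensor_natural (F : S ⥤ T) [F.Additive] [F.Monoidal] {M N M' N' : Mat_ S}
    (f : M ⟶ N) (g : M' ⟶ N') :
    tensorMatHom ((matMap F).map f) ((matMap F).map g) ≫
      (single (M := tensorMat ((matMap F).obj N) ((matMap F).obj N'))
        (N := (matMap F).obj (tensorMat N N')) (fun p => p) fun p => μ F (N.X p.1) (N'.X p.2)) =
    (single (M := tensorMat ((matMap F).obj M) ((matMap F).obj M'))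
        (N := (matMap F).obj (tensorMat M M')) (fun p => p) fun p => μ F (M.X p.1) (M'.X p.2)) ≫
      (matMap F).map (tensorMatHom f g) := by
  ext p q
  refine (comp_single (M := tensorMat ((matMap F).obj M) ((matMap F).obj M'))
    (N := tensorMat ((matMap F).obj N) ((matMap F).obj N'))
    (K := (matMap F).obj (tensorMat N N')) _ _ (fun _ _ h => h) _ p q).trans ?_
  refine Eq.trans ?_ (single_comp (M := tensorMat ((matMap F).obj M) ((matMap F).obj M'))
    (N := (matMap F).obj (tensorMat M M')) _ _ _ _ _).symm
  exact μ_natural F _ _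

instance matMap_monoidal (F : S ⥤ T) [F.Additive] [F.Monoidal] : (matMap F).Monoidal :=
  Functor.CoreMonoidal.toMonoidal
    { εIso := singleIso (M := unitMat T) (N := (matMap F).obj (unitMat S)) (Equiv.refl _)
        fun _ => Functor.Monoidal.εIso F
      μIso := fun M N => singleIso (M := tensorMat ((matMap F).obj M) ((matMap F).obj N))
        (N := (matMap F).obj (tensorMat M N)) (Equiv.refl _)
        fun p => Functor.Monoidal.μIso F (M.X p.1) (N.X p.2)
      μIso_hom_natural_left := fun {M N} f M' => by
        have := matMap_tensor_natural F f (𝟙 M')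
        rw [(matMap F).map_id] at this
        exact this
      μIso_hom_natural_right := fun {M N} M' f => by
        have := matMap_tensor_natural F (𝟙 M') f
        rw [(matMap F).map_id] at this
        exact this
      associativity := fun M N K => by
        change tensorMatHom (single (M := tensorMat ((matMap F).obj M) ((matMap F).obj N))
            (N := (matMap F).obj (tensorMat M N)) _ _) (𝟙 _) ≫
          single (M := tensorMat ((matMap F).obj (tensorMat M N)) ((matMap F).obj K))
            (N := (matMap F).obj (tensorMat (tensorMat M N) K)) _ _ ≫
          (matMap F).map (single (M := tensorMat (tensorMat M N) K)
            (N := tensorMat M (tensorMat N K)) _ _) =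
          single (M := tensorMat (tensorMat ((matMap F).obj M) ((matMap F).obj N))
              ((matMap F).obj K))
            (N := tensorMat ((matMap F).obj M) (tensorMat ((matMap F).obj N)
              ((matMap F).obj K))) _ _ ≫
          tensorMatHom (𝟙 _) (single (M := tensorMat ((matMap F).obj N) ((matMap F).obj K))
            (N := (matMap F).obj (tensorMat N K)) _ _) ≫
          single (M := tensorMat ((matMap F).obj M) ((matMap F).obj (tensorMat N K)))
            (N := (matMap F).obj (tensorMat M (tensorMat N K))) _ _
        rw [id_eq_single, id_eq_single, tensorMatHom_single, tensorMatHom_single, matMap_single]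
        erw [single_comp_single, single_comp_single, single_comp_single, single_comp_single]
        refine congrArg (single _) ?_
        funext p
        change (Functor.LaxMonoidal.μ F _ _ ⊗ₘ 𝟙 _) ≫ Functor.LaxMonoidal.μ F _ _ ≫ F.map _ =
          (α_ _ _ _).hom ≫ (𝟙 _ ⊗ₘ Functor.LaxMonoidal.μ F _ _) ≫ Functor.LaxMonoidal.μ F _ _
        rw [tensorHom_id, id_tensorHom]
        exact Functor.LaxMonoidal.associativity F _ _ _
      left_unitality := fun M => by
        change single (M := tensorMat (unitMat T) ((matMap F).obj M)) (N := (matMap F).obj M) _ _ =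
          tensorMatHom (single (M := unitMat T) (N := (matMap F).obj (unitMat S)) _ _) (𝟙 _) ≫
          single (M := tensorMat ((matMap F).obj (unitMat S)) ((matMap F).obj M))
            (N := (matMap F).obj (tensorMat (unitMat S) M)) _ _ ≫
          (matMap F).map (single (M := tensorMat (unitMat S) M) (N := M) _ _)
        rw [id_eq_single, tensorMatHom_single, matMap_single]
        erw [single_comp_single, single_comp_single]
        refine congrArg (single _) ?_
        funext p
        change (λ_ _).hom = (Functor.LaxMonoidal.ε F ⊗ₘ 𝟙 _) ≫ Functor.LaxMonoidal.μ F _ _ ≫ F.map _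
        rw [tensorHom_id]
        exact Functor.LaxMonoidal.left_unitality F _
      right_unitality := fun M => by
        change single (M := tensorMat ((matMap F).obj M) (unitMat T)) (N := (matMap F).obj M) _ _ =
          tensorMatHom (𝟙 _) (single (M := unitMat T) (N := (matMap F).obj (unitMat S)) _ _) ≫
          single (M := tensorMat ((matMap F).obj M) ((matMap F).obj (unitMat S)))
            (N := (matMap F).obj (tensorMat M (unitMat S))) _ _ ≫
          (matMap F).map (single (M := tensorMat M (unitMat S)) (N := M) _ _)
        rw [id_eq_single, tensorMatHom_single, matMap_single]
        erw [single_comp_single, single_comp_single]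
        refine congrArg (single _) ?_
        funext p
        change (ρ_ _).hom = (𝟙 _ ⊗ₘ Functor.LaxMonoidal.ε F) ≫ Functor.LaxMonoidal.μ F _ _ ≫ F.map _
        rw [id_tensorHom]
        exact Functor.LaxMonoidal.right_unitality F _ }

/-- The formal direct sum with a single summand `X`. -/
abbrev onePt (X : S) : Mat_ S := ⟨PUnit, fun _ => X⟩

theorem embedding_map_eq_single {X Y : S} (f : X ⟶ Y) :
    (Mat_.embedding S).map f = single (M := onePt X)
      (N := onePt Y) (fun _ => PUnit.unit) (fun _ => f) := by
  refine Mat_.hom_ext _ _ fun i j => ?_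
  exact (single_self (M := onePt X)
      (N := onePt Y) (fun _ => PUnit.unit) (fun _ => f) i).symm

/-- The embedding of a monoidal category into its additive completion is monoidal. -/
instance embedding_monoidal : (Mat_.embedding S).Monoidal :=
  Functor.CoreMonoidal.toMonoidal
    { εIso := Iso.refl _
      μIso := fun X Y => singleIso (M := tensorMat (onePt X)
        (onePt Y)) (N := onePt (X ⊗ Y)) (Equiv.punitProd _)
        fun p => Iso.refl _
      μIso_hom_natural_left := fun {X Y} f X' => by
        change tensorMatHom ((Mat_.embedding S).map f) (𝟙 (onePt X')) ≫
          single (M := tensorMat (onePt Y) (onePt X'))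
            (N := onePt (Y ⊗ X')) _ _ =
          single (M := tensorMat (onePt X) (onePt X'))
            (N := onePt (X ⊗ X')) _ _ ≫ (Mat_.embedding S).map (f ▷ X')
        rw [embedding_map_eq_single, embedding_map_eq_single, id_eq_single]
        erw [tensorMatHom_single, single_comp_single, single_comp_single]
        refine congrArg (single _) ?_
        funext p
        change (f ⊗ₘ 𝟙 _) ≫ 𝟙 _ = 𝟙 _ ≫ f ▷ X'
        simp
      μIso_hom_natural_right := fun {X Y} X' f => by
        change tensorMatHom (𝟙 (onePt X')) ((Mat_.embedding S).map f) ≫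
          single (M := tensorMat (onePt X') (onePt Y))
            (N := onePt (X' ⊗ Y)) _ _ =
          single (M := tensorMat (onePt X') (onePt X))
            (N := onePt (X' ⊗ X)) _ _ ≫ (Mat_.embedding S).map (X' ◁ f)
        rw [embedding_map_eq_single, embedding_map_eq_single, id_eq_single]
        erw [tensorMatHom_single, single_comp_single, single_comp_single]
        refine congrArg (single _) ?_
        funext p
        change (𝟙 _ ⊗ₘ f) ≫ 𝟙 _ = 𝟙 _ ≫ X' ◁ f
        simp
      associativity := fun X Y Z => by
        change tensorMatHom (single (M := tensorMat (onePt X)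
            (onePt Y)) (N := onePt (X ⊗ Y)) _ _) (𝟙 _) ≫
          single (M := tensorMat (onePt (X ⊗ Y)) (onePt Z))
            (N := onePt ((X ⊗ Y) ⊗ Z)) _ _ ≫
          (Mat_.embedding S).map (α_ X Y Z).hom =
          single (M := tensorMat (tensorMat (onePt X) (onePt Y))
              (onePt Z))
            (N := tensorMat (onePt X) (tensorMat (onePt Y)
              (onePt Z))) _ _ ≫
          tensorMatHom (𝟙 _) (single (M := tensorMat (onePt Y)
            (onePt Z)) (N := onePt (Y ⊗ Z)) _ _) ≫
          single (M := tensorMat (onePt X) (onePt (Y ⊗ Z)))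
            (N := onePt (X ⊗ (Y ⊗ Z))) _ _
        rw [embedding_map_eq_single, id_eq_single, id_eq_single, tensorMatHom_single,
          tensorMatHom_single]
        erw [single_comp_single, single_comp_single, single_comp_single, single_comp_single]
        refine congrArg (single _) ?_
        funext p
        change (𝟙 _ ⊗ₘ 𝟙 _) ≫ 𝟙 _ ≫ (α_ _ _ _).hom = (α_ _ _ _).hom ≫ (𝟙 _ ⊗ₘ 𝟙 _) ≫ 𝟙 _
        simp
      left_unitality := fun X => by
        change single (M := tensorMat (unitMat S) (onePt X))
            (N := onePt X) _ _ =
          tensorMatHom (𝟙 (unitMat S)) (𝟙 _) ≫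
          single (M := tensorMat (unitMat S) (onePt X))
            (N := onePt (𝟙_ S ⊗ X)) _ _ ≫
          (Mat_.embedding S).map (λ_ X).hom
        rw [embedding_map_eq_single, id_eq_single, id_eq_single, tensorMatHom_single]
        erw [single_comp_single, single_comp_single]
        refine congrArg (single _) ?_
        funext p
        change (λ_ _).hom = (𝟙 _ ⊗ₘ 𝟙 _) ≫ 𝟙 _ ≫ (λ_ _).hom
        simp
      right_unitality := fun X => by
        change single (M := tensorMat (onePt X) (unitMat S))
            (N := onePt X) _ _ =
          tensorMatHom (𝟙 _) (𝟙 (unitMat S)) ≫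
          single (M := tensorMat (onePt X) (unitMat S))
            (N := onePt (X ⊗ 𝟙_ S)) _ _ ≫
          (Mat_.embedding S).map (ρ_ X).hom
        rw [embedding_map_eq_single, id_eq_single, id_eq_single, tensorMatHom_single]
        erw [single_comp_single, single_comp_single]
        refine congrArg (single _) ?_
        funext p
        change (ρ_ _).hom = (𝟙 _ ⊗ₘ 𝟙 _) ≫ 𝟙 _ ≫ (ρ_ _).hom
        simp }

end MatFunctors

/-! ### Flattening nested formal direct sums. -/

section Flatten

variable {T : Type u} [Category.{v} T] [Preadditive T]

/-- A formal direct sum of formal direct sums, as a formal direct sum. -/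
def flatten : Mat_ (Mat_ T) ⥤ Mat_ T where
  obj M := ⟨Σ i : M.ι, (M.X i).ι, fun p => (M.X p.1).X p.2⟩
  map f := fun p q => f p.1 q.1 p.2 q.2
  map_id M := by
    refine Mat_.hom_ext _ _ fun (p q : Σ i : M.ι, (M.X i).ι) => ?_
    obtain ⟨i, a⟩ := p
    obtain ⟨j, b⟩ := q
    by_cases h : i = j
    · subst h
      refine (congrFun (congrFun (Mat_.id_apply_self M i) a) b).trans ?_
      by_cases h : a = b
      · subst h
        exact (Mat_.id_apply_self (M.X i) a).trans (Mat_.id_apply_self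
          (⟨Σ i : M.ι, (M.X i).ι, fun p => (M.X p.1).X p.2⟩ : Mat_ T) ⟨i, a⟩).symm
      · exact (Mat_.id_apply_of_ne (M.X i) a b h).trans (Mat_.id_apply_of_ne
          (⟨Σ i : M.ι, (M.X i).ι, fun p => (M.X p.1).X p.2⟩ : Mat_ T) ⟨i, a⟩ ⟨i, b⟩
          (fun e => h (eq_of_heq (Sigma.mk.inj e).2))).symm
    · exact (congrFun (congrFun (Mat_.id_apply_of_ne M i j h) a) b).trans (Mat_.id_apply_of_ne
          (⟨Σ i : M.ι, (M.X i).ι, fun p => (M.X p.1).X p.2⟩ : Mat_ T) ⟨i, a⟩ ⟨j, b⟩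
          (fun e => h (Sigma.mk.inj e).1)).symm
  map_comp {M N K} f g := by
    refine Mat_.hom_ext _ _ fun (p : Σ i : M.ι, (M.X i).ι) (q : Σ i : K.ι, (K.X i).ι) => ?_
    change (∑ j, f p.1 j ≫ g j q.1) p.2 q.2 =
      ∑ x : Σ i : N.ι, (N.X i).ι, f p.1 x.1 p.2 x.2 ≫ g x.1 q.1 x.2 q.2
    rw [Fintype.sum_sigma]
    have : ∀ (s : Finset N.ι), (∑ j ∈ s, f p.1 j ≫ g j q.1) p.2 q.2 =
        ∑ j ∈ s, (f p.1 j ≫ g j q.1) p.2 q.2 := fun s => by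
      classical
      induction s using Finset.induction_on with
      | empty => rfl
      | insert a s ha ih => rw [Finset.sum_insert ha, Finset.sum_insert ha, Mat_.add_apply, ih]
    exact this _

instance flatten_additive : (flatten (T := T)).Additive where
  map_add := rfl

instance flatten_linear (k : Type w) [Semiring k] [Linear k T] :
    (flatten (T := T)).Linear k where
  map_smul _ _ := rfl

/-- A block matrix with one nonzero block per row, itself with one nonzero entry per row, has one
nonzero entry per row. -/
theorem flatten_single {M N : Mat_ (Mat_ T)} (f : M.ι → N.ι)
    (g : ∀ i, (M.X i).ι → (N.X (f i)).ι) (φ : ∀ i a, (M.X i).X a ⟶ (N.X (f i)).X (g i a)) :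
    flatten.map (single f (fun i => single (g i) (φ i))) =
      single (M := flatten.obj M) (N := flatten.obj N) (fun p => ⟨f p.1, g p.1 p.2⟩)
        (fun p => φ p.1 p.2) := by
  refine Mat_.hom_ext _ _ fun (p : Σ i : M.ι, (M.X i).ι) (q : Σ i : N.ι, (N.X i).ι) => ?_
  obtain ⟨i, a⟩ := p
  obtain ⟨j, b⟩ := q
  by_cases h : f i = j
  · subst h
    refine (congrFun (congrFun (single_self f (fun i => single (g i) (φ i)) i) a) b).trans ?_
    by_cases h : g i a = b
    · subst h
      exact (single_self (g i) (φ i) a).trans (single_self (M := flatten.obj M)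
        (N := flatten.obj N) (fun p => ⟨f p.1, g p.1 p.2⟩) (fun p => φ p.1 p.2) ⟨i, a⟩).symm
    · exact (single_ne (g i) (φ i) h).trans (single_ne (M := flatten.obj M)
        (N := flatten.obj N) (fun p => ⟨f p.1, g p.1 p.2⟩) (fun p => φ p.1 p.2)
        (i := ⟨i, a⟩) (j := ⟨f i, b⟩) (fun e => h (eq_of_heq (Sigma.mk.inj e).2))).symm
  · exact (congrFun (congrFun (single_ne f (fun i => single (g i) (φ i)) h) a) b).trans
      (single_ne (M := flatten.obj M)
        (N := flatten.obj N) (fun p => ⟨f p.1, g p.1 p.2⟩) (fun p => φ p.1 p.2)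
        (i := ⟨i, a⟩) (j := ⟨j, b⟩) (fun e => h (Sigma.mk.inj e).1)).symm

variable [MonoidalCategory T] [MonoidalPreadditive T]

/-- Distributivity of the tensor product over nested formal direct sums. -/
def flattenTensorIso (M N : Mat_ (Mat_ T)) :
    tensorMat (flatten.obj M) (flatten.obj N) ≅ flatten.obj (tensorMat M N) :=
  singleIso (M := tensorMat (flatten.obj M) (flatten.obj N)) (N := flatten.obj (tensorMat M N))
    { toFun := fun p => ⟨(p.1.1, p.2.1), (p.1.2, p.2.2)⟩
      invFun := fun q => (⟨q.1.1, q.2.1⟩, ⟨q.1.2, q.2.2⟩)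
      left_inv := fun _ => rfl
      right_inv := fun _ => rfl } fun _ => Iso.refl _

theorem flatten_tensor_natural {M N M' N' : Mat_ (Mat_ T)} (f : M ⟶ N) (g : M' ⟶ N') :
    tensorMatHom (flatten.map f) (flatten.map g) ≫ (flattenTensorIso N N').hom =
      (flattenTensorIso M M').hom ≫ flatten.map (tensorMatHom f g) := by
  refine Mat_.hom_ext _ _ fun p q => ?_
  refine (comp_single (M := tensorMat (flatten.obj M) (flatten.obj M'))
    (N := tensorMat (flatten.obj N) (flatten.obj N'))
    (K := flatten.obj (tensorMat N N')) _ _ (Equiv.injective _) _ p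
      (⟨q.1.1, q.2.1⟩, ⟨q.1.2, q.2.2⟩)).trans ?_
  refine Eq.trans ?_ (single_comp (M := tensorMat (flatten.obj M) (flatten.obj M'))
    (N := flatten.obj (tensorMat M M')) _ _ _ _ _).symm
  exact (Category.comp_id _).trans (Category.id_comp _).symm

theorem flattenTensorIso_hom (M N : Mat_ (Mat_ T)) :
    (flattenTensorIso M N).hom = single (M := tensorMat (flatten.obj M) (flatten.obj N))
      (N := flatten.obj (tensorMat M N)) (fun p => ⟨(p.1.1, p.2.1), (p.1.2, p.2.2)⟩)
      (fun p => 𝟙 ((M.X p.1.1).X p.1.2 ⊗ (N.X p.2.1).X p.2.2)) := rfl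

theorem flatten_map_associator (M N K : Mat_ (Mat_ T)) :
    flatten.map (α_ M N K).hom = single (M := flatten.obj (tensorMat (tensorMat M N) K))
      (N := flatten.obj (tensorMat M (tensorMat N K)))
      (fun p => ⟨(p.1.1.1, (p.1.1.2, p.1.2)), (p.2.1.1, (p.2.1.2, p.2.2))⟩)
      (fun p => (α_ ((M.X p.1.1.1).X p.2.1.1) ((N.X p.1.1.2).X p.2.1.2)
        ((K.X p.1.2).X p.2.2)).hom) :=
  flatten_single (M := tensorMat (tensorMat M N) K) (N := tensorMat M (tensorMat N K))
    (fun p => (p.1.1, (p.1.2, p.2))) (fun _ a => (a.1.1, (a.1.2, a.2))) _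

theorem flatten_map_leftUnitor (M : Mat_ (Mat_ T)) :
    flatten.map (λ_ M).hom = single (M := flatten.obj (tensorMat (unitMat (Mat_ T)) M))
      (N := flatten.obj M) (fun p => ⟨p.1.2, p.2.2⟩)
      (fun p => (λ_ ((M.X p.1.2).X p.2.2)).hom) :=
  flatten_single (M := tensorMat (unitMat (Mat_ T)) M) (N := M)
    (fun p => p.2) (fun _ a => a.2) _

theorem flatten_map_rightUnitor (M : Mat_ (Mat_ T)) :
    flatten.map (ρ_ M).hom = single (M := flatten.obj (tensorMat M (unitMat (Mat_ T))))
      (N := flatten.obj M) (fun p => ⟨p.1.1, p.2.1⟩)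
      (fun p => (ρ_ ((M.X p.1.1).X p.2.1)).hom) :=
  flatten_single (M := tensorMat M (unitMat (Mat_ T))) (N := M)
    (fun p => p.1) (fun _ a => a.1) _

theorem associator_hom_eq_single (M N K : Mat_ T) :
    (α_ M N K).hom = single (M := tensorMat (tensorMat M N) K) (N := tensorMat M (tensorMat N K))
      (fun p => (p.1.1, (p.1.2, p.2))) (fun p => (α_ (M.X p.1.1) (N.X p.1.2) (K.X p.2)).hom) := rfl

theorem leftUnitor_hom_eq_single (M : Mat_ T) :
    (λ_ M).hom = single (M := tensorMat (unitMat T) M) (N := M)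
      (fun p => p.2) (fun p => (λ_ (M.X p.2)).hom) := rfl

theorem rightUnitor_hom_eq_single (M : Mat_ T) :
    (ρ_ M).hom = single (M := tensorMat M (unitMat T)) (N := M)
      (fun p => p.1) (fun p => (ρ_ (M.X p.1)).hom) := rfl

theorem whiskerRight_single {M N : Mat_ T} (f : M.ι → N.ι)
    (φ : ∀ i, M.X i ⟶ N.X (f i)) (K : Mat_ T) :
    single f φ ▷ K = single (M := tensorMat M K) (N := tensorMat N K) (fun p => (f p.1, p.2))
      (fun p => φ p.1 ▷ K.X p.2) := by
  change tensorMatHom _ (𝟙 K) = _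
  rw [id_eq_single, tensorMatHom_single]
  refine congrArg (single _) ?_
  funext p
  exact tensorHom_id _ _

theorem whiskerLeft_single (K : Mat_ T) {M N : Mat_ T} (f : M.ι → N.ι)
    (φ : ∀ i, M.X i ⟶ N.X (f i)) :
    K ◁ single f φ = single (M := tensorMat K M) (N := tensorMat K N) (fun p => (p.1, f p.2))
      (fun p => K.X p.1 ◁ φ p.2) := by
  change tensorMatHom (𝟙 K) _ = _
  rw [id_eq_single, tensorMatHom_single]
  refine congrArg (single _) ?_
  funext p
  exact id_tensorHom _ _

/-- The unit object as a nested formal direct sum. -/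
def flattenUnitIso (T : Type u) [Category.{v} T] [Preadditive T] [MonoidalCategory T]
    [MonoidalPreadditive T] : unitMat T ≅ flatten.obj (unitMat (Mat_ T)) :=
  singleIso (M := unitMat T) (N := flatten.obj (unitMat (Mat_ T)))
    { toFun := fun _ => ⟨(), ()⟩
      invFun := fun _ => ()
      left_inv := fun _ => rfl
      right_inv := fun _ => rfl } fun _ => Iso.refl _

theorem flattenUnitIso_hom : (flattenUnitIso T).hom =
    single (M := unitMat T) (N := flatten.obj (unitMat (Mat_ T))) (fun _ => ⟨(), ()⟩)
      (fun _ => 𝟙 (𝟙_ T)) := rfl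

theorem flatten_associativity (M N K : Mat_ (Mat_ T)) :
    (flattenTensorIso M N).hom ▷ flatten.obj K ≫ (flattenTensorIso (tensorMat M N) K).hom ≫
      flatten.map (α_ M N K).hom =
    (α_ (flatten.obj M) (flatten.obj N) (flatten.obj K)).hom ≫
      flatten.obj M ◁ (flattenTensorIso N K).hom ≫ (flattenTensorIso M (tensorMat N K)).hom := by
  rw [flatten_map_associator, associator_hom_eq_single]
  simp only [flattenTensorIso_hom]
  erw [whiskerRight_single, whiskerLeft_single]
  erw [single_comp_single, single_comp_single, single_comp_single, single_comp_single]
  refine congrArg (single _) ?_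
  funext p
  change 𝟙 _ ▷ _ ≫ 𝟙 _ ≫ (α_ _ _ _).hom = (α_ _ _ _).hom ≫ _ ◁ 𝟙 _ ≫ 𝟙 _
  simp

instance flatten_monoidal : (flatten (T := T)).Monoidal :=
  Functor.CoreMonoidal.toMonoidal
    { εIso := flattenUnitIso T
      μIso := flattenTensorIso
      μIso_hom_natural_left := fun {M N} f M' => by
        have := flatten_tensor_natural f (𝟙 M')
        rw [flatten.map_id] at this
        exact this
      μIso_hom_natural_right := fun {M N} M' f => by
        have := flatten_tensor_natural (𝟙 M') f
        rw [flatten.map_id] at this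
        exact this
      associativity := flatten_associativity
      left_unitality := fun M => by
        rw [flatten_map_leftUnitor, leftUnitor_hom_eq_single, flattenUnitIso_hom]
        change _ = _ ≫ (flattenTensorIso _ _).hom ≫ _
        rw [flattenTensorIso_hom]
        erw [whiskerRight_single]
        erw [single_comp_single, single_comp_single]
        refine congrArg (single _) ?_
        funext p
        change (λ_ _).hom = 𝟙 _ ▷ _ ≫ 𝟙 _ ≫ (λ_ _).hom
        simp
      right_unitality := fun M => by
        rw [flatten_map_rightUnitor, rightUnitor_hom_eq_single, flattenUnitIso_hom]
        change _ = _ ≫ (flattenTensorIso _ _).hom ≫ _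
        rw [flattenTensorIso_hom]
        erw [whiskerLeft_single]
        erw [single_comp_single, single_comp_single]
        refine congrArg (single _) ?_
        funext p
        change (ρ_ _).hom = _ ◁ 𝟙 _ ≫ 𝟙 _ ≫ (ρ_ _).hom
        simp }

end Flatten

/-! ### Bilinear functors and the functors they induce on `LinTensor` and `Mat_`. -/

section Bilinear

open CategoryTheory.Prod

/-- A functor of two variables that is `k`-linear in each of them. -/
class IsBilinear (k : Type w) [Semiring k] {A : Type u₁} [Category.{v₁} A] [Preadditive A]
    [Linear k A] {B : Type u₂} [Category.{v₂} B] [Preadditive B] [Linear k B]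
    {C : Type u₃} [Category.{v₃} C] [Preadditive C] [Linear k C] (H : A × B ⥤ C) : Prop where
  map_add_left {X X' : A} {Y Y' : B} (f f' : X ⟶ X') (g : Y ⟶ Y') :
    H.map ((f + f') ×ₘ g) = H.map (f ×ₘ g) + H.map (f' ×ₘ g)
  map_add_right {X X' : A} {Y Y' : B} (f : X ⟶ X') (g g' : Y ⟶ Y') :
    H.map (f ×ₘ (g + g')) = H.map (f ×ₘ g) + H.map (f ×ₘ g')
  map_smul_left {X X' : A} {Y Y' : B} (r : k) (f : X ⟶ X') (g : Y ⟶ Y') :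
    H.map ((r • f) ×ₘ g) = r • H.map (f ×ₘ g)
  map_smul_right {X X' : A} {Y Y' : B} (r : k) (f : X ⟶ X') (g : Y ⟶ Y') :
    H.map (f ×ₘ (r • g)) = r • H.map (f ×ₘ g)

variable (k : Type w) [CommRing k] {A : Type u₁} [Category.{v₁} A] [Preadditive A]
    [Linear k A] {B : Type u₂} [Category.{v₂} B] [Preadditive B] [Linear k B]
    {C : Type u₃} [Category.{v₃} C] [Preadditive C] [Linear k C]

theorem IsBilinear.map_zero_left (H : A × B ⥤ C) [IsBilinear k H] {X X' : A} {Y Y' : B}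
    (g : Y ⟶ Y') : H.map ((0 : X ⟶ X') ×ₘ g) = 0 := by
  have := IsBilinear.map_smul_left (H := H) (0 : k) (0 : X ⟶ X') g
  rwa [zero_smul, zero_smul] at this

theorem IsBilinear.comp {D : Type u} [Category.{v} D] [Preadditive D] [Linear k D]
    (H : A × B ⥤ C) [IsBilinear k H] (F : C ⥤ D) [F.Additive] [F.Linear k] :
    IsBilinear k (H ⋙ F) where
  map_add_left f f' g := by simp [IsBilinear.map_add_left k, F.map_add]
  map_add_right f f' g := by simp [IsBilinear.map_add_right k, F.map_add]
  map_smul_left r f g := by simp [IsBilinear.map_smul_left, F.map_smul]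
  map_smul_right r f g := by simp [IsBilinear.map_smul_right, F.map_smul]

theorem IsBilinear.prod_comp {A' : Type u} [Category.{v} A'] [Preadditive A'] [Linear k A']
    {B' : Type u₄} [Category.{v₄} B'] [Preadditive B'] [Linear k B']
    (F : A' ⥤ A) [F.Additive] [F.Linear k] (G : B' ⥤ B) [G.Additive] [G.Linear k]
    (H : A × B ⥤ C) [IsBilinear k H] : IsBilinear k (F.prod G ⋙ H) where
  map_add_left f f' g := by
    have := IsBilinear.map_add_left k (H := H) (F.map f) (F.map f') (G.map g)
    rw [← F.map_add] at this
    exact this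
  map_add_right f g g' := by
    have := IsBilinear.map_add_right k (H := H) (F.map f) (G.map g) (G.map g')
    rw [← G.map_add] at this
    exact this
  map_smul_left r f g := by
    have := IsBilinear.map_smul_left (H := H) r (F.map f) (G.map g)
    rw [← F.map_smul] at this
    exact this
  map_smul_right r f g := by
    have := IsBilinear.map_smul_right (H := H) r (F.map f) (G.map g)
    rw [← G.map_smul] at this
    exact this

instance tensor_isBilinear [MonoidalCategory C] [MonoidalPreadditive C] [MonoidalLinear k C] :
    IsBilinear k (tensor C) where
  map_add_left f f' g := MonoidalPreadditive.add_tensor _ _ _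
  map_add_right f f' g := MonoidalPreadditive.tensor_add _ _ _
  map_smul_left r f g := by simp [MonoidalCategory.tensorHom_def]
  map_smul_right r f g := by simp [MonoidalCategory.tensorHom_def]

namespace LinTensor

/-- The functor on the tensor product of linear categories induced by a bilinear functor. -/
def lift (H : A × B ⥤ C) [IsBilinear k H] : LinTensor k A B ⥤ C where
  obj X := H.obj (X.left, X.right)
  map {X Y} f := TensorProduct.lift (LinearMap.mk₂ k
    (fun (f : X.left ⟶ Y.left) (g : X.right ⟶ Y.right) => H.map (f ×ₘ g))
    (IsBilinear.map_add_left k) (fun r f g => IsBilinear.map_smul_left r f g)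
    (IsBilinear.map_add_right k) (fun r f g => IsBilinear.map_smul_right r f g)) f
  map_id X := by
    refine (TensorProduct.lift.tmul _ _).trans ?_
    exact H.map_id (X.left, X.right)
  map_comp {X Y Z} f g := by
    induction f using LinTensor.hom_induction with
    | zero =>
      rw [zero_comp]
      refine (map_zero _).trans ?_
      refine Eq.trans zero_comp.symm (congrArg (· ≫ _) (map_zero _).symm)
    | add a b ha hb =>
      rw [Preadditive.add_comp]
      refine (map_add _ _ _).trans ?_
      rw [ha, hb, ← Preadditive.add_comp]
      exact congrArg (· ≫ _) (map_add _ _ _).symm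
    | tmul a b =>
      induction g using LinTensor.hom_induction with
      | zero =>
        rw [comp_zero]
        refine (map_zero _).trans ?_
        refine Eq.trans comp_zero.symm (congrArg (_ ≫ ·) (map_zero _).symm)
      | add c d hc hd =>
        rw [Preadditive.comp_add]
        refine (map_add _ _ _).trans ?_
        rw [hc, hd, ← Preadditive.comp_add]
        exact congrArg (_ ≫ ·) (map_add _ _ _).symm
      | tmul c d => exact H.map_comp (a ×ₘ b) (c ×ₘ d)

variable (H : A × B ⥤ C) [IsBilinear k H]

instance lift_additive : (lift k H).Additive where
  map_add := map_add _ _ _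

instance lift_linear : (lift k H).Linear k where
  map_smul _ _ := map_smul _ _ _

variable [MonoidalCategory A] [MonoidalPreadditive A] [MonoidalLinear k A]
  [MonoidalCategory B] [MonoidalPreadditive B] [MonoidalLinear k B]
  [MonoidalCategory C] [MonoidalPreadditive C]

/-- Compatibility of `lift` with tensor products of objects. -/
def liftTensorIso [H.Monoidal] (X Y : LinTensor k A B) :
    (lift k H).obj X ⊗ (lift k H).obj Y ≅ (lift k H).obj (X ⊗ Y) :=
  Functor.Monoidal.μIso H (X.left, X.right) (Y.left, Y.right)

/-- Both sides are additive in `f` and in `g`, so pure tensors suffice, and for these it is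
naturality of the tensorator of `H`. -/
theorem lift_tensor_natural [H.Monoidal] {X X' Y Y' : LinTensor k A B} (f : X ⟶ X')
    (g : Y ⟶ Y') : ((lift k H).map f ⊗ₘ (lift k H).map g) ≫ (liftTensorIso k H X' Y').hom =
    (liftTensorIso k H X Y).hom ≫ (lift k H).map (f ⊗ₘ g) := by
  induction f using LinTensor.hom_induction with
  | zero =>
    rw [(lift k H).map_zero, MonoidalPreadditive.zero_tensor, zero_comp,
      LinTensor.zero_tensorHom, (lift k H).map_zero, comp_zero]
  | add a b ha hb =>
    rw [(lift k H).map_add, MonoidalPreadditive.add_tensor, Preadditive.add_comp, ha, hb,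
      LinTensor.add_tensorHom, (lift k H).map_add, Preadditive.comp_add]
  | tmul a b =>
    induction g using LinTensor.hom_induction with
    | zero =>
      rw [(lift k H).map_zero, MonoidalPreadditive.tensor_zero, zero_comp,
        LinTensor.tensorHom_zero, (lift k H).map_zero, comp_zero]
    | add c d hc hd =>
      rw [(lift k H).map_add, MonoidalPreadditive.tensor_add, Preadditive.add_comp, hc, hd,
        LinTensor.tensorHom_add, (lift k H).map_add, Preadditive.comp_add]
    | tmul c d => exact Functor.LaxMonoidal.μ_natural H (a ×ₘ b) (c ×ₘ d)

instance lift_monoidal [H.Monoidal] : (lift k H).Monoidal :=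
  Functor.CoreMonoidal.toMonoidal
    { εIso := Functor.Monoidal.εIso H
      μIso := liftTensorIso k H
      μIso_hom_natural_left := fun {X Y} f Z => by
        have := lift_tensor_natural k H f (𝟙 Z)
        rw [(lift k H).map_id, tensorHom_id, tensorHom_id] at this
        exact this
      μIso_hom_natural_right := fun {X Y} Z f => by
        have := lift_tensor_natural k H (𝟙 Z) f
        rw [(lift k H).map_id, id_tensorHom, id_tensorHom] at this
        exact this
      associativity := fun X Y Z => Functor.LaxMonoidal.associativity H
        (X.left, X.right) (Y.left, Y.right) (Z.left, Z.right)
      left_unitality := fun X => Functor.LaxMonoidal.left_unitality H (X.left, X.right)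
      right_unitality := fun X => Functor.LaxMonoidal.right_unitality H (X.left, X.right) }

end LinTensor

/-! ### Tensoring a bilinear functor with a spectator category `J`. -/

section Extend

variable (J : Type u) [Category.{v} J] [Preadditive J] [Linear k J]

/-- The map on spaces of morphisms of `extendLeft`. -/
def extendLeftMap (H : A × B ⥤ C) [IsBilinear k H] {X X' : LinTensor k J A} {Y Y' : B}
    (g : Y ⟶ Y') : (X ⟶ X') →ₗ[k] ((⟨X.left, H.obj (X.right, Y)⟩ : LinTensor k J C) ⟶
      ⟨X'.left, H.obj (X'.right, Y')⟩) :=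
  LinearMap.lTensor (X.left ⟶ X'.left)
    ({ toFun := fun f : X.right ⟶ X'.right => H.map (f ×ₘ g)
       map_add' := fun f f' => IsBilinear.map_add_left k f f' g
       map_smul' := fun r f => IsBilinear.map_smul_left r f g } :
       (X.right ⟶ X'.right) →ₗ[k] (H.obj (X.right, Y) ⟶ H.obj (X'.right, Y')))

theorem extendLeftMap_tmul (H : A × B ⥤ C) [IsBilinear k H] {X X' : LinTensor k J A} {Y Y' : B}
    (a : X.left ⟶ X'.left) (b : X.right ⟶ X'.right) (g : Y ⟶ Y') :
    extendLeftMap k J H g (LinTensor.tmul a b : X ⟶ X') =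
      LinTensor.tmul (X := ⟨X.left, H.obj (X.right, Y)⟩) (Y := ⟨X'.left, H.obj (X'.right, Y')⟩)
        a (H.map (b ×ₘ g)) := rfl

/-- A bilinear functor `A × B ⥤ C` induces a bilinear functor `(J ⊗ A) × B ⥤ J ⊗ C`. -/
def extendLeft (H : A × B ⥤ C) [IsBilinear k H] : LinTensor k J A × B ⥤ LinTensor k J C where
  obj p := ⟨p.1.left, H.obj (p.1.right, p.2)⟩
  map f := extendLeftMap k J H f.2 f.1
  map_id p := by
    refine (extendLeftMap_tmul k J H (X := p.1) (X' := p.1) (𝟙 _) (𝟙 _) (𝟙 p.2)).trans ?_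
    exact congrArg (LinTensor.tmul _) (H.map_id (p.1.right, p.2))
  map_comp {p q r} f g := by
    obtain ⟨f, f'⟩ := f
    obtain ⟨g, g'⟩ := g
    change extendLeftMap k J H (f' ≫ g') (f ≫ g) =
      extendLeftMap k J H f' f ≫ extendLeftMap k J H g' g
    induction f using LinTensor.hom_induction with
    | zero => simp
    | add a b ha hb => simp only [Preadditive.add_comp, map_add, ha, hb]
    | tmul a b =>
      induction g using LinTensor.hom_induction with
      | zero => simp
      | add a b ha hb => simp only [Preadditive.comp_add, map_add, ha, hb]
      | tmul c d =>
        rw [LinTensor.tmul_comp, extendLeftMap_tmul, extendLeftMap_tmul, extendLeftMap_tmul]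
        refine Eq.trans ?_ (LinTensor.tmul_comp _ _ _ _).symm
        exact congrArg (LinTensor.tmul _) (H.map_comp (b ×ₘ f') (d ×ₘ g'))

instance extendLeft_isBilinear (H : A × B ⥤ C) [IsBilinear k H] :
    IsBilinear k (extendLeft k J H) where
  map_add_left f f' g := map_add _ _ _
  map_smul_left r f g := map_smul _ _ _
  map_add_right f g g' := by
    change extendLeftMap k J H (g + g') f = extendLeftMap k J H g f + extendLeftMap k J H g' f
    induction f using LinTensor.hom_induction with
    | zero => simp
    | add a b ha hb => simp only [map_add, ha, hb]; abel
    | tmul a b =>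
      rw [extendLeftMap_tmul, extendLeftMap_tmul, extendLeftMap_tmul, IsBilinear.map_add_right k]
      exact TensorProduct.tmul_add _ _ _
  map_smul_right r f g := by
    change extendLeftMap k J H (r • g) f = r • extendLeftMap k J H g f
    induction f using LinTensor.hom_induction with
    | zero => simp
    | add a b ha hb => simp only [map_add, ha, hb, smul_add]
    | tmul a b =>
      rw [extendLeftMap_tmul, extendLeftMap_tmul, IsBilinear.map_smul_right]
      exact TensorProduct.tmul_smul _ _ _

variable [MonoidalCategory A] [MonoidalPreadditive A] [MonoidalLinear k A]
  [MonoidalCategory B] [MonoidalPreadditive B] [MonoidalLinear k B]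
  [MonoidalCategory C] [MonoidalPreadditive C] [MonoidalLinear k C]
  [MonoidalCategory J] [MonoidalPreadditive J] [MonoidalLinear k J]
  (H : A × B ⥤ C) [IsBilinear k H] [H.Monoidal]

/-- Compatibility of `extendLeft` with tensor products of objects. -/
def extendLeftTensorIso (p q : LinTensor k J A × B) :
    (extendLeft k J H).obj p ⊗ (extendLeft k J H).obj q ≅ (extendLeft k J H).obj (p ⊗ q) :=
  LinTensor.isoMk (X := (extendLeft k J H).obj p ⊗ (extendLeft k J H).obj q)
    (Y := (extendLeft k J H).obj (p ⊗ q)) (Iso.refl (p.1.left ⊗ q.1.left))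
    (Functor.Monoidal.μIso H (p.1.right, p.2) (q.1.right, q.2))

/-- Additivity reduces the first components of `f` and `g` to pure tensors; then the factor in `J`
is untouched and the other is naturality for `H`. -/
theorem extendLeft_tensor_natural {p p' q q' : LinTensor k J A × B} (f : p ⟶ p') (g : q ⟶ q') :
    ((extendLeft k J H).map f ⊗ₘ (extendLeft k J H).map g) ≫ (extendLeftTensorIso k J H p' q').hom =
      (extendLeftTensorIso k J H p q).hom ≫ (extendLeft k J H).map (f ⊗ₘ g) := by
  obtain ⟨f, f'⟩ := f
  obtain ⟨g, g'⟩ := g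
  change ((extendLeft k J H).map (f ×ₘ f') ⊗ₘ (extendLeft k J H).map (g ×ₘ g')) ≫ _ =
    _ ≫ (extendLeft k J H).map ((f ⊗ₘ g) ×ₘ (f' ⊗ₘ g'))
  induction f using LinTensor.hom_induction with
  | zero => rw [LinTensor.zero_tensorHom, IsBilinear.map_zero_left k (extendLeft k J H),
      IsBilinear.map_zero_left k (extendLeft k J H), LinTensor.zero_tensorHom, zero_comp, comp_zero]
  | add a b ha hb =>
    rw [LinTensor.add_tensorHom, IsBilinear.map_add_left k (H := extendLeft k J H),
      IsBilinear.map_add_left k (H := extendLeft k J H), LinTensor.add_tensorHom,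
      Preadditive.add_comp, ha, hb, Preadditive.comp_add]
  | tmul a b =>
    induction g using LinTensor.hom_induction with
    | zero => rw [LinTensor.tensorHom_zero, IsBilinear.map_zero_left k (extendLeft k J H),
        IsBilinear.map_zero_left k (extendLeft k J H), LinTensor.tensorHom_zero, zero_comp,
        comp_zero]
    | add a b ha hb =>
      rw [LinTensor.tensorHom_add, IsBilinear.map_add_left k (H := extendLeft k J H),
        IsBilinear.map_add_left k (H := extendLeft k J H), LinTensor.tensorHom_add,
        Preadditive.add_comp, ha, hb, Preadditive.comp_add]
    | tmul c d =>
      exact congrArg₂ (fun x y => LinTensor.tmul (k := k)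
        (X := (extendLeft k J H).obj p ⊗ (extendLeft k J H).obj q)
        (Y := (extendLeft k J H).obj (p' ⊗ q')) x y)
        ((Category.comp_id (a ⊗ₘ c)).trans (Category.id_comp (a ⊗ₘ c)).symm)
        (Functor.LaxMonoidal.μ_natural H (b ×ₘ f') (d ×ₘ g'))

instance extendLeft_monoidal : (extendLeft k J H).Monoidal :=
  Functor.CoreMonoidal.toMonoidal
    { εIso := LinTensor.isoMk (X := 𝟙_ (LinTensor k J C))
        (Y := (extendLeft k J H).obj (𝟙_ (LinTensor k J A × B))) (Iso.refl (𝟙_ J))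
        (Functor.Monoidal.εIso H)
      μIso := extendLeftTensorIso k J H
      μIso_hom_natural_left := fun {p q} f r => by
        have := extendLeft_tensor_natural k J H f (𝟙 r)
        rw [(extendLeft k J H).map_id, tensorHom_id, tensorHom_id] at this
        exact this
      μIso_hom_natural_right := fun {p q} r f => by
        have := extendLeft_tensor_natural k J H (𝟙 r) f
        rw [(extendLeft k J H).map_id, id_tensorHom, id_tensorHom] at this
        exact this
      associativity := fun p q r => by
        refine congrArg₂ (fun x y => LinTensor.tmul (k := k)
          (X := ((extendLeft k J H).obj p ⊗ (extendLeft k J H).obj q) ⊗ (extendLeft k J H).obj r)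
          (Y := (extendLeft k J H).obj (p ⊗ (q ⊗ r))) x y) ?_ ?_
        · change (𝟙 _ ⊗ₘ 𝟙 _) ≫ 𝟙 _ ≫ (α_ _ _ _).hom = (α_ _ _ _).hom ≫ (𝟙 _ ⊗ₘ 𝟙 _) ≫ 𝟙 _
          simp
        · change (Functor.LaxMonoidal.μ H (p.1.right, p.2) (q.1.right, q.2) ⊗ₘ 𝟙 _) ≫ _ = _ ≫
            (𝟙 _ ⊗ₘ Functor.LaxMonoidal.μ H (q.1.right, q.2) (r.1.right, r.2)) ≫ _
          rw [tensorHom_id, id_tensorHom]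
          exact Functor.LaxMonoidal.associativity H (p.1.right, p.2) (q.1.right, q.2)
            (r.1.right, r.2)
      left_unitality := fun p => by
        refine congrArg₂ (fun x y => LinTensor.tmul (k := k)
          (X := 𝟙_ _ ⊗ (extendLeft k J H).obj p) (Y := (extendLeft k J H).obj p) x y) ?_ ?_
        · change (λ_ _).hom = (𝟙 _ ⊗ₘ 𝟙 _) ≫ 𝟙 _ ≫ (λ_ _).hom
          simp
        · change (λ_ _).hom = (Functor.LaxMonoidal.ε H ⊗ₘ 𝟙 _) ≫ _
          rw [tensorHom_id]
          exact Functor.LaxMonoidal.left_unitality H (p.1.right, p.2)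
      right_unitality := fun p => by
        refine congrArg₂ (fun x y => LinTensor.tmul (k := k)
          (X := (extendLeft k J H).obj p ⊗ 𝟙_ _) (Y := (extendLeft k J H).obj p) x y) ?_ ?_
        · change (ρ_ _).hom = (𝟙 _ ⊗ₘ 𝟙 _) ≫ 𝟙 _ ≫ (ρ_ _).hom
          simp
        · change (ρ_ _).hom = (𝟙 _ ⊗ₘ Functor.LaxMonoidal.ε H) ≫ _
          rw [id_tensorHom]
          exact Functor.LaxMonoidal.right_unitality H (p.1.right, p.2) }

end Extend

/-! ### Additive completion of a bilinear functor in its first variable. -/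

section MatMapLeft

/-- A bilinear functor `A × B ⥤ C` induces a bilinear functor `Mat_ A × B ⥤ Mat_ C`, entrywise in
the first variable. -/
def matMapLeft (H : A × B ⥤ C) [IsBilinear k H] : Mat_ A × B ⥤ Mat_ C where
  obj p := ⟨p.1.ι, fun i => H.obj (p.1.X i, p.2)⟩
  map f := fun i j => H.map (f.1 i j ×ₘ f.2)
  map_id p := by
    refine Mat_.hom_ext _ _ fun (i j : p.1.ι) => ?_
    by_cases h : i = j
    · subst h
      exact ((congrArg (fun x => H.map (x ×ₘ 𝟙 p.2)) (Mat_.id_apply_self p.1 i)).trans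
        (H.map_id _)).trans (Mat_.id_apply_self (⟨p.1.ι, fun i => H.obj (p.1.X i, p.2)⟩ : Mat_ C)
          i).symm
    · refine (congrArg (fun x => H.map (x ×ₘ 𝟙 p.2)) (Mat_.id_apply_of_ne p.1 i j h)).trans
        (Eq.trans ?_ (Mat_.id_apply_of_ne (⟨p.1.ι, fun i => H.obj (p.1.X i, p.2)⟩ : Mat_ C)
          i j h).symm)
      exact IsBilinear.map_zero_left k H (𝟙 p.2)
  map_comp {p q r} f g := by
    refine Mat_.hom_ext _ _ fun (i : p.1.ι) (j : r.1.ι) => ?_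
    -- With the second variable fixed at `f.2 ≫ g.2`, the functor is additive in the matrix entry,
    -- so it passes through the sum that defines the product of matrices.
    let Φ : (p.1.X i ⟶ r.1.X j) →+ (H.obj (p.1.X i, p.2) ⟶ H.obj (r.1.X j, r.2)) :=
      AddMonoidHom.mk' (fun x => H.map (x ×ₘ (f.2 ≫ g.2)))
        fun x y => IsBilinear.map_add_left k x y _
    refine (map_sum Φ _ _).trans (Finset.sum_congr rfl fun x _ => ?_)
    exact H.map_comp (f.1 i x ×ₘ f.2) (g.1 x j ×ₘ g.2)

instance matMapLeft_isBilinear (H : A × B ⥤ C) [IsBilinear k H] :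
    IsBilinear k (matMapLeft k H) where
  map_add_left _ _ _ := Mat_.hom_ext _ _ fun _ _ => IsBilinear.map_add_left k _ _ _
  map_add_right _ _ _ := Mat_.hom_ext _ _ fun _ _ => IsBilinear.map_add_right k _ _ _
  map_smul_left _ _ _ := Mat_.hom_ext _ _ fun _ _ => IsBilinear.map_smul_left _ _ _
  map_smul_right _ _ _ := Mat_.hom_ext _ _ fun _ _ => IsBilinear.map_smul_right _ _ _

theorem matMapLeft_single (H : A × B ⥤ C) [IsBilinear k H] {M N : Mat_ A} {Y Y' : B}
    (f : M.ι → N.ι) (φ : ∀ i, M.X i ⟶ N.X (f i)) (g : Y ⟶ Y') :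
    (matMapLeft k H).map (single f φ ×ₘ g) =
      single (M := (matMapLeft k H).obj (M, Y)) (N := (matMapLeft k H).obj (N, Y')) f
        (fun i => H.map (φ i ×ₘ g)) := by
  refine Mat_.hom_ext _ _ fun (i : M.ι) (j : N.ι) => ?_
  by_cases h : f i = j
  · subst h
    exact (congrArg (fun x => H.map (x ×ₘ g)) (single_self f φ i)).trans
      (single_self (M := (matMapLeft k H).obj (M, Y)) (N := (matMapLeft k H).obj (N, Y')) f
        (fun i => H.map (φ i ×ₘ g)) i).symm
  · refine (congrArg (fun x => H.map (x ×ₘ g)) (single_ne f φ h)).trans (Eq.trans ?_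
      (single_ne (M := (matMapLeft k H).obj (M, Y)) (N := (matMapLeft k H).obj (N, Y')) f
        (fun i => H.map (φ i ×ₘ g)) h).symm)
    exact IsBilinear.map_zero_left k H g

variable [MonoidalCategory A] [MonoidalPreadditive A]
  [MonoidalCategory B] [MonoidalPreadditive B]
  [MonoidalCategory C] [MonoidalPreadditive C]
  (H : A × B ⥤ C) [IsBilinear k H] [H.Monoidal]

/-- Compatibility of `matMapLeft` with tensor products of objects. -/
def matMapLeftTensorIso (p q : Mat_ A × B) :
    tensorMat ((matMapLeft k H).obj p) ((matMapLeft k H).obj q) ≅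
      (matMapLeft k H).obj (tensorMat p.1 q.1, p.2 ⊗ q.2) :=
  singleIso (M := tensorMat ((matMapLeft k H).obj p) ((matMapLeft k H).obj q))
    (N := (matMapLeft k H).obj (tensorMat p.1 q.1, p.2 ⊗ q.2)) (Equiv.refl _)
    fun i => Functor.Monoidal.μIso H (p.1.X i.1, p.2) (q.1.X i.2, q.2)

theorem matMapLeftTensorIso_hom (p q : Mat_ A × B) : (matMapLeftTensorIso k H p q).hom =
    single (M := tensorMat ((matMapLeft k H).obj p) ((matMapLeft k H).obj q))
      (N := (matMapLeft k H).obj (tensorMat p.1 q.1, p.2 ⊗ q.2)) (fun i => i)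
      (fun i => Functor.LaxMonoidal.μ H (p.1.X i.1, p.2) (q.1.X i.2, q.2)) := rfl

/-- The unit object as the value of `matMapLeft` at the unit object. -/
def matMapLeftUnitIso : unitMat C ≅ (matMapLeft k H).obj (unitMat A, 𝟙_ B) :=
  singleIso (M := unitMat C) (N := (matMapLeft k H).obj (unitMat A, 𝟙_ B)) (Equiv.refl _)
    fun _ => Functor.Monoidal.εIso H

theorem matMapLeftUnitIso_hom : (matMapLeftUnitIso k H).hom =
    single (M := unitMat C) (N := (matMapLeft k H).obj (unitMat A, 𝟙_ B)) (fun i => i)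
      (fun _ => Functor.LaxMonoidal.ε H) := rfl

theorem matMapLeft_tensor_natural {p p' q q' : Mat_ A × B} (f : p ⟶ p') (g : q ⟶ q') :
    tensorMatHom ((matMapLeft k H).map f) ((matMapLeft k H).map g) ≫
      (matMapLeftTensorIso k H p' q').hom =
    (matMapLeftTensorIso k H p q).hom ≫
      (matMapLeft k H).map (tensorMatHom f.1 g.1 ×ₘ (f.2 ⊗ₘ g.2)) := by
  refine Mat_.hom_ext _ _ fun i j => ?_
  refine (comp_single (M := tensorMat ((matMapLeft k H).obj p) ((matMapLeft k H).obj q))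
    (N := tensorMat ((matMapLeft k H).obj p') ((matMapLeft k H).obj q'))
    (K := (matMapLeft k H).obj (tensorMat p'.1 q'.1, p'.2 ⊗ q'.2)) _ _
    (Equiv.injective _) _ i j).trans ?_
  refine Eq.trans ?_ (single_comp (M := tensorMat ((matMapLeft k H).obj p)
    ((matMapLeft k H).obj q)) (N := (matMapLeft k H).obj (tensorMat p.1 q.1, p.2 ⊗ q.2))
    _ _ _ _ _).symm
  exact Functor.LaxMonoidal.μ_natural H (f.1 i.1 j.1 ×ₘ f.2) (g.1 i.2 j.2 ×ₘ g.2)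

theorem matMapLeft_associativity (p q r : Mat_ A × B) :
    (matMapLeftTensorIso k H p q).hom ▷ (matMapLeft k H).obj r ≫
      (matMapLeftTensorIso k H (p ⊗ q) r).hom ≫ (matMapLeft k H).map (α_ p q r).hom =
    (α_ ((matMapLeft k H).obj p) ((matMapLeft k H).obj q) ((matMapLeft k H).obj r)).hom ≫
      (matMapLeft k H).obj p ◁ (matMapLeftTensorIso k H q r).hom ≫
      (matMapLeftTensorIso k H p (q ⊗ r)).hom := by
  have h : (matMapLeft k H).map (α_ p q r).hom = single
      (M := (matMapLeft k H).obj (tensorMat (tensorMat p.1 q.1) r.1, (p.2 ⊗ q.2) ⊗ r.2))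
      (N := (matMapLeft k H).obj (tensorMat p.1 (tensorMat q.1 r.1), p.2 ⊗ (q.2 ⊗ r.2)))
      (fun i => (i.1.1, (i.1.2, i.2)))
      (fun i => H.map ((α_ (p.1.X i.1.1) (q.1.X i.1.2) (r.1.X i.2)).hom ×ₘ
        (α_ p.2 q.2 r.2).hom)) :=
    matMapLeft_single k H (M := tensorMat (tensorMat p.1 q.1) r.1)
      (N := tensorMat p.1 (tensorMat q.1 r.1)) _ _ _
  rw [h, associator_hom_eq_single]
  simp only [matMapLeftTensorIso_hom]
  erw [whiskerRight_single, whiskerLeft_single]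
  erw [single_comp_single, single_comp_single, single_comp_single, single_comp_single]
  refine congrArg (single _) ?_
  funext i
  exact Functor.LaxMonoidal.associativity H (p.1.X i.1.1, p.2) (q.1.X i.1.2, q.2) (r.1.X i.2, r.2)

instance matMapLeft_monoidal : (matMapLeft k H).Monoidal :=
  Functor.CoreMonoidal.toMonoidal
    { εIso := matMapLeftUnitIso k H
      μIso := matMapLeftTensorIso k H
      μIso_hom_natural_left := fun {p q} f r => by
        have := matMapLeft_tensor_natural k H f (𝟙 r)
        rw [(matMapLeft k H).map_id] at this
        refine this.trans (congrArg _ (congrArg _ ?_))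
        exact Prod.ext rfl (tensorHom_id _ _)
      μIso_hom_natural_right := fun {p q} r f => by
        have := matMapLeft_tensor_natural k H (𝟙 r) f
        rw [(matMapLeft k H).map_id] at this
        refine this.trans (congrArg _ (congrArg _ ?_))
        exact Prod.ext rfl (id_tensorHom _ _)
      associativity := matMapLeft_associativity k H
      left_unitality := fun p => by
        have h : (matMapLeft k H).map (λ_ p).hom = single
            (M := (matMapLeft k H).obj (tensorMat (unitMat A) p.1, 𝟙_ B ⊗ p.2))
            (N := (matMapLeft k H).obj p) (fun i => i.2)
            (fun i => H.map ((λ_ (p.1.X i.2)).hom ×ₘ (λ_ p.2).hom)) :=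
          matMapLeft_single k H (M := tensorMat (unitMat A) p.1) (N := p.1) _ _ _
        rw [h, leftUnitor_hom_eq_single, matMapLeftUnitIso_hom, matMapLeftTensorIso_hom]
        erw [whiskerRight_single]
        erw [single_comp_single, single_comp_single]
        refine congrArg (single _) ?_
        funext i
        exact Functor.LaxMonoidal.left_unitality H (p.1.X i.2, p.2)
      right_unitality := fun p => by
        have h : (matMapLeft k H).map (ρ_ p).hom = single
            (M := (matMapLeft k H).obj (tensorMat p.1 (unitMat A), p.2 ⊗ 𝟙_ B))
            (N := (matMapLeft k H).obj p) (fun i => i.1)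
            (fun i => H.map ((ρ_ (p.1.X i.1)).hom ×ₘ (ρ_ p.2).hom)) :=
          matMapLeft_single k H (M := tensorMat p.1 (unitMat A)) (N := p.1) _ _ _
        rw [h, rightUnitor_hom_eq_single, matMapLeftUnitIso_hom, matMapLeftTensorIso_hom]
        erw [whiskerLeft_single]
        erw [single_comp_single, single_comp_single]
        refine congrArg (single _) ?_
        funext i
        exact Functor.LaxMonoidal.right_unitality H (p.1.X i.1, p.2) }

end MatMapLeft

end Bilinear

/-! ### Change of grading group and the symmetric braiding of graded vector spaces. -/

section VecFunctors

variable (k : Type w) [Field k] {G : Type u₁} {G' : Type u₂}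

/-- The functor on lines induced by a homomorphism of the groups of degrees. -/
def Line.map [AddMonoid G] [AddMonoid G'] (φ : G →+ G') : Line k G ⥤ Line k G' where
  obj X := ⟨φ X.deg⟩
  map f := ⟨f.1, fun h => f.2 fun e => h (congrArg φ e)⟩

instance Line.map_additive [AddMonoid G] [AddMonoid G'] (φ : G →+ G') :
    (Line.map k φ).Additive where
  map_add := rfl

instance Line.map_linear [AddMonoid G] [AddMonoid G'] (φ : G →+ G') :
    (Line.map k φ).Linear k where
  map_smul _ _ := rfl

instance Line.map_monoidal [AddMonoid G] [AddMonoid G'] (φ : G →+ G') :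
    (Line.map k φ).Monoidal :=
  Functor.CoreMonoidal.toMonoidal
    { εIso := Line.isoOfEq φ.map_zero.symm
      μIso := fun X Y => Line.isoOfEq (φ.map_add X.deg Y.deg).symm
      μIso_hom_natural_left := fun f X => Subtype.ext (by
        change (f.1 * 1) * 1 = 1 * (f.1 * 1); ring)
      μIso_hom_natural_right := fun X f => Subtype.ext (by
        change (1 * f.1) * 1 = 1 * (1 * f.1); ring)
      associativity := fun X Y Z => Subtype.ext (by
        change ((1 : k) * 1) * (1 * 1) = 1 * ((1 * 1) * 1); ring)
      left_unitality := fun X => Subtype.ext (by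
        change (1 : k) = (1 * 1) * (1 * 1); ring)
      right_unitality := fun X => Subtype.ext (by
        change (1 : k) = (1 * 1) * (1 * 1); ring) }

/-- The trivial braiding on lines, graded by a commutative group. -/
instance Line.braided [AddCommMonoid G] : BraidedCategory (Line k G) where
  braiding X Y := Line.isoOfEq (add_comm X.deg Y.deg)
  braiding_naturality_right X _ _ f := Subtype.ext (by
    change (1 * f.1) * 1 = 1 * (f.1 * 1); ring)
  braiding_naturality_left f X := Subtype.ext (by
    change (f.1 * 1) * 1 = 1 * (1 * f.1); ring)
  hexagon_forward X Y Z := Subtype.ext (by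
    change (1 : k) * (1 * 1) = (1 * 1) * (1 * (1 * 1)); ring)
  hexagon_reverse X Y Z := Subtype.ext (by
    change (1 : k) * (1 * 1) = (1 * 1) * (1 * (1 * 1)); ring)

/-- The functor on graded vector spaces induced by a homomorphism of the groups of degrees. -/
abbrev Vec.map [AddMonoid G] [AddMonoid G'] (φ : G →+ G') : Vec k G ⥤ Vec k G' :=
  matMap (Line.map k φ)

end VecFunctors

/-! ### Regrading objects of `I ⊠ Vec_G`. -/

section Regrade

variable (k : Type w) [Field k] (I : Type u) [Category.{v} I] [Preadditive I] [Linear k I]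
  {G₁ : Type u₁} {G₂ : Type u₂} {G₃ : Type u₃}
  [AddCommGroup G₁] [AddCommGroup G₂] [AddCommGroup G₃]

/-- The functor `(V, W) ↦ φ V ⊗ ψ W`. -/
abbrev vecTensor (φ : G₁ →+ G₃) (ψ : G₂ →+ G₃) : Vec k G₁ × Vec k G₂ ⥤ Vec k G₃ :=
  (Vec.map k φ).prod (Vec.map k ψ) ⋙ tensor (Vec k G₃)

instance vecTensor_isBilinear (φ : G₁ →+ G₃) (ψ : G₂ →+ G₃) :
    IsBilinear k (vecTensor k φ ψ) :=
  IsBilinear.prod_comp k (Vec.map k φ) (Vec.map k ψ) (tensor (Vec k G₃))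

/-- The functor `(X ⊠ V, W) ↦ X ⊠ (φ V ⊗ ψ W)`. -/
abbrev regrade (φ : G₁ →+ G₃) (ψ : G₂ →+ G₃) :
    DeligneProduct k I (Vec k G₁) × Vec k G₂ ⥤ DeligneProduct k I (Vec k G₃) :=
  matMapLeft k (extendLeft k I (vecTensor k φ ψ))

variable [MonoidalCategory I] [MonoidalPreadditive I] [MonoidalLinear k I]

/-- The essential ingredient is that `tensor (Vec k G₃)` is monoidal, which requires a braiding on
`Vec k G₃`; the trivial braiding `Line.braided` provides it. -/
instance regrade_monoidal (φ : G₁ →+ G₃) (ψ : G₂ →+ G₃) : (regrade k I φ ψ).Monoidal :=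
  inferInstance

end Regrade

/-! ### The inclusions of the factors into a product of monoidal categories. -/

section Inclusions

open CategoryTheory.Prod

variable (A : Type u₁) [Category.{v₁} A] [MonoidalCategory A]
  (B : Type u₂) [Category.{v₂} B] [MonoidalCategory B]

/-- The functor `X ↦ (X, 𝟙)`. -/
def inclLeft : A ⥤ A × B where
  obj X := (X, 𝟙_ B)
  map f := f ×ₘ 𝟙 _

/-- The functor `Y ↦ (𝟙, Y)`. -/
def inclRight : B ⥤ A × B where
  obj Y := (𝟙_ A, Y)
  map f := 𝟙 _ ×ₘ f

instance inclLeft_monoidal : (inclLeft A B).Monoidal :=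
  Functor.CoreMonoidal.toMonoidal
    { εIso := Iso.refl _
      μIso := fun X Y => Iso.prod (Iso.refl (X ⊗ Y)) (λ_ (𝟙_ B))
      μIso_hom_natural_left := fun f X => by
        ext <;> simp [inclLeft]
      μIso_hom_natural_right := fun f X => by
        ext <;> simp [inclLeft]
      associativity := fun X Y Z => by
        ext <;> simp [inclLeft, unitors_equal]
      left_unitality := fun X => by
        ext <;> simp [inclLeft]
      right_unitality := fun X => by
        ext <;> simp [inclLeft, unitors_equal] }

instance inclRight_monoidal : (inclRight A B).Monoidal :=
  Functor.CoreMonoidal.toMonoidal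
    { εIso := Iso.refl _
      μIso := fun X Y => Iso.prod (λ_ (𝟙_ A)) (Iso.refl (X ⊗ Y))
      μIso_hom_natural_left := fun f X => by
        ext <;> simp [inclRight]
      μIso_hom_natural_right := fun f X => by
        ext <;> simp [inclRight]
      associativity := fun X Y Z => by
        ext <;> simp [inclRight, unitors_equal]
      left_unitality := fun X => by
        ext <;> simp [inclRight]
      right_unitality := fun X => by
        ext <;> simp [inclRight, unitors_equal] }

end Inclusions

/-! ### The universal bilinear functor. -/

section Pure

open CategoryTheory.Prod

variable (k : Type w) [CommRing k]
  (A : Type u₁) [Category.{v₁} A] [Preadditive A] [Linear k A]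
  (B : Type u₂) [Category.{v₂} B] [Preadditive B] [Linear k B]

/-- The universal bilinear functor. -/
def LinTensor.pure : A × B ⥤ LinTensor k A B where
  obj p := ⟨p.1, p.2⟩
  map f := LinTensor.tmul f.1 f.2

instance LinTensor.pure_isBilinear : IsBilinear k (LinTensor.pure k A B) where
  map_add_left _ _ _ := TensorProduct.add_tmul _ _ _
  map_add_right _ _ _ := TensorProduct.tmul_add _ _ _
  map_smul_left _ _ _ := rfl
  map_smul_right {X X' Y Y'} r f g :=
    TensorProduct.tmul_smul (R := k) (M := (X ⟶ X')) (N := (Y ⟶ Y')) r f g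

variable [MonoidalCategory A] [MonoidalPreadditive A] [MonoidalLinear k A]
  [MonoidalCategory B] [MonoidalPreadditive B] [MonoidalLinear k B]

instance LinTensor.pure_monoidal : (LinTensor.pure k A B).Monoidal :=
  Functor.CoreMonoidal.toMonoidal
    { εIso := Iso.refl _
      μIso := fun p q => Iso.refl _
      μIso_hom_natural_left := fun {p q} f r => by
        refine (Category.comp_id _).trans (Eq.trans ?_ (Category.id_comp _).symm)
        exact congrArg₂ (fun x y => LinTensor.tmul (k := k)
          (X := (LinTensor.pure k A B).obj (p ⊗ r)) (Y := (LinTensor.pure k A B).obj (q ⊗ r)) x y)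
          (tensorHom_id f.1 r.1) (tensorHom_id f.2 r.2)
      μIso_hom_natural_right := fun {p q} r f => by
        refine (Category.comp_id _).trans (Eq.trans ?_ (Category.id_comp _).symm)
        exact congrArg₂ (fun x y => LinTensor.tmul (k := k)
          (X := (LinTensor.pure k A B).obj (r ⊗ p)) (Y := (LinTensor.pure k A B).obj (r ⊗ q)) x y)
          (id_tensorHom r.1 f.1) (id_tensorHom r.2 f.2)
      associativity := fun p q r => by
        simp only [Iso.refl_hom]
        erw [id_whiskerRight, whiskerLeft_id, Category.id_comp, Category.id_comp, Category.comp_id,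
          Category.comp_id]
        rfl
      left_unitality := fun p => by
        simp only [Iso.refl_hom]
        erw [id_whiskerRight, Category.id_comp, Category.id_comp]
        rfl
      right_unitality := fun p => by
        simp only [Iso.refl_hom]
        erw [whiskerLeft_id, Category.id_comp, Category.id_comp]
        rfl }

end Pure

/-! ### Corestriction to full subcategories. -/

section FullSubcategoryLift

variable {C : Type u₁} [Category.{v₁} C] [MonoidalCategory C]
  {D : Type u₂} [Category.{v₂} D] [MonoidalCategory D]

/-- A monoidal functor that takes values in a full monoidal subcategory is monoidal as a functor
to that subcategory. -/
instance objectPropertyLift_monoidal (P : ObjectProperty D) [P.IsMonoidal] (F : C ⥤ D) [F.Monoidal]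
    (h : ∀ X, P (F.obj X)) : (P.lift F h).Monoidal :=
  Functor.CoreMonoidal.toMonoidal
    { εIso := P.isoMk (Functor.Monoidal.εIso F)
      μIso := fun X Y => P.isoMk (Functor.Monoidal.μIso F X Y)
      μIso_hom_natural_left := fun f X => by
        ext
        exact Functor.LaxMonoidal.μ_natural_left (F := F) f X
      μIso_hom_natural_right := fun X f => by
        ext
        exact Functor.LaxMonoidal.μ_natural_right (F := F) X f
      associativity := fun X Y Z => by
        ext
        exact Functor.LaxMonoidal.associativity F X Y Z
      left_unitality := fun X => by
        ext
        exact Functor.LaxMonoidal.left_unitality F X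
      right_unitality := fun X => by
        ext
        exact Functor.LaxMonoidal.right_unitality F X }

variable {E : Type u₁} [Category.{v₁} E] [Preadditive E]
  {E' : Type u₂} [Category.{v₂} E'] [Preadditive E'] (P : ObjectProperty E')

instance objectPropertyLift_linear (k : Type w) [Semiring k] [Linear k E] [Linear k E']
    (F : E ⥤ E') [F.Additive] [F.Linear k] (h : ∀ X, P (F.obj X)) : (P.lift F h).Linear k where
  map_smul f r := by
    ext
    exact F.map_smul r f

end FullSubcategoryLift

/-! ### Finite direct sum decompositions. -/

section IsSumOf

variable {C : Type u₁} [Category.{v₁} C] [Preadditive C] {D : Type u₂} [Category.{v₂} D]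
  [Preadditive D]

/-- The object `X` is a finite direct sum of objects with the property `Q`. -/
def IsSumOf (Q : ObjectProperty C) : ObjectProperty C := fun X =>
  ∃ (J : Type) (_ : Fintype J) (S : J → C) (p : ∀ j, X ⟶ S j) (i : ∀ j, S j ⟶ X),
    (∀ j, Q (S j)) ∧ (∀ j, i j ≫ p j = 𝟙 (S j)) ∧ (∀ j l, j ≠ l → i j ≫ p l = 0) ∧
    ∑ j, p j ≫ i j = 𝟙 X

theorem IsSumOf.of {Q : ObjectProperty C} {X : C} (h : Q X) : IsSumOf Q X :=
  ⟨Unit, inferInstance, fun _ => X, fun _ => 𝟙 X, fun _ => 𝟙 X, fun _ => h,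
    fun _ => Category.comp_id _, fun _ _ h => absurd rfl h, by simp⟩

/-- Decompositions can be refined: the summands of the summands are indexed by the sigma type. -/
theorem IsSumOf.trans {Q Q' : ObjectProperty C} (h : ∀ X, Q X → IsSumOf Q' X) {X : C}
    (hX : IsSumOf Q X) : IsSumOf Q' X := by
  obtain ⟨J, _, S, p, i, hS, h₁, h₂, h₃⟩ := hX
  choose K hK T q r hT g₁ g₂ g₃ using fun j => h _ (hS j)
  refine ⟨Σ j, K j, inferInstance, fun a => T a.1 a.2, fun a => p a.1 ≫ q a.1 a.2,
    fun a => r a.1 a.2 ≫ i a.1, fun a => hT _ _, fun a => ?_, ?_, ?_⟩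
  · simp [reassoc_of% h₁, g₁]
  · rintro ⟨j, a⟩ ⟨l, b⟩ hne
    by_cases hjl : j = l
    · subst hjl
      simp only [Category.assoc, reassoc_of% h₁]
      exact g₂ j a b fun e => hne (by rw [e])
    · simp [reassoc_of% h₂ j l hjl]
  · rw [Fintype.sum_sigma, ← h₃]
    refine Finset.sum_congr rfl fun j _ => ?_
    have := congrArg (fun f => p j ≫ f ≫ i j) (g₃ j)
    simp only [Category.id_comp] at this
    rw [← this]
    simp [Preadditive.sum_comp, Preadditive.comp_sum]

theorem IsSumOf.mono {Q Q' : ObjectProperty C} (h : ∀ X, Q X → Q' X) {X : C}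
    (hX : IsSumOf Q X) : IsSumOf Q' X :=
  hX.trans fun X hX => IsSumOf.of (h X hX)

/-- A decomposition is expressed by equations between projections and injections, and an additive
functor preserves these. No biproduct has to exist in either category. -/
theorem IsSumOf.map {Q : ObjectProperty C} {Q' : ObjectProperty D} (F : C ⥤ D) [F.Additive]
    (h : ∀ X, Q X → Q' (F.obj X)) {X : C} (hX : IsSumOf Q X) : IsSumOf Q' (F.obj X) := by
  obtain ⟨J, _, S, p, i, hS, h₁, h₂, h₃⟩ := hX
  refine ⟨J, inferInstance, fun j => F.obj (S j), fun j => F.map (p j), fun j => F.map (i j),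
    fun j => h _ (hS j), fun j => ?_, fun j l hjl => ?_, ?_⟩
  · rw [← F.map_comp, h₁, F.map_id]
  · rw [← F.map_comp, h₂ j l hjl, F.map_zero]
  · simp_rw [← F.map_comp]
    rw [← F.map_sum, h₃, F.map_id]

/-- The projections are the columns of the identity matrix and the injections are its rows; the
required relations are the entries of `𝟙 M ≫ 𝟙 M = 𝟙 M`. -/
theorem isSumOf_embedding (M : Mat_ C) :
    IsSumOf (fun N => ∃ i, N = (Mat_.embedding C).obj (M.X i)) M := by
  refine ⟨M.ι, inferInstance, fun i => (Mat_.embedding C).obj (M.X i),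
    fun i => fun a _ => (𝟙 M : M ⟶ M) a i, fun i => fun _ a => (𝟙 M : M ⟶ M) i a,
    fun i => ⟨i, rfl⟩, fun i => ?_, fun i j hij => ?_, ?_⟩
  · refine Mat_.hom_ext _ _ fun a b => ?_
    exact (congrFun (congrFun (Category.comp_id (𝟙 M)) i) i).trans
      ((Mat_.id_apply_self M i).trans (Mat_.id_apply_self ((Mat_.embedding C).obj (M.X i)) a).symm)
  · refine Mat_.hom_ext _ _ fun a b => ?_
    exact (congrFun (congrFun (Category.comp_id (𝟙 M)) i) j).trans (Mat_.id_apply_of_ne M i j hij)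
  · have key : ∀ (s : Finset M.ι) (f : M.ι → (M ⟶ M)) (a b : M.ι),
        (∑ i ∈ s, f i) a b = ∑ i ∈ s, f i a b := fun s f a b => by
      classical
      induction s using Finset.induction_on with
      | empty => rfl
      | insert c s hc ih => rw [Finset.sum_insert hc, Finset.sum_insert hc, Mat_.add_apply, ih]
    refine Mat_.hom_ext _ _ fun a b => ?_
    rw [key]
    refine Eq.trans (Finset.sum_congr rfl fun i _ => ?_)
      (congrFun (congrFun (Category.comp_id (𝟙 M)) a) b)
    exact Fintype.sum_unique (ι := PUnit)
      (fun _ => (𝟙 M : M ⟶ M) a i ≫ (𝟙 M : M ⟶ M) i b)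

/-- In a full subcategory closed under retracts, a decomposition in the ambient category is a
decomposition in the subcategory. -/
theorem IsSumOf.fullSubcategory {P Q : ObjectProperty C}
    (hP : ∀ X Y : C, Retract X Y → P Y → P X) {X : P.FullSubcategory} (hX : IsSumOf Q X.obj) :
    IsSumOf (fun Y : P.FullSubcategory => Q Y.obj) X := by
  obtain ⟨J, _, S, p, i, hS, h₁, h₂, h₃⟩ := hX
  refine ⟨J, inferInstance, fun j => ⟨S j, hP _ _ ⟨i j, p j, h₁ j⟩ X.property⟩,
    fun j => ObjectProperty.homMk (p j), fun j => ObjectProperty.homMk (i j), hS,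
    fun j => ?_, fun j l hjl => ?_, ?_⟩
  · ext; exact h₁ j
  · ext; exact h₂ j l hjl
  · refine P.ι.map_injective ?_
    rw [P.ι.map_sum, P.ι.map_id]
    exact h₃

/-- A morphism is recovered from its matrix coefficients `i j ≫ f ≫ p' l`, which are morphisms
between objects with property `Q`. -/
theorem faithful_of_isSumOf {Q : ObjectProperty C} (hC : ∀ X, IsSumOf Q X) (F : C ⥤ D)
    [F.Additive] (h : ∀ X Y, Q X → Q Y → Function.Injective (F.map : (X ⟶ Y) → _)) :
    F.Faithful where
  map_injective {X Y} f g hfg := by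
    obtain ⟨J, _, S, p, i, hS, -, -, h₃⟩ := hC X
    obtain ⟨J', _, S', p', i', hS', -, -, h₃'⟩ := hC Y
    have e : ∀ j l, i j ≫ f ≫ p' l = i j ≫ g ≫ p' l := fun j l =>
      h _ _ (hS j) (hS' l) (by simp only [F.map_comp, hfg])
    have key : ∀ f : X ⟶ Y, f = ∑ j, ∑ l, p j ≫ (i j ≫ f ≫ p' l) ≫ i' l := fun f => by
      calc f = (∑ j, p j ≫ i j) ≫ f ≫ ∑ l, p' l ≫ i' l := by rw [h₃, h₃']; simp
        _ = _ := by
          simp only [Preadditive.sum_comp, Preadditive.comp_sum, Category.assoc]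
          exact Finset.sum_comm
    rw [key f, key g]
    simp_rw [e]

/-- Lift each matrix coefficient and reassemble the lifts along the decompositions of source and
target. -/
theorem full_of_isSumOf {Q : ObjectProperty C} (hC : ∀ X, IsSumOf Q X) (F : C ⥤ D)
    [F.Additive] (h : ∀ X Y, Q X → Q Y → Function.Surjective (F.map : (X ⟶ Y) → _)) :
    F.Full where
  map_surjective {X Y} f := by
    obtain ⟨J, _, S, p, i, hS, -, -, h₃⟩ := hC X
    obtain ⟨J', _, S', p', i', hS', -, -, h₃'⟩ := hC Y
    choose g hg using fun j l => h _ _ (hS j) (hS' l) (F.map (i j) ≫ f ≫ F.map (p' l))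
    refine ⟨∑ j, ∑ l, p j ≫ g j l ≫ i' l, ?_⟩
    calc F.map (∑ j, ∑ l, p j ≫ g j l ≫ i' l)
        = F.map (∑ j, p j ≫ i j) ≫ f ≫ F.map (∑ l, p' l ≫ i' l) := by
          simp only [F.map_sum, F.map_comp, hg, Preadditive.sum_comp, Preadditive.comp_sum,
            Category.assoc]
          exact Finset.sum_comm
      _ = f := by rw [h₃, h₃']; simp

/-- The biproduct of preimages of the summands is a preimage of the sum. -/
theorem essImage_of_isSumOf [HasFiniteBiproducts C] (F : C ⥤ D) [F.Additive] {X : D}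
    (hX : IsSumOf F.essImage X) : F.essImage X := by
  classical
  obtain ⟨J, _, S, p, i, hS, h₁, h₂, h₃⟩ := hX
  choose T hT using hS
  let e := fun j => (hT j).some
  refine ⟨⨁ T, ⟨⟨∑ j, F.map (biproduct.π T j) ≫ (e j).hom ≫ i j,
    ∑ j, p j ≫ (e j).inv ≫ F.map (biproduct.ι T j), ?_, ?_⟩⟩⟩
  · have : ∀ j l, F.map (biproduct.π T j) ≫ (e j).hom ≫ i j ≫ p l ≫ (e l).inv ≫
        F.map (biproduct.ι T l) = if j = l then F.map (biproduct.π T j ≫ biproduct.ι T j)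
        else 0 := fun j l => by
      split_ifs with hjl
      · subst hjl
        simp [reassoc_of% h₁]
      · rw [reassoc_of% h₂ j l hjl]
        simp
    simp only [Preadditive.sum_comp, Preadditive.comp_sum, Category.assoc, this,
      Finset.sum_ite_eq', Finset.mem_univ, if_true]
    rw [← F.map_sum, biproduct.total, F.map_id]
  · have : ∀ j l, p j ≫ (e j).inv ≫ F.map (biproduct.ι T j) ≫ F.map (biproduct.π T l) ≫
        (e l).hom ≫ i l = if j = l then p j ≫ i j else 0 := fun j l => by
      split_ifs with hjl
      · subst hjl
        rw [← F.map_comp_assoc, biproduct.ι_π_self]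
        simp
      · rw [← F.map_comp_assoc, biproduct.ι_π_ne _ hjl]
        simp
    simp only [Preadditive.sum_comp, Preadditive.comp_sum, Category.assoc, this,
      Finset.sum_ite_eq', Finset.mem_univ, if_true]
    exact h₃

end IsSumOf

instance matHasBinaryBiproducts {S : Type u₁} [Category.{v₁} S] [Preadditive S] :
    HasBinaryBiproducts (Mat_ S) :=
  hasBinaryBiproducts_of_finite_biproducts _

/-! ### Closure properties of fusion subcategories. -/

section FusionSubcategory

variable {C : Type u₁} [Category.{v₁} C] [Preadditive C] [MonoidalCategory C]
  {D : Type u₂} [Category.{v₂} D] [Preadditive D] [MonoidalCategory D]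

theorem IsFusionSubcategory.iso {P : ObjectProperty C} (hP : IsFusionSubcategory P) {X Y : C}
    (e : X ≅ Y) (h : P Y) : P X :=
  hP.summand X Y (Retract.ofIso e) h

/-- From `∑ j, p j ≫ i j = 𝟙 X` alone, `X` is a retract of an iterated binary biproduct of the
summands. Closure under binary sums and retracts then suffices. -/
theorem IsFusionSubcategory.isSumOf [HasBinaryBiproducts C] {P : ObjectProperty C}
    (hP : IsFusionSubcategory P) {X : C} (hX : IsSumOf P X) : P X := by
  classical
  obtain ⟨J, _, S, p, i, hS, -, -, h₃⟩ := hX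
  have key : ∀ s : Finset J, ∃ (B : C) (_ : P B) (f : X ⟶ B) (g : B ⟶ X),
      f ≫ g = ∑ j ∈ s, p j ≫ i j := fun s => by
    induction s using Finset.induction_on with
    -- The empty sum factors through the unit object by zero maps; a zero object is not among the
    -- axioms of a fusion subcategory.
    | empty => exact ⟨𝟙_ C, hP.unit, 0, 0, by simp⟩
    | insert j s hj ih =>
      obtain ⟨B, hB, f, g, hfg⟩ := ih
      refine ⟨S j ⊞ B, hP.sum _ _ _ (BinaryBiproduct.isBilimit (S j) B) (hS j) hB,
        biprod.lift (p j) f, biprod.desc (i j) g, ?_⟩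
      rw [biprod.lift_desc, hfg, Finset.sum_insert hj]
  obtain ⟨B, hB, f, g, hfg⟩ := key Finset.univ
  exact hP.summand X B ⟨f, g, hfg.trans h₃⟩ hB

open Functor.LaxMonoidal Functor.OplaxMonoidal in
/-- A monoidal functor preserves duals. -/
@[reducible]
def exactPairingMap (F : C ⥤ D) [F.Monoidal] {X Y : C} (e : ExactPairing X Y) :
    ExactPairing (F.obj X) (F.obj Y) where
  coevaluation' := ε F ≫ F.map (η_ X Y) ≫ δ F X Y
  evaluation' := μ F Y X ≫ F.map (ε_ X Y) ≫ η F
  coevaluation_evaluation' := by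
    have h := congrArg F.map (ExactPairing.coevaluation_evaluation X Y)
    simp only [F.map_comp] at h
    have a := Functor.OplaxMonoidal.associativity_inv F Y X Y
    have b : F.obj Y ◁ F.map (η_ X Y) = μ F _ _ ≫ F.map (Y ◁ η_ X Y) ≫ δ F _ _ := by
      simp only [Functor.Monoidal.map_whiskerLeft, Category.assoc,
        Functor.Monoidal.μ_δ_assoc, Functor.Monoidal.μ_δ, Category.comp_id]
    have c : F.map (ε_ X Y) ▷ F.obj Y = μ F _ _ ≫ F.map (ε_ X Y ▷ Y) ≫ δ F _ _ := by
      simp only [Functor.Monoidal.map_whiskerRight, Category.assoc,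
        Functor.Monoidal.μ_δ_assoc, Functor.Monoidal.μ_δ, Category.comp_id]
    simp only [MonoidalCategory.whiskerLeft_comp, comp_whiskerRight, Category.assoc, b, c]
    rw [reassoc_of% a]
    simp only [Functor.Monoidal.whiskerRight_δ_μ_assoc, Functor.Monoidal.δ_μ_assoc]
    rw [reassoc_of% h]
    simp
  evaluation_coevaluation' := by
    have h := congrArg F.map (ExactPairing.evaluation_coevaluation X Y)
    simp only [F.map_comp] at h
    have a := Functor.OplaxMonoidal.associativity F X Y X
    have b : F.obj X ◁ F.map (ε_ X Y) = μ F _ _ ≫ F.map (X ◁ ε_ X Y) ≫ δ F _ _ := by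
      simp only [Functor.Monoidal.map_whiskerLeft, Category.assoc,
        Functor.Monoidal.μ_δ_assoc, Functor.Monoidal.μ_δ, Category.comp_id]
    have c : F.map (η_ X Y) ▷ F.obj X = μ F _ _ ≫ F.map (η_ X Y ▷ X) ≫ δ F _ _ := by
      simp only [Functor.Monoidal.map_whiskerRight, Category.assoc,
        Functor.Monoidal.μ_δ_assoc, Functor.Monoidal.μ_δ, Category.comp_id]
    simp only [MonoidalCategory.whiskerLeft_comp, comp_whiskerRight, Category.assoc, b, c]
    rw [reassoc_of% a]
    simp only [Functor.Monoidal.whiskerLeft_δ_μ_assoc, Functor.Monoidal.δ_μ_assoc]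
    rw [reassoc_of% h]
    simp

/-- The preimage of a fusion subcategory under an additive monoidal functor is a fusion
subcategory. -/
theorem IsFusionSubcategory.inverseImage {P : ObjectProperty D} (hP : IsFusionSubcategory P)
    (F : C ⥤ D) [F.Monoidal] [F.Additive] : IsFusionSubcategory (P.inverseImage F) where
  unit := hP.iso (Functor.Monoidal.εIso F).symm hP.unit
  tensor X Y hX hY := hP.iso (Functor.Monoidal.μIso F X Y).symm (hP.tensor _ _ hX hY)
  sum X Y b hb hX hY := by
    have := preservesBinaryBiproduct_of_preservesBiproduct F X Y
    exact hP.sum _ _ (F.mapBinaryBicone b) (isBinaryBilimitOfPreserves F hb) hX hY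
  summand X Y r hY := hP.summand _ _ (r.map F) hY
  rightDual X Y e hX := hP.rightDual _ _ (exactPairingMap F e) hX
  leftDual X Y e hX := hP.leftDual _ _ (exactPairingMap F e) hX

end FusionSubcategory

/-! ### The objects `X ⊠ g` and their behaviour under tensor products and regrading. -/

section Boxes

open CategoryTheory.Prod

variable (k : Type w) [Field k] {I : Type u} [Category.{v} I] [Preadditive I] [Linear k I]
  {G : Type u₁}

/-- The object `X ⊠ g`, with the line in degree `g` as second factor. -/
abbrev boxLine (X : I) (g : G) : DeligneProduct k I (Vec k G) := box k X (Vec.line k g)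

/-- A bilinear functor with its first variable fixed is additive, so it preserves decompositions of
the second. -/
theorem isSumOf_sectR {A : Type u₁} [Category.{v₁} A] [Preadditive A] [Linear k A]
    {B : Type u₂} [Category.{v₂} B] [Preadditive B] [Linear k B]
    {C : Type u₃} [Category.{v₃} C] [Preadditive C] [Linear k C] (H : A × B ⥤ C) [IsBilinear k H]
    (X : A) {Q : ObjectProperty B} {Q' : ObjectProperty C} (h : ∀ Y, Q Y → Q' (H.obj (X, Y)))
    {Y : B} (hY : IsSumOf Q Y) : IsSumOf Q' (H.obj (X, Y)) := by
  have : (Prod.sectR X B ⋙ H).Additive := ⟨IsBilinear.map_add_right k _ _ _⟩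
  exact hY.map (Prod.sectR X B ⋙ H) h

theorem isSumOf_sectL {A : Type u₁} [Category.{v₁} A] [Preadditive A] [Linear k A]
    {B : Type u₂} [Category.{v₂} B] [Preadditive B] [Linear k B]
    {C : Type u₃} [Category.{v₃} C] [Preadditive C] [Linear k C] (H : A × B ⥤ C) [IsBilinear k H]
    (Y : B) {Q : ObjectProperty A} {Q' : ObjectProperty C} (h : ∀ X, Q X → Q' (H.obj (X, Y)))
    {X : A} (hX : IsSumOf Q X) : IsSumOf Q' (H.obj (X, Y)) := by
  have : (Prod.sectL A Y ⋙ H).Additive := ⟨IsBilinear.map_add_left k _ _ _⟩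
  exact hX.map (Prod.sectL A Y ⋙ H) h

/-- The functor `(X, Y) ↦ X ⊠ Y`. -/
abbrev boxFunctor (A : Type u₁) [Category.{v₁} A] [Preadditive A] [Linear k A]
    (B : Type u₂) [Category.{v₂} B] [Preadditive B] [Linear k B] :
    A × B ⥤ DeligneProduct k A B :=
  LinTensor.pure k A B ⋙ Mat_.embedding _

instance embedding_linear {S : Type u₁} [Category.{v₁} S] [Preadditive S] [Linear k S] :
    (Mat_.embedding S).Linear k where
  map_smul _ _ := rfl

instance boxFunctor_isBilinear (A : Type u₁) [Category.{v₁} A] [Preadditive A] [Linear k A]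
    (B : Type u₂) [Category.{v₂} B] [Preadditive B] [Linear k B] :
    IsBilinear k (boxFunctor k A B) :=
  IsBilinear.comp k _ _

/-- The functor `X ↦ X ⊠ g`. -/
abbrev boxLineFunctor (g : G) : I ⥤ DeligneProduct k I (Vec k G) :=
  Prod.sectL I (Vec.line k g) ⋙ boxFunctor k I (Vec k G)

theorem isSumOf_line (V : Vec k G) : IsSumOf (fun W => ∃ g, W = Vec.line k g) V :=
  (isSumOf_embedding V).mono fun W hW => by
    obtain ⟨i, rfl⟩ := hW
    exact ⟨(V.X i).deg, rfl⟩

/-- Split the formal direct sum into its summands `X ⊠ Y`, then refine by decomposing `Y`, then `X`.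
-/
theorem isSumOf_box {A : Type u₁} [Category.{v₁} A] [Preadditive A] [Linear k A]
    {B : Type u₂} [Category.{v₂} B] [Preadditive B] [Linear k B] {Q : ObjectProperty A}
    (hA : ∀ X, IsSumOf Q X) {Q' : ObjectProperty B} (hB : ∀ Y, IsSumOf Q' Y)
    (M : DeligneProduct k A B) :
    IsSumOf (fun N => ∃ X Y, Q X ∧ Q' Y ∧ N = box k X Y) M := by
  refine (isSumOf_embedding M).trans fun N hN => ?_
  obtain ⟨i, rfl⟩ := hN
  refine IsSumOf.trans (Q := fun N => ∃ Y, Q' Y ∧ N = box k (M.X i).left Y) ?_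
    (isSumOf_sectR k (boxFunctor k A B) (M.X i).left (Q := Q')
      (fun Y hY => ⟨Y, hY, rfl⟩) (hB (M.X i).right))
  rintro _ ⟨Y, hY, rfl⟩
  exact isSumOf_sectL k (boxFunctor k A B) Y (Q := Q) (fun X hX => ⟨X, Y, hX, hY, rfl⟩) (hA _)

/-- Only the graded factor is decomposed; `X` stays an arbitrary object of `I`. This is enough for
all later arguments, which therefore never have to run through the simple objects of `I`. -/
theorem isSumOf_boxLine (M : DeligneProduct k I (Vec k G)) :
    IsSumOf (fun N => ∃ (X : I) (g : G), N = boxLine k X g) M :=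
  (isSumOf_box k (Q := fun _ => True) (fun _ => IsSumOf.of trivial) (isSumOf_line k) M).mono (by
    rintro _ ⟨X, _, -, ⟨g, rfl⟩, rfl⟩
    exact ⟨X, g, rfl⟩)

/-- The product of two lines. -/
def Vec.lineTensorIso [AddMonoid G] (g h : G) :
    Vec.line k g ⊗ Vec.line k h ≅ Vec.line k (g + h) :=
  Functor.Monoidal.μIso (Mat_.embedding (Line k G)) ⟨g⟩ ⟨h⟩

variable [MonoidalCategory I] [MonoidalPreadditive I] [MonoidalLinear k I]

/-- The product of two objects `X ⊠ g` and `Y ⊠ h`. -/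
def boxLineTensorIso [AddMonoid G] (X Y : I) (g h : G) :
    boxLine k X g ⊗ boxLine k Y h ≅ boxLine k (X ⊗ Y) (g + h) :=
  Functor.Monoidal.μIso (Mat_.embedding (LinTensor k I (Vec k G))) ⟨X, Vec.line k g⟩
    ⟨Y, Vec.line k h⟩ ≪≫ (Mat_.embedding (LinTensor k I (Vec k G))).mapIso
      (LinTensor.isoMk (X := ⟨X, Vec.line k g⟩ ⊗ ⟨Y, Vec.line k h⟩)
        (Y := ⟨X ⊗ Y, Vec.line k (g + h)⟩) (Iso.refl _) (Vec.lineTensorIso k g h))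

variable {G₁ : Type u₁} {G₂ : Type u₂} {G₃ : Type u₃}
  [AddCommGroup G₁] [AddCommGroup G₂] [AddCommGroup G₃]

/-- The effect of `regrade` on `X ⊠ g`. -/
def regradeBoxLineIso (φ : G₁ →+ G₃) (ψ : G₂ →+ G₃) (X : I) (g : G₁) (h : G₂) :
    (regrade k I φ ψ).obj (boxLine k X g, Vec.line k h) ≅ boxLine k X (φ g + ψ h) :=
  (Mat_.embedding (LinTensor k I (Vec k G₃))).mapIso
    (LinTensor.isoMk (X := ⟨X, Vec.line k (φ g) ⊗ Vec.line k (ψ h)⟩)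
      (Y := ⟨X, Vec.line k (φ g + ψ h)⟩) (Iso.refl _) (Vec.lineTensorIso k _ _))

/-- The functor on graded objects induced by a homomorphism of the groups of degrees. -/
abbrev regradeLeft (φ : G₁ →+ G₃) : DeligneProduct k I (Vec k G₁) ⥤ DeligneProduct k I (Vec k G₃) :=
  inclLeft _ (Vec k G₁) ⋙ regrade k I φ (0 : G₁ →+ G₃)

instance regradeLeft_additive (φ : G₁ →+ G₃) : (regradeLeft k (I := I) φ).Additive :=
  ⟨IsBilinear.map_add_left k (H := regrade k I φ (0 : G₁ →+ G₃)) _ _ _⟩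

/-- The effect of `regradeLeft` on `X ⊠ g`. -/
def regradeLeftBoxLineIso (φ : G₁ →+ G₃) (X : I) (g : G₁) :
    (regradeLeft k φ).obj (boxLine k X g) ≅ boxLine k X (φ g) :=
  regradeBoxLineIso k φ (0 : G₁ →+ G₃) X g 0 ≪≫ eqToIso (by simp)

end Boxes

/-! ### Objects forced into a fusion subcategory by `Z ⊠ g`. -/

section CyclicMembership

variable (k : Type w) [Field k] {I : Type u} [Category.{v} I] [Preadditive I] [Linear k I]
  [MonoidalCategory I] [MonoidalPreadditive I] [MonoidalLinear k I]

/-- The form in which the fusion rule for `Z ⊗ Z` enters the proof. -/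
theorem IsIsing.exists_retract {δ Z : I} (h : IsIsing δ Z) : Nonempty (Retract (𝟙_ I) (Z ⊗ Z)) := by
  obtain ⟨b, -, ⟨e⟩⟩ := h.Z_tensor_Z
  exact ⟨⟨b.inl ≫ e.inv, e.hom ≫ b.fst, by simp⟩⟩

theorem generated_boxLine_mul {G : Type u₁} [AddCommGroup G] {P : ObjectProperty
    (DeligneProduct k I (Vec k G))} (hP : IsFusionSubcategory P) {X Y : I} {g h : G}
    (hX : P (boxLine k X g)) (hY : P (boxLine k Y h)) : P (boxLine k (X ⊗ Y) (g + h)) :=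
  hP.iso (boxLineTensorIso k X Y g h).symm (hP.tensor _ _ hX hY)

theorem boxLine_retract {G : Type u₁} [AddCommGroup G] {P : ObjectProperty
    (DeligneProduct k I (Vec k G))} (hP : IsFusionSubcategory P) {X Y : I} {g : G}
    (r : Retract X Y) (hY : P (boxLine k Y g)) : P (boxLine k X g) :=
  hP.summand _ _ (r.map (boxLineFunctor k g)) hY

/-- The square of `Z ⊠ g` is `(Z ⊗ Z) ⊠ 2g`, which has `𝟙 ⊠ 2g` as a retract. Tensor powers of the
latter give all even multiples of `g`, and one more factor `Z ⊠ g` gives the odd ones. -/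
theorem boxLine_mem {δ Z : I} (h : IsIsing δ Z) {G : Type u₁} [AddCommGroup G]
    {P : ObjectProperty (DeligneProduct k I (Vec k G))} (hP : IsFusionSubcategory P) {g : G}
    (hZ : P (boxLine k Z g)) (n : ℕ) :
    P (boxLine k (𝟙_ I) ((2 * n) • g)) ∧ P (boxLine k Z ((2 * n + 1) • g)) := by
  obtain ⟨r⟩ := h.exists_retract
  have h₂ : P (boxLine k (𝟙_ I) (g + g)) :=
    boxLine_retract k hP r (generated_boxLine_mul k hP hZ hZ)
  have key : ∀ n : ℕ, P (boxLine k (𝟙_ I) ((2 * n) • g)) := fun n => by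
    induction n with
    | zero =>
      simp only [mul_zero, zero_smul]
      exact hP.unit
    | succ n ih =>
      have := boxLine_retract k hP (Retract.ofIso (λ_ (𝟙_ I)).symm)
        (generated_boxLine_mul k hP ih h₂)
      convert! this using 2
      rw [mul_add, add_smul, mul_one, two_smul ℕ g]
  refine ⟨key n, ?_⟩
  rw [add_smul, one_smul]
  exact boxLine_retract k hP (Retract.ofIso (λ_ Z).symm)
    (generated_boxLine_mul k hP (key n) hZ)

end CyclicMembership

/-! ### The functor that combines the two gradings, and its values. -/

section Assemble

open CategoryTheory.Prod

variable (k : Type w) [Field k] {I : Type u} [Category.{v} I] [Preadditive I] [Linear k I]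
  [MonoidalCategory I] [MonoidalPreadditive I] [MonoidalLinear k I]
  {G₁ : Type u₁} {G₂ : Type u₂} {G₃ : Type u₃}
  [AddCommGroup G₁] [AddCommGroup G₂] [AddCommGroup G₃]
  (φ : G₁ →+ G₃) (ψ : G₂ →+ G₃)
  (P₁ : ObjectProperty (DeligneProduct k I (Vec k G₁))) [P₁.IsMonoidal]
  (P₃ : ObjectProperty (DeligneProduct k I (Vec k G₃))) [P₃.IsMonoidal]

/-- The restriction of `regrade` to a full subcategory. -/
abbrev regradeOn : P₁.FullSubcategory × Vec k G₂ ⥤ DeligneProduct k I (Vec k G₃) :=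
  P₁.ι.prod (𝟭 (Vec k G₂)) ⋙ regrade k I φ ψ

instance regradeOn_isBilinear : IsBilinear k (regradeOn k φ ψ P₁) :=
  IsBilinear.prod_comp k P₁.ι (𝟭 (Vec k G₂)) (regrade k I φ ψ)

/-- The functor `Y ⊠ V ↦ Y ⊗ V` that combines the degrees. -/
abbrev combine : DeligneProduct k P₁.FullSubcategory (Vec k G₂) ⥤ DeligneProduct k I (Vec k G₃) :=
  matMap (LinTensor.lift k (regradeOn k φ ψ P₁)) ⋙ flatten

/-- A formal direct sum with a single summand. -/
def flattenEmbeddingIso {T : Type u₁} [Category.{v₁} T] [Preadditive T] (N : Mat_ T) :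
    flatten.obj ((Mat_.embedding (Mat_ T)).obj N) ≅ N :=
  singleIso (M := flatten.obj ((Mat_.embedding (Mat_ T)).obj N)) (N := N)
    { toFun := fun p => p.2
      invFun := fun a => ⟨PUnit.unit, a⟩
      left_inv := fun _ => rfl
      right_inv := fun _ => rfl } fun _ => Iso.refl _

/-- The value of `combine` at `Y ⊠ V`. -/
def combineBoxIso (Y : P₁.FullSubcategory) (V : Vec k G₂) :
    (combine k φ ψ P₁).obj (box k Y V) ≅ (regrade k I φ ψ).obj (Y.obj, V) :=
  flattenEmbeddingIso ((regrade k I φ ψ).obj (Y.obj, V))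

variable {P₁ P₃}

/-- Since `(Y, V) ≅ (Y, 𝟙) ⊗ (𝟙, V)` and `regrade` is monoidal, the two variables can be treated
separately. For `Y` the preimage of `P₃` is a fusion subcategory containing the generator; `V` is
decomposed into lines, to which `hψ` applies. -/
theorem regrade_mem {Z : I} {g₁ : G₁} (hP₁ : P₁ = generated (boxLine k Z g₁))
    (hP₃ : IsFusionSubcategory P₃) (hZ : P₃ (boxLine k Z (φ g₁)))
    (hψ : ∀ g, P₃ (boxLine k (𝟙_ I) (ψ g))) (Y : DeligneProduct k I (Vec k G₁)) (hY : P₁ Y)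
    (V : Vec k G₂) : P₃ ((regrade k I φ ψ).obj (Y, V)) := by
  have h₁ : ∀ Y, P₁ Y → P₃ ((regrade k I φ ψ).obj (Y, 𝟙_ (Vec k G₂))) := by
    have hadd : (inclLeft _ (Vec k G₂) ⋙ regrade k I φ ψ).Additive :=
      ⟨IsBilinear.map_add_left k (H := regrade k I φ ψ) _ _ _⟩
    intro Y hY
    rw [hP₁] at hY
    refine hY _ (hP₃.inverseImage (inclLeft _ (Vec k G₂) ⋙ regrade k I φ ψ)) ?_
    refine hP₃.iso (regradeBoxLineIso k φ ψ Z g₁ 0) ?_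
    rwa [map_zero, add_zero]
  have h₂ : P₃ ((regrade k I φ ψ).obj (𝟙_ _, V)) := by
    refine hP₃.isSumOf (isSumOf_sectR k (regrade k I φ ψ) (𝟙_ _) (Q' := P₃) ?_ (isSumOf_line k V))
    rintro _ ⟨g, rfl⟩
    refine hP₃.iso (regradeBoxLineIso k φ ψ (𝟙_ I) 0 g) ?_
    rw [map_zero, zero_add]
    exact hψ g
  refine hP₃.iso ?_ (hP₃.tensor _ _ (h₁ Y hY) h₂)
  exact (regrade k I φ ψ).mapIso (Iso.prod (ρ_ Y).symm (λ_ V).symm) ≪≫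
    (Functor.Monoidal.μIso (regrade k I φ ψ) (Y, 𝟙_ _) (𝟙_ _, V)).symm

theorem combine_mem (hP₃ : IsFusionSubcategory P₃)
    (h : ∀ Y, P₁ Y → ∀ V, P₃ ((regrade k I φ ψ).obj (Y, V)))
    (T : DeligneProduct k P₁.FullSubcategory (Vec k G₂)) : P₃ ((combine k φ ψ P₁).obj T) := by
  refine hP₃.isSumOf ((isSumOf_embedding T).map (combine k φ ψ P₁) ?_)
  rintro _ ⟨i, rfl⟩
  exact hP₃.iso (combineBoxIso k φ ψ P₁ (T.X i).left (T.X i).right) (h _ (T.X i).left.property _)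

variable (P₁ P₃)

/-- The functor `combine` as a functor to a full subcategory that contains its values. -/
abbrev combineTo (h : ∀ T, P₃ ((combine k φ ψ P₁).obj T)) :
    DeligneProduct k P₁.FullSubcategory (Vec k G₂) ⥤ P₃.FullSubcategory :=
  P₃.lift (combine k φ ψ P₁) h

/-- `X ⊠ g ⊠ h` for `X ⊠ g` in a full subcategory. -/
abbrev boxLine₂ (Y : P₁.FullSubcategory) (h : G₂) :
    DeligneProduct k P₁.FullSubcategory (Vec k G₂) := box k Y (Vec.line k h)

variable {P₁} in
-- The summands `X ⊠ g` of an object of `P₁` are retracts of it, so they lie in `P₁` again and the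
-- decomposition takes place in the subcategory.
theorem isSumOf_boxLine₂ (hP₁ : IsFusionSubcategory P₁)
    (T : DeligneProduct k P₁.FullSubcategory (Vec k G₂)) :
    IsSumOf (fun N => ∃ (X : I) (g : G₁) (hg : P₁ (boxLine k X g)) (h : G₂),
      N = boxLine₂ k P₁ ⟨boxLine k X g, hg⟩ h) T := by
  refine (isSumOf_box k (fun Y : P₁.FullSubcategory =>
    (isSumOf_boxLine k Y.obj).fullSubcategory hP₁.summand) (isSumOf_line k) T).mono ?_
  rintro _ ⟨⟨_, hY⟩, _, ⟨X, g, rfl⟩, ⟨h, rfl⟩, rfl⟩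
  exact ⟨X, g, hY, h, rfl⟩

/-! ### Homomorphisms between the generating objects -/

theorem line_hom_eq_smul {g : G₁} (f : Vec.line k g ⟶ Vec.line k g) :
    ∃ c : k, f = c • 𝟙 (Vec.line k g) := by
  refine ⟨(f PUnit.unit PUnit.unit).1, Mat_.hom_ext _ _ fun a b => Subtype.ext ?_⟩
  exact (mul_one _).symm.trans (congrArg (fun x => (f PUnit.unit PUnit.unit).1 * Subtype.val x)
    (Mat_.id_apply_self (Vec.line k g) a).symm)

theorem line_hom_eq_zero {g h : G₁} (hgh : g ≠ h) (f : Vec.line k g ⟶ Vec.line k h) : f = 0 :=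
  Mat_.hom_ext _ _ fun a b => Subtype.ext ((f a b).2 hgh)

theorem line_id_ne_zero (g : G₁) : 𝟙 (Vec.line k g) ≠ 0 := fun h => by
  have := congrFun (congrFun h PUnit.unit) PUnit.unit
  exact one_ne_zero (congrArg Subtype.val
    ((Mat_.id_apply_self (Vec.line k g) PUnit.unit).symm.trans this))

variable {A : Type u₁} [Category.{v₁} A] [Preadditive A] [Linear k A]
  {B : Type u₂} [Category.{v₂} B] [Preadditive B] [Linear k B]

/-- When the endomorphisms of `Y` are scalars, they can be moved across the tensor sign into the
first factor. -/
theorem LinTensor.exists_tmul_id {X X' : A} {Y : B} (hY : ∀ f : Y ⟶ Y, ∃ c : k, f = c • 𝟙 Y)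
    (f : (⟨X, Y⟩ : LinTensor k A B) ⟶ ⟨X', Y⟩) :
    ∃ a : X ⟶ X', f = LinTensor.tmul (X := ⟨X, Y⟩) (Y := ⟨X', Y⟩) a (𝟙 Y) := by
  induction f using LinTensor.hom_induction with
  | zero => exact ⟨0, (TensorProduct.zero_tmul _ _).symm⟩
  | tmul a b =>
    obtain ⟨c, rfl⟩ := hY b
    exact ⟨c • a, (TensorProduct.smul_tmul c a (𝟙 Y)).symm⟩
  | add f g hf hg =>
    obtain ⟨a, rfl⟩ := hf
    obtain ⟨b, rfl⟩ := hg
    exact ⟨a + b, (TensorProduct.add_tmul _ _ _).symm⟩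

/-- Over a field there is a linear functional on `End Y` with value `1` at `𝟙 Y`; applied to the
second factor it recovers `a` from `a ⊗ 𝟙`. -/
theorem LinTensor.tmul_id_injective {X X' : A} {Y : B} (hY : 𝟙 Y ≠ 0) :
    Function.Injective fun a : X ⟶ X' =>
      LinTensor.tmul (k := k) (X := ⟨X, Y⟩) (Y := ⟨X', Y⟩) a (𝟙 Y) := fun a b hab => by
  obtain ⟨e, he⟩ := Module.Projective.exists_dual_eq_one k hY
  have h := congrArg (fun x => TensorProduct.rid k (X ⟶ X') (LinearMap.lTensor (X ⟶ X') e x)) hab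
  simpa [LinTensor.tmul, he] using h

theorem LinTensor.hom_eq_zero_left {X X' : A} {Y Y' : B} (h : ∀ f : X ⟶ X', f = 0)
    (f : (⟨X, Y⟩ : LinTensor k A B) ⟶ ⟨X', Y'⟩) : f = 0 := by
  induction f using LinTensor.hom_induction with
  | zero => rfl
  | tmul a b =>
    rw [h a]
    exact TensorProduct.zero_tmul _ _
  | add f g hf hg => rw [hf, hg, add_zero]

theorem LinTensor.hom_eq_zero_right {X X' : A} {Y Y' : B} (h : ∀ f : Y ⟶ Y', f = 0)
    (f : (⟨X, Y⟩ : LinTensor k A B) ⟶ ⟨X', Y'⟩) : f = 0 := by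
  induction f using LinTensor.hom_induction with
  | zero => rfl
  | tmul a b =>
    rw [h b]
    exact TensorProduct.tmul_zero _ _
  | add f g hf hg => rw [hf, hg, add_zero]

end Assemble

/-! ### The combining functor is an equivalence. -/

section CombineFullyFaithful

variable (k : Type w) [Field k] {I : Type u} [Category.{v} I] [Preadditive I] [Linear k I]
  [MonoidalCategory I] [MonoidalPreadditive I] [MonoidalLinear k I]
  {G₁ : Type u₁} {G₂ : Type u₂} {G₃ : Type u₃}
  [AddCommGroup G₁] [AddCommGroup G₂] [AddCommGroup G₃]
  (φ : G₁ →+ G₃) (ψ : G₂ →+ G₃)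
  {P₁ : ObjectProperty (DeligneProduct k I (Vec k G₁))} [P₁.IsMonoidal]

/-- The morphism `a ⊠ 𝟙` between objects `X ⊠ g ⊠ h`. -/
abbrev boxLine₂Map {X X' : I} {g : G₁} (hX : P₁ (boxLine k X g)) (hX' : P₁ (boxLine k X' g))
    (h : G₂) (a : X ⟶ X') : boxLine₂ k P₁ ⟨boxLine k X g, hX⟩ h ⟶
      boxLine₂ k P₁ ⟨boxLine k X' g, hX'⟩ h :=
  (Mat_.embedding _).map (LinTensor.tmul
    (X := (⟨⟨boxLine k X g, hX⟩, Vec.line k h⟩ : LinTensor k P₁.FullSubcategory (Vec k G₂)))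
    (Y := ⟨⟨boxLine k X' g, hX'⟩, Vec.line k h⟩)
    (ObjectProperty.homMk ((Mat_.embedding _).map
      (LinTensor.tmul (X := (⟨X, Vec.line k g⟩ : LinTensor k I (Vec k G₁)))
        (Y := ⟨X', Vec.line k g⟩) a (𝟙 _)))) (𝟙 _))

/-- Two applications of `LinTensor.exists_tmul_id` remove the lines of degree `h` and `g` in turn.
-/
theorem boxLine₂_hom_eq {X X' : I} {g : G₁} (hX : P₁ (boxLine k X g)) (hX' : P₁ (boxLine k X' g))
    (h : G₂) (f : boxLine₂ k P₁ ⟨boxLine k X g, hX⟩ h ⟶ boxLine₂ k P₁ ⟨boxLine k X' g, hX'⟩ h) :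
    ∃ a : X ⟶ X', f = boxLine₂Map k hX hX' h a := by
  obtain ⟨f, rfl⟩ := (Mat_.embedding _).map_surjective f
  obtain ⟨b, rfl⟩ := LinTensor.exists_tmul_id k (fun f => line_hom_eq_smul k f) f
  obtain ⟨b⟩ := b
  obtain ⟨b, rfl⟩ := (Mat_.embedding _).map_surjective b
  obtain ⟨a, rfl⟩ := LinTensor.exists_tmul_id k (fun f => line_hom_eq_smul k f) b
  exact ⟨a, rfl⟩

theorem combine_map_boxLine₂Map {X X' : I} {g : G₁} (hX : P₁ (boxLine k X g))
    (hX' : P₁ (boxLine k X' g)) (h : G₂) (a : X ⟶ X') :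
    (combine k φ ψ P₁).map (boxLine₂Map k hX hX' h a) ⟨PUnit.unit, PUnit.unit⟩
      ⟨PUnit.unit, PUnit.unit⟩ =
    LinTensor.tmul (X := (⟨X, (vecTensor k φ ψ).obj (Vec.line k g, Vec.line k h)⟩ :
      LinTensor k I (Vec k G₃)))
      (Y := ⟨X', (vecTensor k φ ψ).obj (Vec.line k g, Vec.line k h)⟩) a (𝟙 _) :=
  congrArg (fun x => LinTensor.tmul (k := k)
    (X := (⟨X, (vecTensor k φ ψ).obj (Vec.line k g, Vec.line k h)⟩ : LinTensor k I (Vec k G₃)))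
    (Y := ⟨X', (vecTensor k φ ψ).obj (Vec.line k g, Vec.line k h)⟩) a x)
    ((vecTensor k φ ψ).map_id (Vec.line k g, Vec.line k h))

/-- The space of morphisms is a tensor product with a factor `Hom` between lines of different
degrees, which vanishes. -/
theorem boxLine₂_hom_eq_zero {X X' : I} {g g' : G₁} (hX : P₁ (boxLine k X g))
    (hX' : P₁ (boxLine k X' g')) {h h' : G₂} (hne : g ≠ g' ∨ h ≠ h')
    (f : boxLine₂ k P₁ ⟨boxLine k X g, hX⟩ h ⟶ boxLine₂ k P₁ ⟨boxLine k X' g', hX'⟩ h') :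
    f = 0 := by
  obtain ⟨f, rfl⟩ := (Mat_.embedding _).map_surjective f
  suffices f = 0 from (congrArg _ this).trans (Functor.map_zero _ _ _)
  rcases hne with hne | hne
  · refine LinTensor.hom_eq_zero_left k (fun a => ?_) f
    obtain ⟨a⟩ := a
    obtain ⟨a, rfl⟩ := (Mat_.embedding _).map_surjective a
    exact ObjectProperty.hom_ext _ <| (congrArg (Mat_.embedding _).map
      (LinTensor.hom_eq_zero_right k
      (fun b => line_hom_eq_zero k hne b) a)).trans (Functor.map_zero _ _ _)
  · exact LinTensor.hom_eq_zero_right k (fun a => line_hom_eq_zero k hne a) f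

theorem vecTensor_line_hom_eq_smul {g : G₁} {h : G₂}
    (f : (vecTensor k φ ψ).obj (Vec.line k g, Vec.line k h) ⟶
      (vecTensor k φ ψ).obj (Vec.line k g, Vec.line k h)) : ∃ c : k, f = c • 𝟙 _ := by
  let e : (vecTensor k φ ψ).obj (Vec.line k g, Vec.line k h) ≅ Vec.line k (φ g + ψ h) :=
    Vec.lineTensorIso k (φ g) (ψ h)
  obtain ⟨c, hc⟩ := line_hom_eq_smul k (e.inv ≫ f ≫ e.hom)
  refine ⟨c, ?_⟩
  rw [← cancel_epi e.inv, ← cancel_mono e.hom, Category.assoc, hc]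
  simp

theorem vecTensor_line_hom_eq_zero {g g' : G₁} {h h' : G₂} (hne : φ g + ψ h ≠ φ g' + ψ h')
    (f : (vecTensor k φ ψ).obj (Vec.line k g, Vec.line k h) ⟶
      (vecTensor k φ ψ).obj (Vec.line k g', Vec.line k h')) : f = 0 := by
  let e : (vecTensor k φ ψ).obj (Vec.line k g, Vec.line k h) ≅ Vec.line k (φ g + ψ h) :=
    Vec.lineTensorIso k (φ g) (ψ h)
  let e' : (vecTensor k φ ψ).obj (Vec.line k g', Vec.line k h') ≅ Vec.line k (φ g' + ψ h') :=
    Vec.lineTensorIso k (φ g') (ψ h')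
  have := line_hom_eq_zero k hne (e.inv ≫ f ≫ e'.hom)
  rw [← cancel_epi e.inv, ← cancel_mono e'.hom, Category.assoc, this]
  simp

theorem vecTensor_line_id_ne_zero (g : G₁) (h : G₂) :
    𝟙 ((vecTensor k φ ψ).obj (Vec.line k g, Vec.line k h)) ≠ 0 := fun h₀ => by
  let e : (vecTensor k φ ψ).obj (Vec.line k g, Vec.line k h) ≅ Vec.line k (φ g + ψ h) :=
    Vec.lineTensorIso k (φ g) (ψ h)
  refine line_id_ne_zero k (φ g + ψ h) ?_
  rw [← e.inv_hom_id, ← Category.id_comp e.hom, h₀]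
  simp

variable {φ ψ}

/-- Between generating objects of different degrees there are no nonzero morphisms to begin with; in
equal degrees both sides are parametrised by `X ⟶ X'`. The images of different degrees may coincide
at this point. -/
theorem combine_faithful (hP₁ : IsFusionSubcategory P₁) : (combine k φ ψ P₁).Faithful := by
  refine faithful_of_isSumOf (isSumOf_boxLine₂ k hP₁) _ ?_
  rintro _ _ ⟨X, g, hX, h, rfl⟩ ⟨X', g', hX', h', rfl⟩ f f' hff
  by_cases hne : g ≠ g' ∨ h ≠ h'
  · rw [boxLine₂_hom_eq_zero k hX hX' hne f, boxLine₂_hom_eq_zero k hX hX' hne f']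
  · obtain ⟨rfl, rfl⟩ : g = g' ∧ h = h' := by tauto
    obtain ⟨a, rfl⟩ := boxLine₂_hom_eq k hX hX' h f
    obtain ⟨a', rfl⟩ := boxLine₂_hom_eq k hX hX' h f'
    refine congrArg _ (LinTensor.tmul_id_injective k (vecTensor_line_id_ne_zero k φ ψ g h) ?_)
    exact (combine_map_boxLine₂Map k φ ψ hX hX' h a).symm.trans
      ((congrFun (congrFun hff _) _).trans (combine_map_boxLine₂Map k φ ψ hX hX' h a'))

/-- Here the injectivity of `(g, h) ↦ φ g + ψ h` is essential: a collision of degrees would create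
morphisms in the target that do not come from the source. -/
theorem combine_full (hφψ : ∀ g g' h h', φ g + ψ h = φ g' + ψ h' → g = g' ∧ h = h')
    (hP₁ : IsFusionSubcategory P₁) : (combine k φ ψ P₁).Full := by
  refine full_of_isSumOf (isSumOf_boxLine₂ k hP₁) _ ?_
  rintro _ _ ⟨X, g, hX, h, rfl⟩ ⟨X', g', hX', h', rfl⟩ f
  by_cases hne : g ≠ g' ∨ h ≠ h'
  · refine ⟨0, (Functor.map_zero _ _ _).trans (Mat_.hom_ext _ _ fun a b => ?_)⟩
    exact (LinTensor.hom_eq_zero_right k (X := X) (X' := X')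
      (fun f => vecTensor_line_hom_eq_zero k φ ψ (fun e => by
        have := hφψ _ _ _ _ e
        tauto) f) (f a b)).symm
  · obtain ⟨rfl, rfl⟩ : g = g' ∧ h = h' := by tauto
    obtain ⟨a, ha⟩ := LinTensor.exists_tmul_id k (X := X) (X' := X')
      (fun f => vecTensor_line_hom_eq_smul k φ ψ f) (f ⟨PUnit.unit, PUnit.unit⟩
        ⟨PUnit.unit, PUnit.unit⟩)
    refine ⟨boxLine₂Map k hX hX' h a, Mat_.hom_ext _ _ fun _ _ => ?_⟩
    exact (combine_map_boxLine₂Map k φ ψ hX hX' h a).trans ha.symm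

variable {P₃ : ObjectProperty (DeligneProduct k I (Vec k G₃))} [P₃.IsMonoidal]

theorem combineTo_isEquivalence (hφψ : ∀ g g' h h', φ g + ψ h = φ g' + ψ h' → g = g' ∧ h = h')
    (hP₁ : IsFusionSubcategory P₁)
    (hP₃ : IsFusionSubcategory P₃)
    (hmem : ∀ T, P₃ ((combine k φ ψ P₁).obj T))
    (hess : ∀ (X : I) (g : G₃), P₃ (boxLine k X g) →
      ∃ (g₁ : G₁) (g₂ : G₂), φ g₁ + ψ g₂ = g ∧ P₁ (boxLine k X g₁)) :
    (combineTo k φ ψ P₁ P₃ hmem).IsEquivalence := by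
  have := combine_faithful k (φ := φ) (ψ := ψ) hP₁
  have := combine_full k hφψ hP₁
  have : (combineTo k φ ψ P₁ P₃ hmem).EssSurj := ⟨fun Y => by
    -- `Y` is a sum of objects `X ⊠ g`, which remain in `P₃` because it is closed under retracts;
    -- `hess` splits the degree of each.
    refine essImage_of_isSumOf _
      (((isSumOf_boxLine k Y.obj).fullSubcategory hP₃.summand).mono fun W hW => ?_)
    obtain ⟨X, g, hXg⟩ := hW
    obtain ⟨W, hW⟩ := W
    obtain rfl : W = boxLine k X g := hXg
    obtain ⟨g₁, g₂, rfl, hX⟩ := hess X g hW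
    exact ⟨boxLine₂ k P₁ ⟨boxLine k X g₁, hX⟩ g₂, ⟨P₃.isoMk
      (combineBoxIso k φ ψ P₁ _ _ ≪≫ regradeBoxLineIso k φ ψ X g₁ g₂)⟩⟩⟩
  exact {}

end CombineFullyFaithful

/-! ### Comparing two braidings on one monoidal category. -/

section BraidingComparison

variable {C : Type u₁} [Category.{v₁} C] [MonoidalCategory C]

/-- The two braidings differ by the scalar `r` at the pair `(X, W)`. -/
def BraidingScalar [Preadditive C] {k : Type w} [CommRing k] [Linear k C]
    (b c : BraidedCategory C) (r : k) (X W : C) : Prop :=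
  (b.braiding X W).hom = r • (c.braiding X W).hom

/-- The two braidings agree at the pair `(X, W)`. -/
def BraidingAgree (b c : BraidedCategory C) (X W : C) : Prop :=
  (b.braiding X W).hom = (c.braiding X W).hom

variable {b c : BraidedCategory C}

theorem BraidingAgree.tensor_left {X Y W : C} (h₁ : BraidingAgree b c X W)
    (h₂ : BraidingAgree b c Y W) : BraidingAgree b c (X ⊗ Y) W := by
  unfold BraidingAgree at *
  refine (@BraidedCategory.braiding_tensor_left_hom C _ _ b X Y W).trans
    (Eq.trans ?_ (@BraidedCategory.braiding_tensor_left_hom C _ _ c X Y W).symm)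
  rw [h₁, h₂]

variable (b c) in
theorem BraidingAgree.unit_left (W : C) : BraidingAgree b c (𝟙_ C) W :=
  (@braiding_tensorUnit_left C _ _ b W).trans (@braiding_tensorUnit_left C _ _ c W).symm

/-- Passing to reverse braidings exchanges the two arguments, so closure properties need to be
proved in the first argument only. -/
theorem BraidingAgree.reverse {X W : C} (h : BraidingAgree b c X W) :
    BraidingAgree (@reverseBraiding C _ _ b) (@reverseBraiding C _ _ c) W X :=
  congrArg Iso.inv (Iso.ext h)

theorem BraidingAgree.of_reverse {X W : C}
    (h : BraidingAgree (@reverseBraiding C _ _ b) (@reverseBraiding C _ _ c) W X) :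
    BraidingAgree b c X W :=
  congrArg Iso.inv (Iso.ext h)

/-- Naturality of the braiding against the evaluation `Y ⊗ X ⟶ 𝟙`, with the hexagon for `Y ⊗ X`,
expresses the braiding of the dual `Y` with `W` through the inverse braiding of `X` with `W`. -/
theorem tensorRightHomEquiv_symm_braiding [BraidedCategory C] (X Y W : C) [ExactPairing X Y] :
    (tensorRightHomEquiv (Y ⊗ W) X Y W).symm (β_ Y W).hom =
      (α_ Y W X).hom ≫ Y ◁ (β_ X W).inv ≫ (α_ Y X W).inv ≫ ε_ X Y ▷ W ≫ (λ_ W).hom := by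
  change (β_ Y W).hom ▷ X ≫ (α_ _ _ _).hom ≫ W ◁ ε_ X Y ≫ (ρ_ W).hom = _
  have h := BraidedCategory.braiding_naturality_left (ε_ X Y) W
  rw [BraidedCategory.braiding_tensor_left_hom, braiding_tensorUnit_left] at h
  simp only [Category.assoc] at h
  have h' := h =≫ (ρ_ W).hom
  simp only [Category.assoc, Iso.inv_hom_id, Category.comp_id] at h'
  rw [h']
  simp

/-- The mirror argument with the coevaluation: the braiding of `Y` with `W` determines that of `X`
with `W`. -/
theorem tensorRightHomEquiv_braiding_inv [BraidedCategory C] (X Y W : C) [ExactPairing X Y] :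
    tensorRightHomEquiv W X Y (X ⊗ W) (β_ X W).inv =
      (λ_ W).inv ≫ η_ X Y ▷ W ≫ (α_ X Y W).hom ≫ X ◁ (β_ Y W).hom ≫ (α_ X W Y).inv := by
  change (ρ_ W).inv ≫ W ◁ η_ X Y ≫ (α_ _ _ _).inv ≫ (β_ X W).inv ▷ Y = _
  have h := BraidedCategory.braiding_naturality_left (η_ X Y) W
  rw [BraidedCategory.braiding_tensor_left_hom, braiding_tensorUnit_left] at h
  simp only [Category.assoc] at h
  have h' := (λ_ W).inv ≫= h
  simp only [Iso.inv_hom_id_assoc] at h'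
  rw [← reassoc_of% h']
  simp

theorem BraidingAgree.rightDual {X Y W : C} [ExactPairing X Y] (h : BraidingAgree b c X W) :
    BraidingAgree b c Y W := by
  apply (tensorRightHomEquiv (Y ⊗ W) X Y W).symm.injective
  refine (@tensorRightHomEquiv_symm_braiding C _ _ b X Y W _).trans
    (Eq.trans ?_ (@tensorRightHomEquiv_symm_braiding C _ _ c X Y W _).symm)
  rw [Iso.ext h]

theorem BraidingAgree.leftDual {X Y W : C} [ExactPairing X Y] (h : BraidingAgree b c Y W) :
    BraidingAgree b c X W := by
  suffices (b.braiding X W).symm = (c.braiding X W).symm from congrArg Iso.inv this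
  refine Iso.ext ((tensorRightHomEquiv W X Y (X ⊗ W)).injective ?_)
  refine (@tensorRightHomEquiv_braiding_inv C _ _ b X Y W _).trans
    (Eq.trans ?_ (@tensorRightHomEquiv_braiding_inv C _ _ c X Y W _).symm)
  rw [Iso.ext h]

/-- On images of `F` both braidings are the transport of `a` along the invertible tensorator. -/
theorem BraidingAgree.of_isBraidedFunctor {D : Type u₂} [Category.{v₂} D] [MonoidalCategory D]
    (a : BraidedCategory D) (F : D ⥤ C) [F.Monoidal]
    (hb : @IsBraidedFunctor D _ _ a C _ _ b F _) (hc : @IsBraidedFunctor D _ _ a C _ _ c F _)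
    (X Y : D) : BraidingAgree b c (F.obj X) (F.obj Y) := by
  unfold BraidingAgree
  rw [← cancel_mono (Functor.LaxMonoidal.μ F Y X)]
  exact (hb X Y).symm.trans (hc X Y)

section Scalars

variable [Preadditive C] {k : Type w} [CommRing k] [Linear k C]

theorem braidingScalar_one_iff {X W : C} :
    BraidingScalar b c (1 : k) X W ↔ BraidingAgree b c X W := by
  unfold BraidingScalar BraidingAgree
  rw [one_smul]

/-- By naturality the braiding of `X` is the sum of the braidings of the `S j`, conjugated by `p j`
and `i j`. Since only `∑ j, p j ≫ i j = 𝟙 X` is needed, this covers retracts as well as direct sums.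
-/
theorem BraidingScalar.of_sum {r : k} {X W : C} {J : Type*} [Fintype J] {S : J → C}
    [MonoidalPreadditive C] {p : ∀ j, X ⟶ S j} {i : ∀ j, S j ⟶ X} (hpi : ∑ j, p j ≫ i j = 𝟙 X)
    (h : ∀ j, BraidingScalar b c r (S j) W) : BraidingScalar b c r X W := by
  have key : ∀ b : BraidedCategory C, (b.braiding X W).hom =
      ∑ j, (p j ▷ W) ≫ (b.braiding (S j) W).hom ≫ (W ◁ i j) := fun b => by
    calc (b.braiding X W).hom = (∑ j, p j ≫ i j) ▷ W ≫ (b.braiding X W).hom := by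
          rw [hpi, id_whiskerRight, Category.id_comp]
      _ = _ := by
          simp only [sum_whiskerRight, Preadditive.sum_comp, comp_whiskerRight, Category.assoc,
            b.braiding_naturality_left]
  unfold BraidingScalar at h ⊢
  rw [key b, key c]
  simp_rw [h, Linear.smul_comp, Linear.comp_smul, Finset.smul_sum]

variable [MonoidalPreadditive C]

theorem BraidingScalar.retract {r : k} {X Y W : C} (e : Retract X Y)
    (h : BraidingScalar b c r Y W) : BraidingScalar b c r X W :=
  BraidingScalar.of_sum (J := Unit) (S := fun _ => Y) (p := fun _ => e.i) (i := fun _ => e.r)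
    (by simp) fun _ => h

theorem BraidingScalar.isSumOf {r : k} {W : C} {Q : ObjectProperty C}
    (h : ∀ X, Q X → BraidingScalar b c r X W) {X : C} (hX : IsSumOf Q X) :
    BraidingScalar b c r X W := by
  obtain ⟨J, _, S, p, i, hS, -, -, hpi⟩ := hX
  exact BraidingScalar.of_sum hpi fun j => h _ (hS j)

variable [MonoidalLinear k C]

/-- The hexagon writes the braiding of `X ⊗ Y` as a composite containing each of the two braidings
once, so the scalars multiply. -/
theorem BraidingScalar.tensor_left {r s : k} {X Y W : C} (h₁ : BraidingScalar b c r X W)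
    (h₂ : BraidingScalar b c s Y W) : BraidingScalar b c (r * s) (X ⊗ Y) W := by
  unfold BraidingScalar at *
  refine (@BraidedCategory.braiding_tensor_left_hom C _ _ b X Y W).trans
    (Eq.trans ?_ (congrArg ((r * s) • ·)
      (@BraidedCategory.braiding_tensor_left_hom C _ _ c X Y W)).symm)
  simp only [h₁, h₂, MonoidalLinear.whiskerLeft_smul, MonoidalLinear.smul_whiskerRight,
    Linear.smul_comp, Linear.comp_smul, smul_smul]

theorem BraidingScalar.tensor_right {r s : k} {X Y W : C} (h₁ : BraidingScalar b c r W X)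
    (h₂ : BraidingScalar b c s W Y) : BraidingScalar b c (r * s) W (X ⊗ Y) := by
  unfold BraidingScalar at *
  refine (@BraidedCategory.braiding_tensor_right_hom C _ _ b W X Y).trans
    (Eq.trans ?_ (congrArg ((r * s) • ·)
      (@BraidedCategory.braiding_tensor_right_hom C _ _ c W X Y)).symm)
  simp only [h₁, h₂, MonoidalLinear.whiskerLeft_smul, MonoidalLinear.smul_whiskerRight,
    Linear.smul_comp, Linear.comp_smul, smul_smul]
  rw [mul_comm]

end Scalars

end BraidingComparison

/-! ### Braided functors: composites, inclusions and embeddings. -/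

section BraidedInclusions

open CategoryTheory.Prod

theorem isBraidedFunctor_comp {C : Type u₁} [Category.{v₁} C] [MonoidalCategory C]
    [BraidedCategory C] {D : Type u₂} [Category.{v₂} D] [MonoidalCategory D] [BraidedCategory D]
    {E : Type u₃} [Category.{v₃} E] [MonoidalCategory E] [BraidedCategory E]
    {F : C ⥤ D} [F.Monoidal] {G : D ⥤ E} [G.Monoidal] (hF : IsBraidedFunctor F)
    (hG : IsBraidedFunctor G) : IsBraidedFunctor (F ⋙ G) := fun X Y => by
  have h₁ := congrArg G.map (hF X Y)
  have h₂ := hG (F.obj X) (F.obj Y)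
  simp only [G.map_comp] at h₁
  rw [Functor.LaxMonoidal.comp_μ, Functor.LaxMonoidal.comp_μ, Category.assoc, Functor.comp_map,
    h₁, reassoc_of% h₂]
  rfl

section Product

variable (A : Type u₁) [Category.{v₁} A] [MonoidalCategory A] [BraidedCategory A]
  (B : Type u₂) [Category.{v₂} B] [MonoidalCategory B] [BraidedCategory B]

instance prodBraided : BraidedCategory (A × B) where
  braiding X Y := Iso.prod (β_ X.1 Y.1) (β_ X.2 Y.2)

theorem inclLeft_isBraidedFunctor : IsBraidedFunctor (inclLeft A B) := fun X Y => by
  refine Prod.ext ?_ ?_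
  · change 𝟙 _ ≫ (β_ X Y).hom = (β_ X Y).hom ≫ 𝟙 _
    rw [Category.id_comp, Category.comp_id]
  · change (λ_ (𝟙_ B)).hom ≫ 𝟙 _ = (β_ (𝟙_ B) (𝟙_ B)).hom ≫ (λ_ (𝟙_ B)).hom
    exact (Category.comp_id _).trans (unitors_equal.trans (braiding_leftUnitor (𝟙_ B)).symm)

theorem inclRight_isBraidedFunctor : IsBraidedFunctor (inclRight A B) := fun X Y => by
  refine Prod.ext ?_ ?_
  · change (λ_ (𝟙_ A)).hom ≫ 𝟙 _ = (β_ (𝟙_ A) (𝟙_ A)).hom ≫ (λ_ (𝟙_ A)).hom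
    exact (Category.comp_id _).trans (unitors_equal.trans (braiding_leftUnitor (𝟙_ A)).symm)
  · change 𝟙 _ ≫ (β_ X Y).hom = (β_ X Y).hom ≫ 𝟙 _
    rw [Category.id_comp, Category.comp_id]

end Product

theorem embedding_isBraidedFunctor (S : Type u₁) [Category.{v₁} S] [Preadditive S]
    [MonoidalCategory S] [MonoidalPreadditive S] [BraidedCategory S] :
    IsBraidedFunctor (Mat_.embedding S) := fun X Y => by
  change single (M := tensorMat (onePt X) (onePt Y)) (N := onePt (X ⊗ Y)) _ _ ≫
      (Mat_.embedding S).map (β_ X Y).hom =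
    single (M := tensorMat (onePt X) (onePt Y)) (N := tensorMat (onePt Y) (onePt X)) _ _ ≫
      single (M := tensorMat (onePt Y) (onePt X)) (N := onePt (Y ⊗ X)) _ _
  rw [embedding_map_eq_single]
  erw [single_comp_single, single_comp_single]
  refine congrArg (single _) ?_
  funext p
  exact (Category.id_comp _).trans (Category.comp_id _).symm

variable (k : Type w) [CommRing k]
  (A : Type u₁) [Category.{v₁} A] [Preadditive A] [Linear k A]
  [MonoidalCategory A] [MonoidalPreadditive A] [MonoidalLinear k A] [BraidedCategory A]
  (B : Type u₂) [Category.{v₂} B] [Preadditive B] [Linear k B]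
  [MonoidalCategory B] [MonoidalPreadditive B] [MonoidalLinear k B] [BraidedCategory B]

theorem pure_isBraidedFunctor : IsBraidedFunctor (LinTensor.pure k A B) := fun _ _ =>
  (Category.id_comp _).trans (Category.comp_id _).symm

end BraidedInclusions

/-! ### Objects whose endomorphisms are the scalars. -/

section ScalarEndomorphisms

variable (k : Type w) [Field k]

/-- The object `X` is nonzero and its endomorphisms are the scalars. -/
structure HasScalarEnd {C : Type u₁} [Category.{v₁} C] [Preadditive C] [Linear k C] (X : C) :
    Prop where
  id_ne_zero : 𝟙 X ≠ 0
  eq_smul : ∀ f : X ⟶ X, ∃ c : k, f = c • 𝟙 X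

variable {k}

theorem HasScalarEnd.of_iso {C : Type u₁} [Category.{v₁} C] [Preadditive C] [Linear k C] {X Y : C}
    (e : X ≅ Y) (h : HasScalarEnd k Y) : HasScalarEnd k X where
  id_ne_zero h₀ := h.id_ne_zero (by rw [← e.inv_hom_id, ← Category.id_comp e.hom, h₀]; simp)
  eq_smul f := by
    obtain ⟨c, hc⟩ := h.eq_smul (e.inv ≫ f ≫ e.hom)
    refine ⟨c, ?_⟩
    rw [← cancel_epi e.inv, ← cancel_mono e.hom, Category.assoc, hc]
    simp

theorem hasScalarEnd_line {G : Type u₁} [AddCommGroup G] (g : G) : HasScalarEnd k (Vec.line k g) :=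
  ⟨line_id_ne_zero k g, line_hom_eq_smul k⟩

theorem HasScalarEnd.box {A : Type u₁} [Category.{v₁} A] [Preadditive A] [Linear k A]
    {B : Type u₂} [Category.{v₂} B] [Preadditive B] [Linear k B] {X : A} {Y : B}
    (hX : HasScalarEnd k X) (hY : HasScalarEnd k Y) : HasScalarEnd k (IsingCM.box k X Y) where
  id_ne_zero h := by
    refine hX.id_ne_zero (LinTensor.tmul_id_injective k hY.id_ne_zero ?_)
    refine (Mat_.embedding (LinTensor k A B)).map_injective (X := ⟨X, Y⟩) (Y := ⟨X, Y⟩) ?_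
    refine ((Mat_.embedding (LinTensor k A B)).map_id ⟨X, Y⟩).trans (h.trans ?_)
    exact ((congrArg (Mat_.embedding (LinTensor k A B)).map
      (TensorProduct.zero_tmul (R := k) (X ⟶ X) (𝟙 Y))).trans (Functor.map_zero _ _ _)).symm
  eq_smul f := by
    obtain ⟨f, rfl⟩ := (Mat_.embedding _).map_surjective f
    obtain ⟨a, rfl⟩ := LinTensor.exists_tmul_id k hY.eq_smul f
    obtain ⟨c, rfl⟩ := hX.eq_smul a
    refine ⟨c, ?_⟩
    refine (Functor.map_smul (Mat_.embedding (LinTensor k A B)) c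
      (LinTensor.tmul (X := (⟨X, Y⟩ : LinTensor k A B)) (Y := ⟨X, Y⟩) (𝟙 X) (𝟙 Y))).trans ?_
    exact congrArg (c • ·) ((Mat_.embedding (LinTensor k A B)).map_id ⟨X, Y⟩)

theorem HasScalarEnd.fullSubcategory {C : Type u₁} [Category.{v₁} C] [Preadditive C] [Linear k C]
    {P : ObjectProperty C} {X : P.FullSubcategory} (h : HasScalarEnd k X.obj) :
    HasScalarEnd k X where
  id_ne_zero h₀ := h.id_ne_zero (congrArg P.ι.map h₀)
  eq_smul f := by
    obtain ⟨c, hc⟩ := h.eq_smul f.hom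
    exact ⟨c, ObjectProperty.hom_ext _ hc⟩

/-- A simple object is nonzero, so its decomposition has a summand; the inclusion of that summand is
a nonzero monomorphism, hence an isomorphism. The summand has a one-dimensional endomorphism space
by the definition of semisimplicity. -/
theorem IsFusion.hasScalarEnd {C : Type u₁} [Category.{v₁} C] [Preadditive C] [Linear k C]
    [MonoidalCategory C] [MonoidalPreadditive C] [MonoidalLinear k C] (hC : IsFusion k C) {X : C}
    (hX : Simple X) : HasScalarEnd k X := by
  obtain ⟨n, S, hS, -, hdec⟩ := hC.semisimple
  obtain ⟨l, s, b, ⟨hb⟩, ⟨e⟩⟩ := hdec X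
  have hl : Nonempty (Fin l) := by
    by_contra hl
    rw [not_nonempty_iff] at hl
    refine id_nonzero X ?_
    have := IsBilimit.total hb
    rw [Finset.univ_eq_empty, Finset.sum_empty] at this
    rw [← e.hom_inv_id, ← Category.id_comp e.inv, ← this]
    simp
  obtain ⟨j⟩ := hl
  have hne : 𝟙 (S (s j)) ≠ 0 := fun h => by
    have h₁ := hS (s j)
    have : Subsingleton (S (s j) ⟶ S (s j)) :=
      ⟨fun f g => by rw [← Category.id_comp f, ← Category.id_comp g, h, zero_comp, zero_comp]⟩
    rw [Module.finrank_zero_of_subsingleton] at h₁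
    exact zero_ne_one h₁
  have hsc : HasScalarEnd k (S (s j)) := ⟨hne, fun f => by
    obtain ⟨c, hc⟩ := (finrank_eq_one_iff_of_nonzero' _ hne).1 (hS (s j)) f
    exact ⟨c, hc.symm⟩⟩
  let i : S (s j) ⟶ X := b.ι j ≫ e.inv
  have hi : i ≫ e.hom ≫ b.π j = 𝟙 _ := by simp [i]
  have : Mono i := mono_of_mono_fac hi
  have hi₀ : i ≠ 0 := fun h => hne (by rw [← hi, h, zero_comp])
  have : IsIso i := (Simple.mono_isIso_iff_nonzero i).2 hi₀
  exact hsc.of_iso (asIso i).symm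

end ScalarEndomorphisms

/-! ### Induction on the fusion subcategory generated by an object. -/

section GeneratedInduction

variable {C : Type u₁} [Category.{v₁} C] [Preadditive C] [MonoidalCategory C]

/-- The exact pairing in a full monoidal subcategory between objects that are paired in the
ambient category. -/
@[reducible]
def exactPairingFullSubcategory {P : ObjectProperty C} [P.IsMonoidal] {X Y : P.FullSubcategory}
    (e : ExactPairing X.obj Y.obj) : ExactPairing X Y :=
  have : ExactPairing (P.ι.obj X) (P.ι.obj Y) := e
  ExactPairing.ofFullyFaithful P.ι X Y

/-- Minimality of `generated X` speaks of properties of the ambient category, whereas `R` may make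
sense only inside the subcategory, as for braidings defined only there. Minimality is applied to
"lies in the subcategory and satisfies `R`"; bicones, retracts and exact pairings lift because the
subcategory is full. -/
theorem generated_induction {X : C} {R : ObjectProperty (generated X).FullSubcategory}
    (hR : IsFusionSubcategory R) (hX : R ⟨X, fun _ _ h => h⟩) (Y : (generated X).FullSubcategory) :
    R Y := by
  have hG := isFusionSubcategory_generated X
  suffices h : IsFusionSubcategory fun D => ∃ h : generated X D, R ⟨D, h⟩ from
    (Y.property _ h ⟨_, hX⟩).2
  constructor
  · exact ⟨_, hR.unit⟩
  · rintro D E ⟨hD, hD'⟩ ⟨hE, hE'⟩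
    exact ⟨_, hR.tensor _ _ hD' hE'⟩
  · rintro D E b hb ⟨hD, hD'⟩ ⟨hE, hE'⟩
    let b' : BinaryBicone (C := (generated X).FullSubcategory) ⟨D, hD⟩ ⟨E, hE⟩ :=
      { pt := ⟨b.pt, hG.sum _ _ b hb hD hE⟩
        fst := ObjectProperty.homMk b.fst
        snd := ObjectProperty.homMk b.snd
        inl := ObjectProperty.homMk b.inl
        inr := ObjectProperty.homMk b.inr
        inl_fst := ObjectProperty.hom_ext _ b.inl_fst
        inl_snd := ObjectProperty.hom_ext _ b.inl_snd
        inr_fst := ObjectProperty.hom_ext _ b.inr_fst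
        inr_snd := ObjectProperty.hom_ext _ b.inr_snd }
    exact ⟨_, hR.sum _ _ b' (isBinaryBilimitOfTotal b'
      (ObjectProperty.hom_ext _ (IsBilimit.binary_total hb))) hD' hE'⟩
  · rintro D E r ⟨hE, hE'⟩
    refine ⟨hG.summand _ _ r hE, hR.summand _ ⟨E, hE⟩ ⟨ObjectProperty.homMk r.i,
      ObjectProperty.homMk r.r, ObjectProperty.hom_ext _ r.retract⟩ hE'⟩
  · rintro D E e ⟨hD, hD'⟩
    exact ⟨hG.rightDual _ _ e hD, hR.rightDual ⟨D, hD⟩ ⟨E, _⟩ (exactPairingFullSubcategory e) hD'⟩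
  · rintro D E e ⟨hE, hE'⟩
    exact ⟨hG.leftDual _ _ e hE, hR.leftDual ⟨D, _⟩ ⟨E, hE⟩ (exactPairingFullSubcategory e) hE'⟩

end GeneratedInduction

/-! ### The fusion subcategory on which two braidings agree. -/

section AgreementSubcategory

variable {C : Type u₁} [Category.{v₁} C] [MonoidalCategory C] [Preadditive C]
  {b c : BraidedCategory C}

theorem BraidingAgree.unit_right (b c : BraidedCategory C) (X : C) : BraidingAgree b c X (𝟙_ C) :=
  (BraidingAgree.unit_left (@reverseBraiding C _ _ b) (@reverseBraiding C _ _ c) X).of_reverse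

theorem BraidingAgree.tensor_right {X W V : C} (h₁ : BraidingAgree b c X W)
    (h₂ : BraidingAgree b c X V) : BraidingAgree b c X (W ⊗ V) :=
  (h₁.reverse.tensor_left h₂.reverse).of_reverse

theorem BraidingScalar.retract_right {k : Type w} [CommRing k] [Linear k C] {r : k} {X V W : C}
    (e : Retract V W) (h : BraidingScalar b c r X W) : BraidingScalar b c r X V := by
  have key : ∀ b : BraidedCategory C, (b.braiding X V).hom =
      X ◁ e.i ≫ (b.braiding X W).hom ≫ e.r ▷ X := fun b => by
    rw [← b.braiding_naturality_right, ← MonoidalCategory.whiskerLeft_comp_assoc, e.retract,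
      MonoidalCategory.whiskerLeft_id, Category.id_comp]
  unfold BraidingScalar at *
  rw [key b, key c, h, Linear.smul_comp, Linear.comp_smul]

variable [MonoidalPreadditive C]

/-- Agreement is the case of the scalar `1`, taken over `ℤ`, over which every preadditive category
is linear. -/
theorem BraidingAgree.retract {X Y W : C} (e : Retract X Y) (h : BraidingAgree b c Y W) :
    BraidingAgree b c X W :=
  braidingScalar_one_iff.1 ((braidingScalar_one_iff (k := ℤ).2 h).retract e)

theorem BraidingAgree.isSumOf {X W : C} {Q : ObjectProperty C}
    (h : ∀ X, Q X → BraidingAgree b c X W) (hX : IsSumOf Q X) : BraidingAgree b c X W :=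
  braidingScalar_one_iff.1
    (BraidingScalar.isSumOf (fun X hX => braidingScalar_one_iff (k := ℤ).2 (h X hX)) hX)

theorem BraidingAgree.isSumOf_right {X W : C} {Q : ObjectProperty C}
    (h : ∀ W, Q W → BraidingAgree b c X W) (hW : IsSumOf Q W) : BraidingAgree b c X W :=
  (BraidingAgree.isSumOf (fun W hW => (h W hW).reverse) hW).of_reverse

/-- Tensor products are handled by the hexagon, sums and summands by naturality, duals by evaluation
and coevaluation. Agreement on a generator thus spreads to all it generates. -/
theorem isFusionSubcategory_braidingAgree [HasBinaryBiproducts C] (b c : BraidedCategory C)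
    (S : ObjectProperty C) :
    IsFusionSubcategory fun X => ∀ W, S W → BraidingAgree b c X W where
  unit W _ := BraidingAgree.unit_left b c W
  tensor _ _ hX hY W hW := (hX W hW).tensor_left (hY W hW)
  sum X Y a ha hX hY W hW := by
    refine BraidingAgree.isSumOf (Q := fun D => BraidingAgree b c D W) (fun _ h => h) ?_
    refine ⟨Bool, inferInstance, fun j => cond j X Y, fun j => j.rec a.snd a.fst,
      fun j => j.rec a.inr a.inl, ?_, ?_, ?_, ?_⟩
    · rintro (_ | _)
      exacts [hY W hW, hX W hW]
    · rintro (_ | _)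
      exacts [a.inr_snd, a.inl_fst]
    · rintro (_ | _) (_ | _) h
      exacts [absurd rfl h, a.inr_fst, a.inl_snd, absurd rfl h]
    · rw [Fintype.sum_bool]
      exact IsBilimit.binary_total ha
  summand _ _ r h W hW := (h W hW).retract r
  rightDual _ _ _ h W hW := (h W hW).rightDual
  leftDual _ _ _ h W hW := (h W hW).leftDual

section Scalars

variable {k : Type w} [Field k] [Linear k C]

/-- One braiding followed by the inverse of the other is an endomorphism of `X ⊗ W`. -/
theorem HasScalarEnd.exists_braidingScalar (b c : BraidedCategory C) {X W : C}
    (h : HasScalarEnd k (X ⊗ W)) : ∃ r : k, BraidingScalar b c r X W := by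
  obtain ⟨r, hr⟩ := h.eq_smul ((b.braiding X W).hom ≫ (c.braiding X W).inv)
  refine ⟨r, ?_⟩
  unfold BraidingScalar
  rw [← cancel_mono (c.braiding X W).inv, hr, Linear.smul_comp, Iso.hom_inv_id]

theorem BraidingScalar.unique {r s : k} {X W : C} (hXW : 𝟙 (X ⊗ W) ≠ 0)
    (hr : BraidingScalar b c r X W) (hs : BraidingScalar b c s X W) : r = s := by
  unfold BraidingScalar at *
  have h := (hr.symm.trans hs) =≫ (c.braiding X W).inv
  rw [Linear.smul_comp, Linear.smul_comp, Iso.hom_inv_id] at h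
  exact smul_left_injective k hXW h

end Scalars

end AgreementSubcategory

/-! ### The two factors inside a Deligne product. -/

section BoxInclusions

open CategoryTheory.Prod

variable (k : Type w) [Field k]
  (A : Type u₁) [Category.{v₁} A] [Preadditive A] [Linear k A]
  [MonoidalCategory A] [MonoidalPreadditive A] [MonoidalLinear k A]
  (B : Type u₂) [Category.{v₂} B] [Preadditive B] [Linear k B]
  [MonoidalCategory B] [MonoidalPreadditive B] [MonoidalLinear k B]

/-- The functor `X ↦ X ⊠ 𝟙`. -/
abbrev boxLeft : A ⥤ DeligneProduct k A B := inclLeft A B ⋙ boxFunctor k A B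

/-- The functor `Y ↦ 𝟙 ⊠ Y`. -/
abbrev boxRight : B ⥤ DeligneProduct k A B := inclRight A B ⋙ boxFunctor k A B

instance boxLeft_additive : (boxLeft k A B).Additive :=
  ⟨IsBilinear.map_add_left k (H := boxFunctor k A B) _ _ _⟩

instance boxRight_additive : (boxRight k A B).Additive :=
  ⟨IsBilinear.map_add_right k (H := boxFunctor k A B) _ _ _⟩

/-- The decomposition of `X ⊠ Y` as a product of `X ⊠ 𝟙` and `𝟙 ⊠ Y`. -/
def boxTensorIso {A B} [Category.{v₁} A] [Preadditive A] [Linear k A]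
    [MonoidalCategory A] [MonoidalPreadditive A] [MonoidalLinear k A]
    [Category.{v₂} B] [Preadditive B] [Linear k B]
    [MonoidalCategory B] [MonoidalPreadditive B] [MonoidalLinear k B] (X : A) (Y : B) :
    (boxLeft k A B).obj X ⊗ (boxRight k A B).obj Y ≅ box k X Y :=
  Functor.Monoidal.μIso (boxFunctor k A B) (X, 𝟙_ B) (𝟙_ A, Y) ≪≫
    (boxFunctor k A B).mapIso (Iso.prod (ρ_ X) (λ_ Y))

variable {A B}

theorem LinTensor.exists_id_tmul {X : A} {Y Y' : B} (hX : ∀ f : X ⟶ X, ∃ c : k, f = c • 𝟙 X)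
    (f : (⟨X, Y⟩ : LinTensor k A B) ⟶ ⟨X, Y'⟩) :
    ∃ a : Y ⟶ Y', f = LinTensor.tmul (X := ⟨X, Y⟩) (Y := ⟨X, Y'⟩) (𝟙 X) a := by
  induction f using LinTensor.hom_induction with
  | zero => exact ⟨0, (TensorProduct.tmul_zero _ _).symm⟩
  | tmul a b =>
    obtain ⟨c, rfl⟩ := hX a
    exact ⟨c • b, TensorProduct.smul_tmul c (𝟙 X) b⟩
  | add f g hf hg =>
    obtain ⟨a, rfl⟩ := hf
    obtain ⟨b, rfl⟩ := hg
    exact ⟨a + b, (TensorProduct.tmul_add _ _ _).symm⟩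

theorem LinTensor.id_tmul_injective {X : A} {Y Y' : B} (hX : 𝟙 X ≠ 0) :
    Function.Injective fun a : Y ⟶ Y' =>
      LinTensor.tmul (k := k) (X := ⟨X, Y⟩) (Y := ⟨X, Y'⟩) (𝟙 X) a := fun a b hab => by
  obtain ⟨e, he⟩ := Module.Projective.exists_dual_eq_one k hX
  have h := congrArg (fun x => TensorProduct.lid k (Y ⟶ Y') (LinearMap.rTensor (Y ⟶ Y') e x)) hab
  simpa [LinTensor.tmul, he] using h

/-- `Hom (X ⊠ 𝟙, X' ⊠ 𝟙) = Hom (X, X') ⊗ End 𝟙`, and `End 𝟙 = k`. -/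
theorem boxLeft_full (hB : HasScalarEnd k (𝟙_ B)) : (boxLeft k A B).Full where
  map_surjective f := by
    obtain ⟨f, rfl⟩ := (Mat_.embedding _).map_surjective f
    obtain ⟨a, rfl⟩ := LinTensor.exists_tmul_id k hB.eq_smul f
    exact ⟨a, rfl⟩

theorem boxLeft_faithful (hB : HasScalarEnd k (𝟙_ B)) : (boxLeft k A B).Faithful where
  map_injective h := LinTensor.tmul_id_injective k hB.id_ne_zero
    ((Mat_.embedding _).map_injective h)

theorem boxRight_full (hA : HasScalarEnd k (𝟙_ A)) : (boxRight k A B).Full where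
  map_surjective f := by
    obtain ⟨f, rfl⟩ := (Mat_.embedding _).map_surjective f
    obtain ⟨a, rfl⟩ := LinTensor.exists_id_tmul k hA.eq_smul f
    exact ⟨a, rfl⟩

theorem boxRight_faithful (hA : HasScalarEnd k (𝟙_ A)) : (boxRight k A B).Faithful where
  map_injective h := LinTensor.id_tmul_injective k hA.id_ne_zero
    ((Mat_.embedding _).map_injective h)

theorem boxLeft_isBraidedFunctor [BraidedCategory A] [BraidedCategory B] :
    IsBraidedFunctor (boxLeft k A B) :=
  isBraidedFunctor_comp (inclLeft_isBraidedFunctor A B)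
    (isBraidedFunctor_comp (pure_isBraidedFunctor k A B) (embedding_isBraidedFunctor _))

theorem boxRight_isBraidedFunctor [BraidedCategory A] [BraidedCategory B] :
    IsBraidedFunctor (boxRight k A B) :=
  isBraidedFunctor_comp (inclRight_isBraidedFunctor A B)
    (isBraidedFunctor_comp (pure_isBraidedFunctor k A B) (embedding_isBraidedFunctor _))

/-- Every object is a sum of `X ⊠ Y ≅ (X ⊠ 𝟙) ⊗ (𝟙 ⊠ Y)`, so by the hexagons a braiding is
determined by its values on pairs of objects coming from the factors. -/
theorem braidingAgree_of_boxes {b c : BraidedCategory (DeligneProduct k A B)}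
    (hll : ∀ X Y, BraidingAgree b c ((boxLeft k A B).obj X) ((boxLeft k A B).obj Y))
    (hlr : ∀ X Y, BraidingAgree b c ((boxLeft k A B).obj X) ((boxRight k A B).obj Y))
    (hrl : ∀ X Y, BraidingAgree b c ((boxRight k A B).obj X) ((boxLeft k A B).obj Y))
    (hrr : ∀ X Y, BraidingAgree b c ((boxRight k A B).obj X) ((boxRight k A B).obj Y))
    (M N : DeligneProduct k A B) : BraidingAgree b c M N := by
  have key : ∀ (X X' : A) (Y Y' : B), BraidingAgree b c (box k X Y) (box k X' Y') :=
    fun X X' Y Y' => by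
      have h₁ := ((hll X X').tensor_right (hlr X Y')).tensor_left
        ((hrl Y X').tensor_right (hrr Y Y'))
      have h₂ := (h₁.retract (Retract.ofIso (boxTensorIso k X Y).symm)).reverse
      exact (h₂.retract (Retract.ofIso (boxTensorIso k X' Y').symm)).of_reverse
  refine BraidingAgree.isSumOf ?_ (isSumOf_embedding M)
  rintro _ ⟨i, rfl⟩
  refine BraidingAgree.isSumOf_right ?_ (isSumOf_embedding N)
  rintro _ ⟨j, rfl⟩
  exact key _ _ _ _

end BoxInclusions

theorem isBraidedFunctor_ofFullyFaithful {C : Type u₁} [Category.{v₁} C] [MonoidalCategory C]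
    {D : Type u₂} [Category.{v₂} D] [MonoidalCategory D] [BraidedCategory D] (F : C ⥤ D)
    [F.Monoidal] [F.Full] [F.Faithful] :
    @IsBraidedFunctor C _ _ (BraidedCategory.ofFullyFaithful F) D _ _ _ F _ := fun X Y => by
  simp +instances [BraidedCategory.ofFullyFaithful, BraidedCategory.ofFaithful]

/-! ### Rigidity of the braiding between the two factors. -/

section CrossBraiding

open CategoryTheory.Prod

variable {k : Type w} [Field k] {I : Type u} [Category.{v} I] [Preadditive I] [Linear k I]
  [MonoidalCategory I] [MonoidalPreadditive I] [MonoidalLinear k I]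
  {G : Type u₁} [AddCommGroup G] {H : Type u₂} [AddCommGroup H] {Z : I} {g : G}

/-- The fusion subcategory generated by `Z ⊠ g`. -/
abbrev GenLine (k : Type w) [Field k] {I : Type u} [Category.{v} I] [Preadditive I] [Linear k I]
    [MonoidalCategory I] [MonoidalPreadditive I] [MonoidalLinear k I]
    {G : Type u₁} [AddCommGroup G] (Z : I) (g : G) :=
  (generated (boxLine k Z g)).FullSubcategory

/-- The object `Z ⊠ g` of the fusion subcategory that it generates. -/
abbrev boxLineGen (k : Type w) [Field k] {I : Type u} [Category.{v} I] [Preadditive I] [Linear k I]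
    [MonoidalCategory I] [MonoidalPreadditive I] [MonoidalLinear k I]
    {G : Type u₁} [AddCommGroup G] (Z : I) (g : G) :
    GenLine k Z g :=
  ⟨boxLine k Z g, fun _ _ h => h⟩

/-- The functor `Y ↦ Y ⊠ 𝟙` on the fusion subcategory generated by `Z ⊠ g`. -/
abbrev genLeft (k : Type w) [Field k] {I : Type u} [Category.{v} I] [Preadditive I] [Linear k I]
    [MonoidalCategory I] [MonoidalPreadditive I] [MonoidalLinear k I]
    {G : Type u₁} [AddCommGroup G] (Z : I) (g : G) (H : Type u₂) [AddCommGroup H] :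
    GenLine k Z g ⥤ DeligneProduct k (GenLine k Z g) (Vec k H) :=
  boxLeft k (GenLine k Z g) (Vec k H)

/-- The functor `V ↦ 𝟙 ⊠ V` to the product with the fusion subcategory generated by `Z ⊠ g`. -/
abbrev genRight (k : Type w) [Field k] {I : Type u} [Category.{v} I] [Preadditive I] [Linear k I]
    [MonoidalCategory I] [MonoidalPreadditive I] [MonoidalLinear k I]
    {G : Type u₁} [AddCommGroup G] (Z : I) (g : G) (H : Type u₂) [AddCommGroup H] :
    Vec k H ⥤ DeligneProduct k (GenLine k Z g) (Vec k H) :=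
  boxRight k (GenLine k Z g) (Vec k H)

/-- The object `𝟙 ⊠ 2 n g` of the fusion subcategory generated by `Z ⊠ g`. -/
abbrev boxLineEven {δ : I} (hZ : IsIsing δ Z) (g : G) (n : ℕ) :
    GenLine k Z g :=
  ⟨boxLine k (𝟙_ I) ((2 * n) • g),
    (boxLine_mem k hZ (isFusionSubcategory_generated _) (fun _ _ h => h) n).1⟩

/-- Two more factors `Z ⊠ g` raise the degree by `2g`, and `𝟙` splits off `Z ⊗ Z`. The retraction is
stated in the subcategory, where the braidings to be compared live. -/
theorem boxLineEven_succ_retract {δ : I} (hZ : IsIsing δ Z) (g : G) (n : ℕ) :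
    Nonempty (Retract (boxLineEven (k := k) hZ g (n + 1))
      (boxLineEven hZ g n ⊗ (boxLineGen k Z g ⊗ boxLineGen k Z g))) := by
  obtain ⟨r⟩ := hZ.exists_retract
  have e : boxLine k (𝟙_ I) ((2 * (n + 1)) • g) = boxLine k (𝟙_ I) ((2 * n) • g + (g + g)) := by
    rw [mul_add, add_smul, mul_one, two_smul ℕ g]
  let r₁ : Retract (boxLine k (𝟙_ I) ((2 * n) • g + (g + g)))
      (boxLine k (𝟙_ I ⊗ (Z ⊗ Z)) ((2 * n) • g + (g + g))) :=
    ((Retract.ofIso (λ_ (𝟙_ I)).symm).trans (r.map (tensorLeft (𝟙_ I)))).map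
      (boxLineFunctor k ((2 * n) • g + (g + g)))
  let r₂ : Retract (boxLine k (𝟙_ I) ((2 * (n + 1)) • g))
      (boxLine k (𝟙_ I) ((2 * n) • g) ⊗ (boxLine k Z g ⊗ boxLine k Z g)) :=
    ((Retract.ofIso (eqToIso e)).trans r₁).trans (Retract.ofIso
      ((whiskerLeftIso _ (boxLineTensorIso k Z Z g g)) ≪≫
        boxLineTensorIso k (𝟙_ I) (Z ⊗ Z) ((2 * n) • g) (g + g)).symm)
  exact ⟨⟨ObjectProperty.homMk r₂.i, ObjectProperty.homMk r₂.r,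
    ObjectProperty.hom_ext _ r₂.retract⟩⟩

theorem hasScalarEnd_boxLine {X : I} (hX : HasScalarEnd k X) (g : G) :
    HasScalarEnd k (boxLine k X g) :=
  hX.box (hasScalarEnd_line g)

variable {b c : BraidedCategory
  (DeligneProduct k (GenLine k Z g) (Vec k H))}


theorem hasScalarEnd_boxLine_tensor {Y : GenLine k Z g}
    (hY : HasScalarEnd k Y) (v : H) :
    HasScalarEnd k ((genLeft k Z g H).obj Y ⊗ (genRight k Z g H).obj (Vec.line k v)) :=
  (hY.box (hasScalarEnd_line v)).of_iso (boxTensorIso k Y (Vec.line k v))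

theorem braidingScalar_pow_right {X : DeligneProduct k (GenLine k Z g)
    (Vec k H)} {v : H} {r : k}
    (h : BraidingScalar b c r X ((genRight k Z g H).obj (Vec.line k v))) (n : ℕ) :
    BraidingScalar b c (r ^ n) X ((genRight k Z g H).obj (Vec.line k (n • v))) := by
  induction n with
  | zero =>
    rw [pow_zero, zero_smul]
    exact BraidingScalar.retract_right (Retract.ofIso
      (Functor.Monoidal.εIso (genRight k Z g H)).symm)
      (braidingScalar_one_iff.2 (BraidingAgree.unit_right b c X))
  | succ n ih =>
    rw [pow_succ, add_smul, one_smul]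
    exact BraidingScalar.retract_right (Retract.ofIso
      ((genRight k Z g H).mapIso (Vec.lineTensorIso k (n • v) v).symm ≪≫
        (Functor.Monoidal.μIso (genRight k Z g H) _ _).symm)) (ih.tensor_right h)

theorem braidingScalar_pow_left {δ : I} (hZ : IsIsing δ Z) {W : DeligneProduct k
    (GenLine k Z g) (Vec k H)} {r : k}
    (h : BraidingScalar b c r ((genLeft k Z g H).obj (boxLineGen k Z g)) W) (n : ℕ) :
    BraidingScalar b c (r ^ (2 * n)) ((genLeft k Z g H).obj (boxLineEven hZ g n)) W := by
  induction n with
  | zero =>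
    rw [mul_zero, pow_zero]
    have e : boxLineEven (k := k) hZ g 0 = 𝟙_ _ :=
      ObjectProperty.FullSubcategory.ext (by
        change boxLine k (𝟙_ I) ((2 * 0) • g) = _
        rw [mul_zero, zero_smul]; rfl)
    rw [e]
    exact BraidingScalar.retract (Retract.ofIso (Functor.Monoidal.εIso (genLeft k Z g H)).symm)
      (braidingScalar_one_iff.2 (BraidingAgree.unit_left b c W))
  | succ n ih =>
    obtain ⟨ρ⟩ := boxLineEven_succ_retract (k := k) hZ g n
    have h₂ := ih.tensor_left (h.tensor_left h)
    rw [mul_add, pow_add, mul_one, pow_two]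
    exact h₂.retract ((ρ.map (genLeft k Z g H)).trans (Retract.ofIso
      ((Functor.Monoidal.μIso (genLeft k Z g H) _ _).symm ≪≫
        whiskerLeftIso _ (Functor.Monoidal.μIso (genLeft k Z g H) _ _).symm)))

/-- The scalar `r` comparing the two braidings has order dividing both `q` and `2 * n`. The bound `2
* n` comes from `Z ⊠ g` although this object is not invertible: a retract of its `2n`-th tensor
power inherits the scalar `r ^ (2 * n)`, and the unit is such a retract. -/
theorem braidingAgree_boxLineGen {δ : I} (hZ : IsIsing δ Z) (hI : HasScalarEnd k (𝟙_ I))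
    (hZ' : HasScalarEnd k Z) {n q : ℕ} (hn : (2 * n) • g = 0) (hq : ∀ v : H, q • v = 0)
    (hnq : (2 * n).Coprime q) (b c : BraidedCategory
      (DeligneProduct k (GenLine k Z g) (Vec k H))) (v : H) :
    BraidingAgree b c ((genLeft k Z g H).obj (boxLineGen k Z g))
      ((genRight k Z g H).obj (Vec.line k v)) := by
  have hsc := hasScalarEnd_boxLine_tensor (H := H) (Y := boxLineGen k Z g)
    (HasScalarEnd.fullSubcategory (hasScalarEnd_boxLine hZ' g))
  obtain ⟨r, hr⟩ := (hsc v).exists_braidingScalar b c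
  -- The line of degree `q • v = 0` is the unit, with which all braidings agree; comparing the
  -- scalars `r ^ q` and `1` is legitimate because the object is nonzero.
  have h₁ : r ^ q = 1 := by
    have h := braidingScalar_pow_right hr q
    refine BraidingScalar.unique (hsc _).id_ne_zero h ?_
    rw [hq v]
    exact BraidingScalar.retract_right (Retract.ofIso
      (Functor.Monoidal.εIso (genRight k Z g H)).symm)
      (braidingScalar_one_iff.2 (BraidingAgree.unit_right b c _))
  have h₂ : r ^ (2 * n) = 1 := by
    have h := braidingScalar_pow_left hZ hr n
    refine BraidingScalar.unique (hasScalarEnd_boxLine_tensor (HasScalarEnd.fullSubcategory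
      (hasScalarEnd_boxLine hI _)) v).id_ne_zero h ?_
    have e : boxLineEven (k := k) hZ g n = 𝟙_ _ :=
      ObjectProperty.FullSubcategory.ext (by
        change boxLine k (𝟙_ I) ((2 * n) • g) = _
        rw [hn]; rfl)
    rw [e]
    exact BraidingScalar.retract (Retract.ofIso (Functor.Monoidal.εIso (genLeft k Z g H)).symm)
      (braidingScalar_one_iff.2 (BraidingAgree.unit_left b c _))
  have : r = 1 := by
    have := Nat.dvd_gcd (orderOf_dvd_of_pow_eq_one h₂) (orderOf_dvd_of_pow_eq_one h₁)
    rw [hnq, Nat.dvd_one, orderOf_eq_one_iff] at this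
    exact this
  rw [this] at hr
  exact braidingScalar_one_iff.1 hr

/-- Against all lines at once, the objects of agreement form a fusion subcategory containing the
generator; afterwards `V` is decomposed into lines. -/
theorem braidingAgree_boxLeft_boxRight {δ : I} (hZ : IsIsing δ Z) (hI : HasScalarEnd k (𝟙_ I))
    (hZ' : HasScalarEnd k Z) {n q : ℕ} (hn : (2 * n) • g = 0) (hq : ∀ v : H, q • v = 0)
    (hnq : (2 * n).Coprime q) (b c : BraidedCategory
      (DeligneProduct k (GenLine k Z g) (Vec k H)))
    (Y : GenLine k Z g) (V : Vec k H) :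
    BraidingAgree b c ((genLeft k Z g H).obj Y) ((genRight k Z g H).obj V) := by
  have hR := isFusionSubcategory_braidingAgree b c
    fun W => ∃ v : H, W = (genRight k Z g H).obj (Vec.line k v)
  have h := generated_induction (hR.inverseImage (genLeft k Z g H)) (by
      rintro _ ⟨v, rfl⟩
      exact braidingAgree_boxLineGen hZ hI hZ' hn hq hnq b c v) Y
  refine BraidingAgree.isSumOf_right h ((isSumOf_line k V).map (genRight k Z g H) ?_)
  rintro _ ⟨v, rfl⟩
  exact ⟨v, rfl⟩

/-- Restrict `b` to both factors. The product of the restrictions agrees with `b` within each factor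
by construction, and on mixed pairs because any two braidings agree there. -/
theorem exists_product_braiding {δ : I} (hZ : IsIsing δ Z) (hI : HasScalarEnd k (𝟙_ I))
    (hZ' : HasScalarEnd k Z) {n q : ℕ} (hn : (2 * n) • g = 0) (hq : ∀ v : H, q • v = 0)
    (hnq : (2 * n).Coprime q) (b : BraidedCategory
      (DeligneProduct k (GenLine k Z g) (Vec k H))) :
    ∃ (_ : BraidedCategory (GenLine k Z g))
      (_ : BraidedCategory (Vec k H)), ∀ X Y, BraidingAgree b matBraided X Y := by
  have hA : HasScalarEnd k (𝟙_ (GenLine k Z g)) :=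
    HasScalarEnd.fullSubcategory (hasScalarEnd_boxLine hI (0 : G))
  have hB : HasScalarEnd k (𝟙_ (Vec k H)) := hasScalarEnd_line 0
  have := boxLeft_full k (A := GenLine k Z g) hB
  have := boxLeft_faithful k (A := GenLine k Z g) hB
  have := boxRight_full k (B := Vec k H) hA
  have := boxRight_faithful k (B := Vec k H) hA
  let a₁ : BraidedCategory (GenLine k Z g) :=
    BraidedCategory.ofFullyFaithful (genLeft k Z g H)
  let a₂ : BraidedCategory (Vec k H) := BraidedCategory.ofFullyFaithful (genRight k Z g H)
  refine ⟨a₁, a₂, braidingAgree_of_boxes k ?_ ?_ ?_ ?_⟩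
  · exact BraidingAgree.of_isBraidedFunctor a₁ _ (isBraidedFunctor_ofFullyFaithful _)
      (boxLeft_isBraidedFunctor k)
  · exact braidingAgree_boxLeft_boxRight hZ hI hZ' hn hq hnq b _
  -- The other order of the factors is the previous case, applied to the reverse braidings.
  · exact fun X Y => BraidingAgree.of_reverse
      (braidingAgree_boxLeft_boxRight hZ hI hZ' hn hq hnq _ _ Y X)
  · exact BraidingAgree.of_isBraidedFunctor a₂ _ (isBraidedFunctor_ofFullyFaithful _)
      (boxRight_isBraidedFunctor k)

end CrossBraiding

theorem isBraidedFunctor_congr {C : Type u₁} [Category.{v₁} C] [MonoidalCategory C]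
    {D : Type u₂} [Category.{v₂} D] [MonoidalCategory D] [BraidedCategory D]
    {b b' : BraidedCategory C} (F : C ⥤ D) [F.Monoidal]
    (hb : ∀ X Y, BraidingAgree b b' X Y) (h : @IsBraidedFunctor C _ _ b D _ _ _ F _) :
    @IsBraidedFunctor C _ _ b' D _ _ _ F _ := fun X Y =>
  (congrArg (fun f => Functor.LaxMonoidal.μ F X Y ≫ F.map f) (hb X Y)).symm.trans (h X Y)

/-! ### The inverse of a braided equivalence. -/

section InverseBraided

open Functor.LaxMonoidal Functor.OplaxMonoidal

variable {C : Type u₁} [Category.{v₁} C] [MonoidalCategory C] [BraidedCategory C]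
  {D : Type u₂} [Category.{v₂} D] [MonoidalCategory D] [BraidedCategory D]

/-- After applying the faithful functor `e.functor` and composing with the invertible counit, the
claim follows from three facts: `e.functor` is braided, the counit is a monoidal transformation, and
the counit is natural. -/
theorem isBraidedFunctor_inverse (e : C ≌ D) [e.functor.Monoidal] [e.inverse.Monoidal]
    [e.IsMonoidal] (h : IsBraidedFunctor e.functor) : IsBraidedFunctor e.inverse := fun X Y => by
  apply e.functor.map_injective
  rw [← cancel_mono (e.toAdjunction.counit.app (Y ⊗ X))]
  have h₁ := e.toAdjunction.map_μ_comp_counit_app_tensor X Y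
  have h₂ := e.toAdjunction.map_μ_comp_counit_app_tensor Y X
  have h₃ := e.toAdjunction.counit.naturality (β_ X Y).hom
  have h₄ := h (e.inverse.obj X) (e.inverse.obj Y)
  have h₅ : e.functor.map (β_ (e.inverse.obj X) (e.inverse.obj Y)).hom ≫ δ e.functor _ _ =
      δ e.functor _ _ ≫ (β_ _ _).hom := by
    rw [← cancel_epi (μ e.functor _ _), reassoc_of% h₄]
    simp
  rw [Functor.map_comp, Functor.map_comp, Category.assoc, Category.assoc, h₂, reassoc_of% h₅]
  rw [← BraidedCategory.braiding_naturality, ← reassoc_of% h₁]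
  exact congrArg (e.functor.map (μ e.inverse X Y) ≫ ·) h₃

end InverseBraided

/-! ### `Vec_G` is a pointed fusion category. -/

section VecFusion

variable {k : Type w} [Field k] {G : Type u₁} [AddCommGroup G]

/-- A nonzero `f` into the line is nonzero on some line summand of its source. That line must have
degree `g`, so the restriction is an invertible scalar and `f` is split epi; being mono, it is an
isomorphism. -/
theorem simple_line (g : G) : Simple (Vec.line k g) where
  mono_isIso_iff_nonzero {Y} f _ := by
    constructor
    · intro _ h
      exact line_id_ne_zero k g ((IsIso.inv_hom_id f).symm.trans
        ((congrArg (inv f ≫ ·) h).trans comp_zero))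
    · intro hf
      obtain ⟨J, _, S, p, i, hS, -, -, h₃⟩ := isSumOf_line k Y
      have : ∃ j, i j ≫ f ≠ 0 := by
        by_contra! h
        refine hf ?_
        rw [← Category.id_comp f, ← h₃, Preadditive.sum_comp]
        exact Finset.sum_eq_zero fun j _ => by rw [Category.assoc, h, comp_zero]
      obtain ⟨j, hj⟩ := this
      -- A summand of any other degree has only the zero morphism to the line, so the chosen summand
      -- is the line of degree `g` itself.
      obtain ⟨s, t, hs⟩ : ∃ (T : Vec k G) (t : T ⟶ Y), T = Vec.line k g ∧ t ≫ f ≠ 0 := by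
        obtain ⟨h, hh⟩ := hS j
        by_cases hgh : h = g
        · exact ⟨S j, i j, by rw [hh, hgh], hj⟩
        · exfalso
          refine hj ?_
          have := hh ▸ (fun f : Vec.line k h ⟶ Vec.line k g => line_hom_eq_zero k hgh f)
          exact this _
      obtain ⟨rfl, hs⟩ := hs
      obtain ⟨c, hc⟩ := line_hom_eq_smul k (t ≫ f)
      have hc₀ : c ≠ 0 := fun h => hs (by rw [hc, h, zero_smul])
      have : IsSplitEpi f := IsSplitEpi.mk' ⟨c⁻¹ • t, by
        rw [Linear.smul_comp, hc, smul_smul, inv_mul_cancel₀ hc₀, one_smul]⟩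
      exact isIso_of_mono_of_isSplitEpi f

theorem exists_iso_line {X : Vec k G} (hX : Simple X) : ∃ g, Nonempty (X ≅ Vec.line k g) := by
  obtain ⟨J, _, S, p, i, hS, h₁, -, h₃⟩ := isSumOf_line k X
  have hJ : Nonempty J := by
    by_contra hJ
    rw [not_nonempty_iff] at hJ
    refine id_nonzero X ?_
    rw [← h₃, Finset.univ_eq_empty, Finset.sum_empty]
  obtain ⟨j⟩ := hJ
  obtain ⟨g, hg⟩ := hS j
  refine ⟨g, ⟨?_⟩⟩
  rw [← hg]
  have : Mono (i j) := mono_of_mono_fac (h₁ j)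
  have hi₀ : i j ≠ 0 := fun h => by
    have : 𝟙 (S j) ≠ 0 := by rw [hg]; exact line_id_ne_zero k g
    exact this (by rw [← h₁ j, h, zero_comp])
  have : IsIso (i j) := (Simple.mono_isIso_iff_nonzero _).2 hi₀
  exact (asIso (i j)).symm

theorem isPointed_vec : IsPointed (Vec k G) := fun X hX => by
  obtain ⟨g, ⟨e⟩⟩ := exists_iso_line hX
  refine ⟨Vec.line k (-g), ⟨(e ⊗ᵢ Iso.refl _) ≪≫ Vec.lineTensorIso k g (-g) ≪≫ eqToIso ?_⟩,
    ⟨(Iso.refl _ ⊗ᵢ e) ≪≫ Vec.lineTensorIso k (-g) g ≪≫ eqToIso ?_⟩⟩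
  · rw [add_neg_cancel]; rfl
  · rw [neg_add_cancel]; rfl

theorem vec_semisimple [Finite G] : ∃ (n : ℕ) (S : Fin n → Vec k G),
    (∀ i, Module.finrank k (S i ⟶ S i) = 1) ∧
    (∀ i j, i ≠ j → Subsingleton (S i ⟶ S j)) ∧
    ∀ X : Vec k G, ∃ (l : ℕ) (s : Fin l → Fin n) (b : Bicone fun j => S (s j)),
      Nonempty b.IsBilimit ∧ Nonempty (X ≅ b.pt) := by
  classical
  obtain ⟨n, ⟨e⟩⟩ := Finite.exists_equiv_fin G
  refine ⟨n, fun i => Vec.line k (e.symm i), fun i => ?_, fun i j hij => ?_, fun X => ?_⟩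
  · refine finrank_eq_one (𝟙 (Vec.line k (e.symm i))) (line_id_ne_zero k _) fun f => ?_
    obtain ⟨c, hc⟩ := line_hom_eq_smul k f
    exact ⟨c, hc.symm⟩
  · refine ⟨fun f f' => ?_⟩
    have h : e.symm i ≠ e.symm j := fun h => hij (e.symm.injective h)
    rw [line_hom_eq_zero k h f, line_hom_eq_zero k h f']
  · obtain ⟨J, _, S, p, i, hS, h₁, h₂, h₃⟩ := isSumOf_line k X
    choose g hg using hS
    let a := Fintype.equivFin J
    let q := fun j => eqToIso (show S (a.symm j) = Vec.line k (e.symm (e (g (a.symm j)))) by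
      rw [hg, e.symm_apply_apply])
    let b : Bicone fun j => Vec.line k (e.symm (e (g (a.symm j)))) :=
      { pt := X
        π := fun j => p (a.symm j) ≫ (q j).hom
        ι := fun j => (q j).inv ≫ i (a.symm j)
        ι_π := fun j l => by
          split_ifs with h
          · subst h
            simp [reassoc_of% h₁]
          · simp [reassoc_of% h₂ _ _ (fun h' => h (a.symm.injective h'))] }
    refine ⟨_, fun j => e (g (a.symm j)), b, ⟨isBilimitOfTotal b ?_⟩, ⟨Iso.refl _⟩⟩
    rw [← h₃, ← Equiv.sum_comp a.symm]
    refine Finset.sum_congr rfl fun j _ => ?_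
    simp [b]

/-- Composition in `Vec` is multiplication of scalar matrices. This turns the duality identities
below into identities between sums of products of Kronecker deltas. -/
theorem coe_comp_apply {X Y Z : Vec k G} (f : X ⟶ Y) (g : Y ⟶ Z) (i : X.ι) (j : Z.ι) :
    ((f ≫ g) i j).1 = ∑ l, (f i l).1 * (g l j).1 := by
  rw [Mat_.comp_apply]
  exact map_sum (lineHom k (X.X i).deg (Z.X j).deg).subtype _ _

theorem coe_eqToHom {X Y : Line k G} (h : X = Y) : (eqToHom h).1 = (1 : k) := by
  subst h
  rfl

open scoped Classical in
theorem coe_single_apply {X Y : Vec k G} (f : X.ι → Y.ι) (φ : ∀ i, X.X i ⟶ Y.X (f i)) (i : X.ι)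
    (j : Y.ι) : (single f φ i j).1 = if f i = j then (φ i).1 else 0 := by
  unfold single
  split_ifs with h
  · exact (congrArg ((φ i).1 * ·) (coe_eqToHom _)).trans (mul_one _)
  · rfl

open scoped Classical in
theorem coe_id_apply (X : Vec k G) (i j : X.ι) :
    ((𝟙 X : X ⟶ X) i j).1 = if i = j then (1 : k) else 0 := by
  rw [id_eq_single, coe_single_apply]
  rfl

/-- The formal direct sum of the lines in the degrees `x i`. -/
abbrev Vec.ofDegrees (k : Type w) [Field k] {G : Type u₁} {ι : Type} [Fintype ι] (x : ι → G) :
    Vec k G := ⟨ι, fun i => ⟨x i⟩⟩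

open scoped Classical in
/-- Lines in opposite degrees are dual to each other. -/
@[reducible]
def Vec.exactPairing {ι : Type} [Fintype ι] (x y : ι → G) (h : ∀ i, x i + y i = 0) :
    ExactPairing (Vec.ofDegrees k x) (Vec.ofDegrees k y) where
  coevaluation' := fun _ (p : ι × ι) => ⟨if p.1 = p.2 then 1 else 0,
    fun (hne : 0 ≠ x p.1 + y p.2) => by
      split_ifs with hp
      · exact absurd (by rw [hp, h]) hne
      · rfl⟩
  evaluation' := fun (p : ι × ι) _ => ⟨if p.1 = p.2 then 1 else 0,
    fun (hne : y p.1 + x p.2 ≠ 0) => by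
      split_ifs with hp
      · exact absurd (by rw [hp, add_comm, h]) hne
      · rfl⟩
  coevaluation_evaluation' := by
    rw [associator_inv_eq_single]
    refine Mat_.hom_ext _ _ fun (p : ι × Unit) (q : Unit × ι) => Subtype.ext ?_
    obtain ⟨i, ⟨⟩⟩ := p
    obtain ⟨⟨⟩, j⟩ := q
    refine (coe_comp_apply _ _ _ _).trans ?_
    refine (Finset.sum_congr (s₂ := Finset.univ) rfl fun (q : ι × (ι × ι)) _ => ?_).trans
      (b := ∑ q : ι × (ι × ι),
      ((if i = q.1 then (1 : k) else 0) * (if q.2.1 = q.2.2 then 1 else 0)) *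
        ((if q.1 = q.2.1 then 1 else 0) * (if q.2.2 = j then 1 else 0))) ?_
    · refine congrArg₂ (· * ·) (congrArg (· * _) (coe_id_apply _ _ _)) ?_
      refine (congrArg Subtype.val (single_comp _ _ _ _ _)).trans ?_
      refine (one_mul _).trans ?_
      exact congrArg (_ * ·) (coe_id_apply _ _ _)
    · refine Eq.trans ?_ (congrArg Subtype.val (single_comp
        (M := tensorMat (Vec.ofDegrees k y) (unitMat _)) (N := Vec.ofDegrees k y) _ _ _ _ _)).symm
      refine Eq.trans ?_ ((one_mul _).trans (coe_single_apply _ _ _ _)).symm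
      refine Eq.trans (b := if i = j then (1 : k) else 0) ?_ ?_
      -- The deltas of the two factors force all three summation indices to equal `i`, which leaves
      -- the delta of `i` and `j`.
      · rw [Finset.sum_eq_single (i, (i, i))]
        · simp
        · rintro ⟨a, b, c⟩ - hne
          dsimp only
          split_ifs <;> simp_all
        · exact fun h' => absurd (Finset.mem_univ _) h'
      · by_cases hij : i = j
        · subst hij
          exact (if_pos rfl).trans ((if_pos rfl).trans
            ((congrArg (· * (1 : k)) (coe_eqToHom _)).trans (mul_one _))).symm
        · exact (if_neg hij).trans (if_neg fun h' => hij ((Prod.ext_iff.1 h').2)).symm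
  evaluation_coevaluation' := by
    refine Mat_.hom_ext _ _ fun (p : Unit × ι) (q : ι × Unit) => Subtype.ext ?_
    obtain ⟨⟨⟩, i⟩ := p
    obtain ⟨j, ⟨⟩⟩ := q
    refine (coe_comp_apply _ _ _ _).trans ?_
    refine (Finset.sum_congr (s₂ := Finset.univ) rfl fun (q : (ι × ι) × ι) _ => ?_).trans
      (b := ∑ q : (ι × ι) × ι,
      ((if q.1.1 = q.1.2 then (1 : k) else 0) * (if i = q.2 then 1 else 0)) *
        ((if q.1.1 = j then 1 else 0) * (if q.1.2 = q.2 then 1 else 0))) ?_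
    · refine congrArg₂ (· * ·) (congrArg (_ * ·) (coe_id_apply _ _ _)) ?_
      refine (congrArg Subtype.val (single_comp _ _ _ _ _)).trans ?_
      refine (one_mul _).trans ?_
      exact congrArg (· * _) (coe_id_apply _ _ _)
    · refine Eq.trans ?_ (congrArg Subtype.val (single_comp
        (M := tensorMat (unitMat _) (Vec.ofDegrees k x)) (N := Vec.ofDegrees k x) _ _ _ _ _)).symm
      refine Eq.trans ?_ ((one_mul _).trans (coe_single_apply _ _ _ _)).symm
      refine Eq.trans (b := if i = j then (1 : k) else 0) ?_ ?_
      · rw [Finset.sum_eq_single ((i, i), i)]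
        · simp
        · rintro ⟨⟨a, b⟩, c⟩ - hne
          dsimp only
          split_ifs <;> simp_all
        · exact fun h' => absurd (Finset.mem_univ _) h'
      · by_cases hij : i = j
        · subst hij
          exact (if_pos rfl).trans ((if_pos rfl).trans
            ((congrArg (· * (1 : k)) (coe_eqToHom _)).trans (mul_one _))).symm
        · exact (if_neg hij).trans (if_neg fun h' => hij (Prod.ext_iff.1 h').1).symm

theorem nonempty_rigidCategory_vec : Nonempty (RigidCategory (Vec k G)) :=
  ⟨{ rightDual := fun X => @HasRightDual.mk _ _ _ X (Vec.ofDegrees k fun i => -(X.X i).deg)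
      (Vec.exactPairing (fun i => (X.X i).deg) _ fun _ => add_neg_cancel _)
     leftDual := fun X => @HasLeftDual.mk _ _ _ X (Vec.ofDegrees k fun i => -(X.X i).deg)
      (Vec.exactPairing _ (fun i => (X.X i).deg) fun _ => neg_add_cancel _) }⟩

theorem isFusion_vec [Finite G] : IsFusion k (Vec k G) where
  hasFiniteBiproducts := inferInstance
  semisimple := vec_semisimple
  rigid := nonempty_rigidCategory_vec
  simple_unit := simple_line 0

end VecFusion

/-! ### The factorization for general grading groups. -/

section Factorization

variable {k : Type w} [Field k] {I : Type u} [Category.{v} I] [Preadditive I] [Linear k I]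
  [MonoidalCategory I] [MonoidalPreadditive I] [MonoidalLinear k I]
  {G₁ : Type u₁} {G₂ : Type u₂} {G₃ : Type u₃}
  [AddCommGroup G₁] [AddCommGroup G₂] [AddCommGroup G₃]

theorem exists_inverse_equivalence {C : Type u₁} [Category.{v₁} C] [Preadditive C] [Linear k C]
    [MonoidalCategory C] {D : Type u₂} [Category.{v₂} D] [Preadditive D] [Linear k D]
    [MonoidalCategory D] (G : C ⥤ D) [hG : G.Monoidal] [G.IsEquivalence]
    [hadd : G.Additive] [hlin : G.Linear k] :
    ∃ (F : D ⥤ C) (_ : F.Monoidal), F.IsEquivalence ∧ F.Additive ∧ F.Linear k ∧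
      ∀ (b : BraidedCategory C) (c : BraidedCategory D),
        @IsBraidedFunctor C _ _ b D _ _ c G _ → @IsBraidedFunctor D _ _ c C _ _ b F _ := by
  let e := G.asEquivalence
  let i₁ : e.functor.Monoidal := hG
  let i₂ : e.inverse.Monoidal := e.inverseMonoidal
  have i₃ : e.IsMonoidal := ⟨rfl, fun _ _ => rfl⟩
  have i₄ : e.functor.Additive := hadd
  have i₅ : e.functor.Linear k := hlin
  exact ⟨e.inverse, i₂, inferInstance, inferInstance, inferInstance,
    fun b c h => isBraidedFunctor_inverse e h⟩

/-- The arithmetic is isolated in the hypotheses: `φ + ψ` is a bijection onto `G₃` with inverse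
`(π₁, π₂)`, `φ g₁` is an odd multiple and each `ψ h` an even multiple of `g₃`, and the orders
controlling the mixed braiding are coprime. -/
theorem generated_boxLine_factorization {δ Z : I} (hZ : IsIsing δ Z) (hI : HasScalarEnd k (𝟙_ I))
    (hZ' : HasScalarEnd k Z) {g₁ : G₁} {g₃ : G₃} (φ : G₁ →+ G₃) (ψ : G₂ →+ G₃) (π₁ : G₃ →+ G₁)
    (π₂ : G₃ → G₂) (hφψ : ∀ g g' h h', φ g + ψ h = φ g' + ψ h' → g = g' ∧ h = h')
    (hπ : ∀ g, φ (π₁ g) + ψ (π₂ g) = g) (hπg : π₁ g₃ = g₁)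
    (hφg : ∃ n : ℕ, φ g₁ = (2 * n + 1) • g₃) (hψ : ∀ h, ∃ n : ℕ, ψ h = (2 * n) • g₃)
    {n q : ℕ} (hn : (2 * n) • g₁ = 0) (hq : ∀ v : G₂, q • v = 0) (hnq : (2 * n).Coprime q) :
    ∃ (F : GenLine k Z g₃ ⥤ DeligneProduct k (GenLine k Z g₁) (Vec k G₂)) (_ : F.Monoidal),
      F.IsEquivalence ∧ F.Additive ∧ F.Linear k ∧
      ∀ _ : BraidedCategory (GenLine k Z g₃),
        ∃ (_ : BraidedCategory (GenLine k Z g₁)) (_ : BraidedCategory (Vec k G₂)),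
          IsBraidedFunctor F := by
  have h₁ := isFusionSubcategory_generated (boxLine k Z g₁)
  have h₃ := isFusionSubcategory_generated (boxLine k Z g₃)
  have hgen : generated (boxLine k Z g₃) (boxLine k Z g₃) := fun _ _ h => h
  have hmem : ∀ T, generated (boxLine k Z g₃)
      ((combine k φ ψ (generated (boxLine k Z g₁))).obj T) := by
    refine combine_mem k φ ψ h₃ fun Y hY V => regrade_mem k φ ψ rfl h₃ ?_ ?_ Y hY V
    · obtain ⟨l, hl⟩ := hφg
      rw [hl]
      exact (boxLine_mem k hZ h₃ hgen l).2
    · intro h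
      obtain ⟨l, hl⟩ := hψ h
      rw [hl]
      exact (boxLine_mem k hZ h₃ hgen l).1
  have hess : ∀ (X : I) (g : G₃), generated (boxLine k Z g₃) (boxLine k X g) →
      ∃ g₁' g₂, φ g₁' + ψ g₂ = g ∧ generated (boxLine k Z g₁) (boxLine k X g₁') := by
    intro X g hX
    refine ⟨π₁ g, π₂ g, hπ g, ?_⟩
    -- The preimage under regrading along `π₁` of the subcategory generated by `Z ⊠ g₁` is a fusion
    -- subcategory. It contains `Z ⊠ g₃` since `π₁ g₃ = g₁`, hence contains `X ⊠ g`.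
    refine h₁.iso (regradeLeftBoxLineIso k π₁ X g).symm ?_
    refine hX _ (h₁.inverseImage (regradeLeft k π₁)) ?_
    refine h₁.iso (regradeLeftBoxLineIso k π₁ Z g₃) ?_
    rw [hπg]
    exact fun _ _ h => h
  have heq := combineTo_isEquivalence k hφψ h₁ h₃ hmem hess
  obtain ⟨F, hF, hF₁, hF₂, hF₃, hbr⟩ := exists_inverse_equivalence (k := k)
    (combineTo k φ ψ (generated (boxLine k Z g₁)) (generated (boxLine k Z g₃)) hmem)
  refine ⟨F, hF, hF₁, hF₂, hF₃, fun c => ?_⟩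
  -- Pull the given braiding back along the equivalence, then replace it by the product braiding
  -- with which it agrees.
  let b : BraidedCategory (DeligneProduct k (GenLine k Z g₁) (Vec k G₂)) :=
    BraidedCategory.ofFullyFaithful
      (combineTo k φ ψ (generated (boxLine k Z g₁)) (generated (boxLine k Z g₃)) hmem)
  obtain ⟨b₁, b₂, hb⟩ := exists_product_braiding hZ hI hZ' hn hq hnq b
  exact ⟨b₁, b₂, hbr _ c (isBraidedFunctor_congr _ hb (isBraidedFunctor_ofFullyFaithful _))⟩

end Factorization

/-! ### Parity in `ZMod (2 ^ N * m)`. -/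

section ChineseRemainder

/-- As `N ≥ 1`, the residue modulo `2 ^ N` determines the parity of the representative `x.val`; this
parity decides whether `boxLine_mem` supplies `𝟙` or `Z` in degree `x`. -/
theorem ZMod.exists_even_or_odd_nsmul {N m : ℕ} (hN : 1 ≤ N) (hm : 1 ≤ m)
    (f : ZMod (2 ^ N * m) →+* ZMod (2 ^ N)) (x : ZMod (2 ^ N * m)) :
    (f x = 0 → ∃ n : ℕ, x = (2 * n) • (1 : ZMod (2 ^ N * m))) ∧
      (f x = 1 → ∃ n : ℕ, x = (2 * n + 1) • (1 : ZMod (2 ^ N * m))) := by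
  have : NeZero (2 ^ N * m) := ⟨by positivity⟩
  have hx : ((x.val : ℕ) : ZMod (2 ^ N * m)) = x := ZMod.natCast_zmod_val x
  have h2 : 2 ∣ 2 ^ N := dvd_pow_self 2 (by omega)
  constructor
  · intro h
    rw [← hx, map_natCast, ZMod.natCast_eq_zero_iff] at h
    obtain ⟨n, hn⟩ := h2.trans h
    exact ⟨n, by rw [← hn, nsmul_one, hx]⟩
  · intro h
    have h' : ((x.val : ℕ) : ZMod (2 ^ N)) = (1 : ℕ) := by
      rw [Nat.cast_one, ← h, ← map_natCast f, hx]
    rw [ZMod.natCast_eq_natCast_iff] at h'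
    have h'' : x.val % 2 = 1 % 2 := h'.of_dvd h2
    exact ⟨x.val / 2, by
      rw [show 2 * (x.val / 2) + 1 = x.val by omega, nsmul_one, hx]⟩

end ChineseRemainder

end IsingCM

end

theorem theorem4p3 {k : Type w} [Field k] [IsAlgClosed k] [CharZero k]
    {I : Type u} [Category.{v} I] [Preadditive I] [Linear k I] [MonoidalCategory I]
    [MonoidalPreadditive I] [MonoidalLinear k I] (hI : IsingCM.IsFusion k I)
    (δ Z : I) (hZ : IsingCM.IsIsing δ Z)
    (M N m : ℕ) (hN : 1 ≤ N) (hm : Odd m) (hM : M = 2 ^ N * m) :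
    IsingCM.IsFusion k (IsingCM.Vec k (ZMod m)) ∧ IsingCM.IsPointed (IsingCM.Vec k (ZMod m)) ∧
    ∃ (F : IsingCM.CM k Z M ⥤
        IsingCM.DeligneProduct k (IsingCM.CM k Z (2 ^ N)) (IsingCM.Vec k (ZMod m)))
      (_ : F.Monoidal),
      F.IsEquivalence ∧ F.Additive ∧ F.Linear k ∧
      ∀ _ : BraidedCategory (IsingCM.CM k Z M),
        ∃ (_ : BraidedCategory (IsingCM.CM k Z (2 ^ N)))
          (_ : BraidedCategory (IsingCM.Vec k (ZMod m))),
          IsingCM.IsBraidedFunctor F := by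
  have : NeZero m := ⟨hm.pos.ne'⟩
  refine ⟨IsingCM.isFusion_vec, IsingCM.isPointed_vec, ?_⟩
  subst hM
  have hco : (2 ^ N).Coprime m := (Nat.coprime_two_left.2 hm).pow_left N
  let e := ZMod.chineseRemainder hco
  let f : ZMod (2 ^ N * m) →+* ZMod (2 ^ N) := (RingHom.fst _ _).comp e.toRingHom
  -- The even exponent `2 * n` is to be the order `2 ^ N` of the first factor, whence `n = 2 ^ (N -
  -- 1)`. It is coprime to `q = m` because `m` is odd.
  have hN' : 2 * 2 ^ (N - 1) = 2 ^ N := by rw [← pow_succ', Nat.sub_add_cancel hN]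
  -- `φ` and `ψ` are the coordinate inclusions of the Chinese remainder isomorphism, and `π₁`, `π₂`
  -- its coordinates; all the distinguished degrees are `1`, so `π₁ g₃ = g₁` is `map_one`.
  refine IsingCM.generated_boxLine_factorization hZ (hI.hasScalarEnd hI.simple_unit)
    (hI.hasScalarEnd hZ.simple_Z)
    (e.symm.toAddMonoidHom.comp (AddMonoidHom.inl (ZMod (2 ^ N)) (ZMod m)))
    (e.symm.toAddMonoidHom.comp (AddMonoidHom.inr (ZMod (2 ^ N)) (ZMod m)))
    f.toAddMonoidHom (fun g => (e g).2) (fun g g' h h' heq => ?_) (fun g => ?_) (map_one f)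
    ((IsingCM.ZMod.exists_even_or_odd_nsmul hN hm.pos f _).2 ?_)
    (fun h => (IsingCM.ZMod.exists_even_or_odd_nsmul hN hm.pos f _).1 ?_)
    (n := 2 ^ (N - 1)) (q := m) ?_ (fun v => ?_) ?_
  · have : e.symm ((g, 0) + (0, h)) = e.symm ((g', 0) + (0, h')) := by
      rw [map_add, map_add]; exact heq
    simpa using e.symm.injective this
  · change e.symm ((e g).1, 0) + e.symm (0, (e g).2) = g
    rw [← map_add]
    simp
  · change (e (e.symm (1, 0))).1 = 1
    simp
  · change (e (e.symm (0, h))).1 = 0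
    simp
  · rw [hN', nsmul_one, ZMod.natCast_self]
  · rw [nsmul_eq_mul, ZMod.natCast_self, zero_mul]
  · rwa [hN']
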